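/- **Conventions.** Let $n\ge 0$ and $[m]=\{1,\dots,m\}$. For $D\subseteq[m-1]$ let $F_{m,D}=\sum x_{i_1}\cdots x_{i_m}$, the sum over $i_1\le\cdots\le i_m$ with $i_j<i_{j+1}$ whenever $j\in D$, be the fundamental quasisymmetric function of degree $m$. The descent set of a permutation $w$ of $[m]$, written as a word, is the set of $i\in[m-1]$ such that $i$ lies to the right of $i+1$ in $w$. For a partition $\lambda$ of $m$, $s_\lambda=\sum_T F_{m,\mathrm{Des}(T)}$ is the Schur function, the sum over standard Young tableaux $T$ of shape $\lambda$ (French notation), where $\mathrm{Des}(T)$ is the descent set of the row reading word (rows left to right, from the top row to the bottom row). **Signed standard tableaux.** Identify a strict partition $\gamma$ of $n$ with its shifted diagram (French notation, row $i$ shifted $i-1$ columns to the right). A signed standard tableau of shape $\gamma$ is a bijective filling of the cells of $\gamma$ with $1,\dots,n$, each entry being marked or unmarked, such that the absolute values increase along rows and up columns and no entry on the main diagonal is marked; $\mathrm{SST}(\gamma)$ is the set of these. The hook reading word of $S$ reads, for $i$ from largest to smallest, the marked entries of column $i$ from bottom to top and then the unmarked entries of row $i$ from left to right; $\mathrm{Des}(S)$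 is the descent set of this word (marks ignored). The Schur $P$-function is $P_\gamma=\sum_{S\in\mathrm{SST}(\gamma)}F_{n,\mathrm{Des}(S)}$. **The involutions.** The map $d_0$ toggles the mark on the entry $2$ (and is the identity if $n\le 1$). For $1<i<n$, let $a\le b\le c$ be the diagonals (row minus column if unmarked, column minus row if marked) on which $i-1,i,i+1$ lie in $S$. Then $d_i(S)$ is given by: 1. if $i$ lies on diagonal $b$, then $d_i(S)=S$; 2. else, if $a=b$ (respectively $b=c$), toggle the mark on the letter on diagonal $c$ (respectively $a$); 3. else, if $\big||a|-|c|\big|=1$, toggle the marks on the letters on diagonals $a$ and $c$; 4. else, swap the absolute values of the letters on diagonals $a$ and $c$, keeping the marks in the given cells. **Dual equivalence.** Let $\mathcal A$ be a finite set and $\mathrm{Des}$ a map from $\mathcal A$ to subsets of $[n-1]$. A dual equivalence for $(\mathcal A,\mathrm{Des})$ is a family of involutions $\{\varphi_i\}_{1<i<n}$ on $\mathcal A$ such that * for all $1<h\le i<n$ with $i-h\le 3$ and all $T\in\mathcal A$ there is a partition $\lambda$ of $i-h+3$ with $$\sum_{U\in[T]_{(h,i)}}F_{i-h+3,\,\mathrm{Des}_{(h-1,i+1)}(U)}=s_\lambda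 ,$$ where $[T]_{(h,i)}$ is the equivalence class of $T$ generated by $\varphi_h,\dots,\varphi_i$, and $\mathrm{Des}_{(h-1,i+1)}(U)=\{x-(h-2): x\in\mathrm{Des}(U),\ h-1\le x<i+1\}$; * $\varphi_j\varphi_i=\varphi_i\varphi_j$ for all $1<i,j<n$ with $|i-j|\ge 3$. **Queer dual equivalence.** A queer dual equivalence for $(\mathcal A,\mathrm{Des})$ is a dual equivalence $\{\psi_i\}_{1<i<n}$ together with an involution $\psi_0$ on $\mathcal A$ such that, writing $[S]_{\le i}$ for the equivalence class of $S$ generated by the $\psi_h$ with $h\le i$, $h\ne 1$: * (i) for $i\in\{1,2,3\}$ with $i<n$ and all $S\in\mathcal A$ there is a strict partition $\gamma$ of $i+1$ with $\sum_{U\in[S]_{\le i}}F_{i+1,\,\mathrm{Des}(U)\cap[i]}=P_\gamma$; * (ii) $\psi_0\psi_i=\psi_i\psi_0$ for all $3<i<n$; * (iii) for all $0\le k<n$ and $S,T\in\mathcal A$ with $T\in[S]_{\le k}$, there is a (possibly empty) finite sequence of indices $i_1,\dots,i_j\in\{0,2,3,\dots,k\}$, at most two of which equal $k$, such that $T=\psi_{i_j}\cdots\psi_{i_1}S$.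 (For $k\le 1$ the index set is $\{0\}$.) **Theorem.** For every $n$ and every strict partition $\gamma$ of $n$, the maps $d_0$ and $\{d_i\}_{1<i<n}$ send $\mathrm{SST}(\gamma)$ to itself and form a queer dual equivalence for $(\mathrm{SST}(\gamma),\mathrm{Des})$. Likewise, they form a queer dual equivalence for the set $\bigsqcup_{\gamma}\mathrm{SST}(\gamma)$ of all signed standard tableaux of size $n$, $\gamma$ running over the strict partitions of $n$. -/

import Mathlib

/-! ### Words, descents and fundamental quasisymmetric functions -/

/-- The descent set of a word `w` that is a permutation of `[n] = {1, …, n}`: the letters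
`i ∈ [n-1]` that lie to the right of `i + 1` in `w`. -/
def wordDescents (n : ℕ) (w : List ℕ) : Finset ℕ :=
  (Finset.Ico 1 n).filter fun i => w.idxOf (i + 1) < w.idxOf i

/-- The fundamental quasisymmetric function `F_D` of degree `n`, for `D ⊆ [n-1]`, in the countably
many variables `x_0, x_1, …`. The coefficient of a monomial `m` is the number of sequences
`i_1 ≤ ⋯ ≤ i_n` with `i_j < i_{j+1}` for `j ∈ D` and `x_{i_1} ⋯ x_{i_n} = m`
(here `i_{j+1}` is `s j`). -/
noncomputable def fundamentalQSym (n : ℕ) (D : Finset ℕ) : MvPowerSeries ℕ ℤ := fun m =>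
  (Set.ncard {s : Fin n → ℕ | Monotone s ∧
    (∀ (j : ℕ) (hj : j + 1 < n), j + 1 ∈ D → s ⟨j, by omega⟩ < s ⟨j + 1, hj⟩) ∧
    ∑ k, Finsupp.single (s k) 1 = m} : ℤ)

/-! ### Standard Young tableaux and Schur functions -/

/-- A standard Young tableau: a bijective filling of a Young diagram with `1, …, |μ|`, with entries
increasing along rows and columns. The cell `(r, c)` is in row `r`, column `c` (from `0`); in
French notation row `0` is the bottom row. -/
structure StandardTableau (μ : YoungDiagram) where
  entry : μ.cells ≃ Finset.Icc 1 μ.card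
  row_le : ∀ x y : μ.cells, x.1.1 = y.1.1 → x.1.2 ≤ y.1.2 → entry x ≤ entry y
  col_lt : ∀ x y : μ.cells, x.1.2 = y.1.2 → x.1.1 < y.1.1 → entry x < entry y

namespace StandardTableau

variable {μ : YoungDiagram}

theorem entry_injective :
    Function.Injective (entry : StandardTableau μ → (μ.cells ≃ Finset.Icc 1 μ.card)) := by
  rintro ⟨e, _, _⟩ ⟨e', _, _⟩ h
  cases h
  rfl

noncomputable instance : Fintype (StandardTableau μ) := Fintype.ofInjective _ entry_injective

/-- The row reading word: the rows are read left to right, from the top row to the bottom row. -/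
def rowWord (T : StandardTableau μ) : List ℕ :=
  (List.range μ.card).reverse.flatMap fun r =>
    (List.range μ.card).filterMap fun c =>
      if h : (r, c) ∈ μ.cells then some (T.entry ⟨(r, c), h⟩ : ℕ) else none

end StandardTableau

/-- The Schur function `s_μ`. -/
noncomputable def schurFunction (μ : YoungDiagram) : MvPowerSeries ℕ ℤ :=
  ∑ T : StandardTableau μ, fundamentalQSym μ.card (wordDescents μ.card T.rowWord)

/-! ### Strict partitions and shifted diagrams -/

/-- A strict partition of `n`, given by its (unshifted) Young diagram. -/
structure StrictPartition (n : ℕ) where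
  diagram : YoungDiagram
  card_eq : diagram.card = n
  /-- the parts strictly decrease -/
  strict : ∀ r s, r < s → 0 < diagram.rowLen s → diagram.rowLen s < diagram.rowLen r

namespace StrictPartition

variable {n : ℕ}

theorem cells_subset (γ : StrictPartition n) :
    γ.diagram.cells ⊆ Finset.range n ×ˢ Finset.range n := by
  rintro ⟨r, c⟩ h
  have hm : (r, c) ∈ γ.diagram := h
  have h1 : (γ.diagram.col c).card ≤ γ.diagram.card := Finset.card_le_card (Finset.filter_subset _ _)
  have h2 : (γ.diagram.row r).card ≤ γ.diagram.card := Finset.card_le_card (Finset.filter_subset _ _)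
  rw [← YoungDiagram.colLen_eq_card, γ.card_eq] at h1
  rw [← YoungDiagram.rowLen_eq_card, γ.card_eq] at h2
  have h3 := YoungDiagram.mem_iff_lt_colLen.1 hm
  have h4 := YoungDiagram.mem_iff_lt_rowLen.1 hm
  simp only [Finset.mem_product, Finset.mem_range]
  omega

noncomputable instance : Fintype (StrictPartition n) :=
  Fintype.ofInjective
    (fun γ => (⟨γ.diagram.cells, Finset.mem_powerset.2 γ.cells_subset⟩ :
      (Finset.range n ×ˢ Finset.range n).powerset)) (by
    rintro ⟨⟨c, _⟩, _, _⟩ ⟨⟨c', _⟩, _, _⟩ h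
    simp only [Subtype.mk.injEq] at h
    cases h
    rfl)

/-- The cells of the shifted diagram: row `r` (from `0`) of the Young diagram is shifted `r` columns
to the right. -/
def shiftedCells (γ : StrictPartition n) : Finset (ℕ × ℕ) :=
  γ.diagram.cells.image fun x => (x.1, x.1 + x.2)

theorem mem_shiftedCells {γ : StrictPartition n} {r c : ℕ} :
    (r, c) ∈ γ.shiftedCells ↔ r ≤ c ∧ c < r + γ.diagram.rowLen r := by
  simp only [shiftedCells, Finset.mem_image, Prod.exists, Prod.mk.injEq, YoungDiagram.mem_cells,
    YoungDiagram.mem_iff_lt_rowLen]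
  constructor
  · rintro ⟨a, b, h, rfl, rfl⟩
    omega
  · rintro ⟨h1, h2⟩
    exact ⟨r, c - r, by omega, rfl, by omega⟩

theorem add_rowLen_le (γ : StrictPartition n) {r s : ℕ} (hrs : r ≤ s)
    (hs : 0 < γ.diagram.rowLen s) : s + γ.diagram.rowLen s ≤ r + γ.diagram.rowLen r := by
  induction s, hrs using Nat.le_induction with
  | base => exact le_rfl
  | succ s _ ih =>
    have := γ.strict s (s + 1) (by omega) hs
    have := ih (by omega)
    omega

end StrictPartition

/-! ### Signed standard tableaux -/

/-- A bijective filling of the shifted diagram of `γ` with the letters of a signed permutation: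
`entry` is the absolute value of the letter in a cell, and `marked` says whether it is marked. -/
structure SignedFilling {n : ℕ} (γ : StrictPartition n) where
  entry : γ.shiftedCells ≃ Finset.Icc 1 n
  marked : γ.shiftedCells → Bool

namespace SignedFilling

variable {n : ℕ} {γ : StrictPartition n}

/-- The conditions for a signed filling to be a signed standard tableau. -/
structure IsStandard (S : SignedFilling γ) : Prop where
  row_le : ∀ x y : γ.shiftedCells, x.1.1 = y.1.1 → x.1.2 ≤ y.1.2 → S.entry x ≤ S.entry y
  col_le : ∀ x y : γ.shiftedCells, x.1.2 = y.1.2 → x.1.1 ≤ y.1.1 → S.entry x ≤ S.entry y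
  diag_unmarked : ∀ x : γ.shiftedCells, x.1.1 = x.1.2 → S.marked x = false

theorem pair_injective : Function.Injective fun S : SignedFilling γ => (S.entry, S.marked) := by
  rintro ⟨e, m⟩ ⟨e', m'⟩ h
  simp only [Prod.mk.injEq] at h
  obtain ⟨rfl, rfl⟩ := h
  rfl

noncomputable instance : Fintype (SignedFilling γ) := Fintype.ofInjective _ pair_injective

/-- The hook reading word: for `i` from largest to smallest, read the marked entries of column `i`
from bottom to top (increasing row index), then the unmarked entries of row `i` from left to
right. -/
def hookWord (S : SignedFilling γ) : List ℕ :=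
  (List.range n).reverse.flatMap fun i =>
    ((List.range n).filterMap fun r =>
      if h : (r, i) ∈ γ.shiftedCells then
        if S.marked ⟨(r, i), h⟩ = true then some (S.entry ⟨(r, i), h⟩ : ℕ) else none
      else none) ++
    ((List.range n).filterMap fun c =>
      if h : (i, c) ∈ γ.shiftedCells then
        if S.marked ⟨(i, c), h⟩ = false then some (S.entry ⟨(i, c), h⟩ : ℕ) else none
      else none)

/-- The diagonal on which the letter with absolute value `k` resides: row minus column if it is
unmarked, column minus row if it is marked. -/
def diag (S : SignedFilling γ) (k : Finset.Icc 1 n) : ℤ :=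
  if S.marked (S.entry.symm k) = true then
    ((S.entry.symm k).1.2 : ℤ) - (S.entry.symm k).1.1
  else ((S.entry.symm k).1.1 : ℤ) - (S.entry.symm k).1.2

/-- Toggle the mark on the letter with absolute value `k`. -/
def toggle (S : SignedFilling γ) (k : Finset.Icc 1 n) : SignedFilling γ where
  entry := S.entry
  marked x := if S.entry x = k then !S.marked x else S.marked x

/-- Swap the absolute values `k` and `l`, keeping the marks in the given cells. -/
def swapValues (S : SignedFilling γ) (k l : Finset.Icc 1 n) : SignedFilling γ where
  entry := S.entry.trans (Equiv.swap k l)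
  marked := S.marked

/-- The one of the three letters `p`, `q`, `r` that lies on diagonal `x`, where `x` is
one of the three diagonals on which these letters lie. -/
def letterOn (S : SignedFilling γ) (p q r : Finset.Icc 1 n) (x : ℤ) : Finset.Icc 1 n :=
  if S.diag p = x then p else if S.diag q = x then q else r

/-- The smallest of the diagonals of the three letters `p`, `q`, `r`. -/
def loDiag (S : SignedFilling γ) (p q r : Finset.Icc 1 n) : ℤ :=
  min (S.diag p) (min (S.diag q) (S.diag r))

/-- The largest of the diagonals of the three letters `p`, `q`, `r`. -/
def hiDiag (S : SignedFilling γ) (p q r : Finset.Icc 1 n) : ℤ :=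
  max (S.diag p) (max (S.diag q) (S.diag r))

/-- The middle one of the diagonals of the three letters `p`, `q`, `r` (with multiplicity). -/
def midDiag (S : SignedFilling γ) (p q r : Finset.Icc 1 n) : ℤ :=
  S.diag p + S.diag q + S.diag r - S.loDiag p q r - S.hiDiag p q r

/-- The dual equivalence move for the letters `p = i - 1`, `q = i`, `r = i + 1`, on diagonals
`a ≤ b ≤ c`. -/
def dualMove (S : SignedFilling γ) (p q r : Finset.Icc 1 n) : SignedFilling γ :=
  let a := S.loDiag p q r
  let b := S.midDiag p q r
  let c := S.hiDiag p q r
  if S.diag q = b then S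
  else if a = b then S.toggle (S.letterOn p q r c)
  else if b = c then S.toggle (S.letterOn p q r a)
  else if |(|a| - |c|)| = 1 then (S.toggle (S.letterOn p q r a)).toggle (S.letterOn p q r c)
  else S.swapValues (S.letterOn p q r a) (S.letterOn p q r c)

/-- The elementary involutions: `d 0` toggles the mark on the letter with absolute value `2` (if
there is one), and `d i` for `1 < i < n` is the dual equivalence move on `i - 1, i, i + 1`. For the
remaining `i`, which carry no involution, it is the identity. -/
def d (i : ℕ) (S : SignedFilling γ) : SignedFilling γ :=
  if i = 0 then
    if h : 2 ≤ n then S.toggle ⟨2, Finset.mem_Icc.2 ⟨by omega, h⟩⟩ else S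
  else if h : 1 < i ∧ i < n then
    S.dualMove ⟨i - 1, Finset.mem_Icc.2 (by omega)⟩ ⟨i, Finset.mem_Icc.2 (by omega)⟩
      ⟨i + 1, Finset.mem_Icc.2 (by omega)⟩
  else S

/-! The elementary involutions preserve signed standard tableaux. -/

theorem diag_cases (S : SignedFilling γ) (k : Finset.Icc 1 n) :
    (S.marked (S.entry.symm k) = true ∧
      S.diag k = ((S.entry.symm k).1.2 : ℤ) - (S.entry.symm k).1.1) ∨
    (S.marked (S.entry.symm k) = false ∧
      S.diag k = ((S.entry.symm k).1.1 : ℤ) - (S.entry.symm k).1.2) := by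
  unfold diag
  split_ifs with h
  · exact Or.inl ⟨h, rfl⟩
  · exact Or.inr ⟨by simpa using h, rfl⟩

theorem abs_diag (S : SignedFilling γ) (x : γ.shiftedCells) :
    |S.diag (S.entry x)| = (x.1.2 : ℤ) - x.1.1 := by
  have hx : x.1.1 ≤ x.1.2 := (StrictPartition.mem_shiftedCells.1 x.2).1
  have h := S.diag_cases (S.entry x)
  rw [Equiv.symm_apply_apply] at h
  rcases h with ⟨_, h⟩ | ⟨_, h⟩ <;> rw [h]
  · rw [abs_of_nonneg (by omega)]
  · rw [abs_of_nonpos (by omega)]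
    ring

theorem IsStandard.toggle {S : SignedFilling γ} (hS : S.IsStandard) {k : Finset.Icc 1 n}
    (hk : S.diag k ≠ 0) : (S.toggle k).IsStandard where
  row_le := hS.row_le
  col_le := hS.col_le
  diag_unmarked x hx := by
    have hne : S.entry x ≠ k := by
      rintro rfl
      apply hk
      have := S.abs_diag x
      rw [← abs_eq_zero, this]
      omega
    simp only [SignedFilling.toggle, if_neg hne]
    exact hS.diag_unmarked x hx

theorem IsStandard.lt_of {S : SignedFilling γ} (hS : S.IsStandard) {x y : γ.shiftedCells}
    (hne : x ≠ y) (h1 : x.1.1 ≤ y.1.1) (h2 : x.1.2 ≤ y.1.2) : S.entry x < S.entry y := by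
  obtain ⟨⟨r, c⟩, hx⟩ := x
  obtain ⟨⟨s, e⟩, hy⟩ := y
  simp only at h1 h2
  have hx' := StrictPartition.mem_shiftedCells.1 hx
  have hy' := StrictPartition.mem_shiftedCells.1 hy
  have hl := γ.add_rowLen_le h1 (by omega)
  have hz : (r, e) ∈ γ.shiftedCells := StrictPartition.mem_shiftedCells.2 ⟨by omega, by omega⟩
  refine lt_of_le_of_ne ((hS.row_le ⟨_, hx⟩ ⟨_, hz⟩ rfl h2).trans (hS.col_le ⟨_, hz⟩ ⟨_, hy⟩ rfl h1)) ?_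
  exact fun h => hne (S.entry.injective h)

theorem IsStandard.gap {S : SignedFilling γ} (hS : S.IsStandard) {x y : γ.shiftedCells}
    (hd : (x.1.2 : ℤ) - x.1.1 = (y.1.2 : ℤ) - y.1.1) (h0 : x.1.1 < x.1.2) (hr : x.1.1 < y.1.1) :
    (S.entry x : ℕ) + 3 ≤ S.entry y := by
  obtain ⟨⟨r, c⟩, hx⟩ := x
  obtain ⟨⟨s, e⟩, hy⟩ := y
  simp only at hd h0 hr
  have hx' := StrictPartition.mem_shiftedCells.1 hx
  have hy' := StrictPartition.mem_shiftedCells.1 hy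
  have hl := γ.add_rowLen_le (r := r) (s := s) (by omega) (by omega)
  have hl' := γ.add_rowLen_le (r := r + 1) (s := s) (by omega) (by omega)
  have hz : (r + 1, c) ∈ γ.shiftedCells :=
    StrictPartition.mem_shiftedCells.2 ⟨by omega, by omega⟩
  have hz' : (r, c + 1) ∈ γ.shiftedCells :=
    StrictPartition.mem_shiftedCells.2 ⟨by omega, by omega⟩
  have a1 : S.entry ⟨_, hx⟩ < S.entry ⟨_, hz⟩ := hS.lt_of (by simp) (by simp) (by simp)
  have a2 : S.entry ⟨_, hx⟩ < S.entry ⟨_, hz'⟩ := hS.lt_of (by simp) (by simp) (by simp)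
  have a3 : S.entry ⟨_, hz⟩ < S.entry ⟨_, hy⟩ :=
    hS.lt_of (by simp; omega) (by simp; omega) (by simp; omega)
  have a4 : S.entry ⟨_, hz'⟩ < S.entry ⟨_, hy⟩ :=
    hS.lt_of (by simp; omega) (by simp; omega) (by simp; omega)
  have a5 : S.entry ⟨_, hz⟩ ≠ S.entry ⟨_, hz'⟩ := fun h => by simpa using S.entry.injective h
  rw [← Subtype.coe_lt_coe] at a1 a2 a3 a4
  rw [Ne, ← Subtype.coe_inj] at a5
  omega

theorem IsStandard.diag_ne {S : SignedFilling γ} (hS : S.IsStandard) {p r : Finset.Icc 1 n}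
    (hlt : (p : ℕ) < r) (hpr : (r : ℕ) < p + 3) (h0 : S.diag p ≠ 0) : S.diag p ≠ S.diag r := by
  intro h
  obtain ⟨x, rfl⟩ := S.entry.surjective p
  obtain ⟨y, rfl⟩ := S.entry.surjective r
  have hx := S.abs_diag x
  have hy := S.abs_diag y
  have hp := abs_pos.2 h0
  rw [← h] at hy
  have hd : (x.1.2 : ℤ) - x.1.1 = (y.1.2 : ℤ) - y.1.1 := by omega
  rcases lt_trichotomy x.1.1 y.1.1 with hr | hr | hr
  · have := hS.gap hd (by omega) hr
    omega
  · have : x = y := Subtype.ext (Prod.ext hr (by omega))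
    subst this
    omega
  · have := hS.gap hd.symm (by omega) hr
    omega

theorem IsStandard.adjacent {S : SignedFilling γ} (hS : S.IsStandard) {x y : γ.shiftedCells}
    (h : x.1.1 = y.1.1 ∧ x.1.2 < y.1.2 ∨ x.1.2 = y.1.2 ∧ x.1.1 < y.1.1)
    (hv : (S.entry y : ℕ) ≤ S.entry x + 1) :
    |(|S.diag (S.entry x)| - |S.diag (S.entry y)|)| = 1 := by
  rw [abs_diag, abs_diag]
  obtain ⟨⟨r, c⟩, hx⟩ := x
  obtain ⟨⟨s, e⟩, hy⟩ := y
  simp only at h ⊢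
  have hx' := StrictPartition.mem_shiftedCells.1 hx
  have hy' := StrictPartition.mem_shiftedCells.1 hy
  rcases h with ⟨rfl, h⟩ | ⟨rfl, h⟩
  · by_cases hc : e = c + 1
    · subst hc
      rw [abs_eq (by norm_num)]
      push_cast
      omega
    · have hz : (r, c + 1) ∈ γ.shiftedCells :=
        StrictPartition.mem_shiftedCells.2 ⟨by omega, by omega⟩
      have a1 : S.entry ⟨_, hx⟩ < S.entry ⟨_, hz⟩ := hS.lt_of (by simp) (by simp) (by simp)
      have a2 : S.entry ⟨_, hz⟩ < S.entry ⟨_, hy⟩ :=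
        hS.lt_of (by simp; omega) (by simp) (by simp; omega)
      rw [← Subtype.coe_lt_coe] at a1 a2
      omega
  · by_cases hc : s = r + 1
    · subst hc
      rw [abs_eq (by norm_num)]
      push_cast
      omega
    · have hl := γ.add_rowLen_le (r := r + 1) (s := s) (by omega) (by omega)
      have hz : (r + 1, c) ∈ γ.shiftedCells :=
        StrictPartition.mem_shiftedCells.2 ⟨by omega, by omega⟩
      have a1 : S.entry ⟨_, hx⟩ < S.entry ⟨_, hz⟩ := hS.lt_of (by simp) (by simp) (by simp)
      have a2 : S.entry ⟨_, hz⟩ < S.entry ⟨_, hy⟩ :=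
        hS.lt_of (by simp; omega) (by simp; omega) (by simp)
      rw [← Subtype.coe_lt_coe] at a1 a2
      omega

theorem swap_le_swap {k l u v : Finset.Icc 1 n} (hkl : (k : ℕ) + 1 = l ∨ (l : ℕ) + 1 = k)
    (huv : u ≤ v) (h1 : ¬ (u = k ∧ v = l)) (h2 : ¬ (u = l ∧ v = k)) :
    Equiv.swap k l u ≤ Equiv.swap k l v := by
  rw [← Subtype.coe_le_coe] at huv ⊢
  simp only [Equiv.swap_apply_def]
  have e : ∀ a b : Finset.Icc 1 n, a = b ↔ (a : ℕ) = b := fun a b => Subtype.ext_iff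
  simp only [e] at h1 h2 ⊢
  split_ifs <;> omega

theorem IsStandard.swapValues {S : SignedFilling γ} (hS : S.IsStandard) {k l : Finset.Icc 1 n}
    (hkl : (k : ℕ) + 1 = l ∨ (l : ℕ) + 1 = k) (hd : |(|S.diag k| - |S.diag l|)| ≠ 1) :
    (S.swapValues k l).IsStandard := by
  have key : ∀ x y : γ.shiftedCells, S.entry x ≤ S.entry y →
      (x.1.1 = y.1.1 ∧ x.1.2 ≤ y.1.2 ∨ x.1.2 = y.1.2 ∧ x.1.1 ≤ y.1.1) →
      Equiv.swap k l (S.entry x) ≤ Equiv.swap k l (S.entry y) := by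
    intro x y hle hxy
    by_cases hxe : x = y
    · rw [hxe]
    have hxy' : x.1.1 = y.1.1 ∧ x.1.2 < y.1.2 ∨ x.1.2 = y.1.2 ∧ x.1.1 < y.1.1 := by
      have : ¬ (x.1.1 = y.1.1 ∧ x.1.2 = y.1.2) := fun h =>
        hxe (Subtype.ext (Prod.ext h.1 h.2))
      omega
    refine swap_le_swap hkl hle ?_ ?_
    · rintro ⟨rfl, rfl⟩
      exact hd (hS.adjacent hxy' (by omega))
    · rintro ⟨rfl, rfl⟩
      rw [abs_sub_comm] at hd
      exact hd (hS.adjacent hxy' (by omega))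
  exact ⟨fun x y h1 h2 => key x y (hS.row_le x y h1 h2) (Or.inl ⟨h1, h2⟩),
    fun x y h1 h2 => key x y (hS.col_le x y h1 h2) (Or.inr ⟨h1, h2⟩), hS.diag_unmarked⟩

theorem diag_toggle_of_ne (S : SignedFilling γ) {k l : Finset.Icc 1 n} (h : l ≠ k) :
    (S.toggle k).diag l = S.diag l := by
  simp [diag, SignedFilling.toggle, h]

theorem letterOn_spec (S : SignedFilling γ) {p q r : Finset.Icc 1 n} {x : ℤ}
    (h : S.diag p = x ∨ S.diag q = x ∨ S.diag r = x) :
    S.diag (S.letterOn p q r x) = x ∧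
      (S.letterOn p q r x = p ∨ S.letterOn p q r x = q ∨ S.letterOn p q r x = r) := by
  unfold letterOn
  split_ifs with h1 h2
  · exact ⟨h1, by simp⟩
  · exact ⟨h2, by simp⟩
  · exact ⟨by tauto, by simp⟩

theorem IsStandard.dualMove {S : SignedFilling γ} (hS : S.IsStandard) {p q r : Finset.Icc 1 n}
    (hpq : (p : ℕ) + 1 = q) (hqr : (q : ℕ) + 1 = r) : (S.dualMove p q r).IsStandard := by
  have hne : S.diag p ≠ 0 → S.diag p ≠ S.diag r := hS.diag_ne (by omega) (by omega)
  have ha := S.letterOn_spec (p := p) (q := q) (r := r) (x := S.loDiag p q r)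
    (by unfold loDiag; omega)
  have hc := S.letterOn_spec (p := p) (q := q) (r := r) (x := S.hiDiag p q r)
    (by unfold hiDiag; omega)
  have hb : S.midDiag p q r =
    S.diag p + S.diag q + S.diag r - S.loDiag p q r - S.hiDiag p q r := rfl
  have hlo : S.loDiag p q r = min (S.diag p) (min (S.diag q) (S.diag r)) := rfl
  have hhi : S.hiDiag p q r = max (S.diag p) (max (S.diag q) (S.diag r)) := rfl
  unfold SignedFilling.dualMove
  simp only
  split_ifs with h1 h2 h3 h4
  · exact hS
  · refine hS.toggle ?_
    rw [hc.1]
    omega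
  · refine hS.toggle ?_
    rw [ha.1]
    omega
  · have hlc : S.letterOn p q r (S.hiDiag p q r) ≠ S.letterOn p q r (S.loDiag p q r) := by
      intro h
      have := congrArg S.diag h
      rw [ha.1, hc.1] at this
      omega
    rw [abs_eq (by norm_num)] at h4
    refine (hS.toggle ?_).toggle ?_
    · rw [ha.1]
      intro h0
      rw [h0, abs_zero, abs_of_nonneg (by omega)] at h4
      omega
    · rw [diag_toggle_of_ne _ hlc, hc.1]
      intro h0
      rw [h0, abs_zero, abs_of_nonpos (by omega)] at h4
      omega
  · refine hS.swapValues ?_ (by rw [ha.1, hc.1]; exact h4)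
    obtain ⟨ha1, ha2⟩ := ha
    obtain ⟨hc1, hc2⟩ := hc
    rcases ha2 with ha2 | ha2 | ha2 <;> rcases hc2 with hc2 | hc2 | hc2 <;>
      rw [ha2] at ha1 <;> rw [hc2] at hc1 <;> rw [ha2, hc2] <;> omega

theorem IsStandard.diag_two {S : SignedFilling γ} (hS : S.IsStandard) (h : 2 ≤ n) :
    S.diag ⟨2, Finset.mem_Icc.2 ⟨by omega, h⟩⟩ ≠ 0 := by
  intro h0
  obtain ⟨x, hx⟩ := S.entry.surjective ⟨2, Finset.mem_Icc.2 ⟨by omega, h⟩⟩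
  have hx2 : (S.entry x : ℕ) = 2 := by rw [hx]
  rw [← hx, ← abs_eq_zero, abs_diag] at h0
  obtain ⟨⟨r, c⟩, hm⟩ := x
  simp only at h0
  obtain rfl : c = r := by omega
  have hm' := StrictPartition.mem_shiftedCells.1 hm
  rcases Nat.eq_zero_or_pos c with rfl | hc
  · obtain ⟨y, hy⟩ := S.entry.surjective ⟨1, Finset.mem_Icc.2 ⟨le_rfl, by omega⟩⟩
    have hlt : S.entry ⟨(0, 0), hm⟩ < S.entry y := hS.lt_of
      (by rintro rfl; rw [hy] at hx2; simp at hx2) (by simp) (by simp)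
    rw [hy, ← Subtype.coe_lt_coe, hx2] at hlt
    simp at hlt
  · have hl := γ.add_rowLen_le (r := c - 1) (s := c) (by omega) (by omega)
    have m1 : (c - 1, c - 1) ∈ γ.shiftedCells :=
      StrictPartition.mem_shiftedCells.2 ⟨by omega, by omega⟩
    have m2 : (c - 1, c) ∈ γ.shiftedCells :=
      StrictPartition.mem_shiftedCells.2 ⟨by omega, by omega⟩
    have a1 : S.entry ⟨_, m1⟩ < S.entry ⟨_, m2⟩ := hS.lt_of (by simp; omega) (by simp) (by simp)
    have a2 : S.entry ⟨_, m2⟩ < S.entry ⟨_, hm⟩ := hS.lt_of (by simp; omega) (by simp) (by simp)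
    have a3 := (Finset.mem_Icc.1 (S.entry ⟨_, m1⟩).2).1
    rw [← Subtype.coe_lt_coe] at a1 a2
    omega

theorem IsStandard.d {S : SignedFilling γ} (hS : S.IsStandard) (i : ℕ) : (S.d i).IsStandard := by
  unfold SignedFilling.d
  split_ifs with h1 h2 h3
  · exact hS.toggle (hS.diag_two h2)
  · exact hS
  · exact hS.dualMove (by simp only; omega) rfl
  · exact hS

end SignedFilling

/-- Signed standard tableaux of strict shape `γ`. -/
def SignedStandardTableau {n : ℕ} (γ : StrictPartition n) : Type :=
  {S : SignedFilling γ // S.IsStandard}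

namespace SignedStandardTableau

variable {n : ℕ} {γ : StrictPartition n}

noncomputable instance : Fintype (SignedStandardTableau γ) :=
  Fintype.ofInjective (fun S => S.1) Subtype.val_injective

/-- The descent set of a signed standard tableau: that of its hook reading word. -/
def des (S : SignedStandardTableau γ) : Finset ℕ := wordDescents n S.1.hookWord

/-- The elementary involutions `d_0` and `d_i`, `1 < i < n`, on signed standard tableaux. -/
def d (i : ℕ) (S : SignedStandardTableau γ) : SignedStandardTableau γ := ⟨S.1.d i, S.2.d i⟩

end SignedStandardTableau

/-- The Schur `P`-function `P_γ`. -/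
noncomputable def schurP {n : ℕ} (γ : StrictPartition n) : MvPowerSeries ℕ ℤ :=
  ∑ S : SignedStandardTableau γ, fundamentalQSym n S.des

/-! ### Dual equivalence and queer dual equivalence -/

/-- Delete from `D` the letters less than `h` and weakly greater than `i`, and subtract `h - 1` from
the letters that remain. -/
def restrictDescents (h i : ℕ) (D : Finset ℕ) : Finset ℕ :=
  (D.filter fun x => h ≤ x ∧ x < i).image fun x => x - (h - 1)

/-- `GenEquiv φ I` is the equivalence relation generated by the maps `φ j` with `j ∈ I`. -/
def GenEquiv {A : Type*} (φ : ℕ → A → A) (I : Set ℕ) : A → A → Prop :=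
  Relation.EqvGen fun S T => ∃ j ∈ I, φ j S = T

open Classical in
/-- The quasisymmetric generating function, of degree `m` and with respect to the descent map
`Des`, of the equivalence class of `S` generated by the maps `φ j` with `j ∈ I`. -/
noncomputable def classQSym {A : Type*} [Fintype A] (m : ℕ) (Des : A → Finset ℕ)
    (φ : ℕ → A → A) (I : Set ℕ) (S : A) : MvPowerSeries ℕ ℤ :=
  ∑ U : A with GenEquiv φ I S U, fundamentalQSym m (Des U)

/-- `{φ i}_{1 < i < n}` is a dual equivalence for `(A, Des)`. -/
structure IsDualEquivalence {A : Type*} [Fintype A] (n : ℕ) (Des : A → Finset ℕ)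
    (φ : ℕ → A → A) : Prop where
  des_subset : ∀ T, Des T ⊆ Finset.Ico 1 n
  involutive : ∀ i, 1 < i → i < n → Function.Involutive (φ i)
  schur_class : ∀ h i, 1 < h → h ≤ i → i < n → i - h ≤ 3 → ∀ T, ∃ μ : YoungDiagram,
    μ.card = i - h + 3 ∧
    classQSym (i - h + 3) (fun U => restrictDescents (h - 1) (i + 1) (Des U)) φ (Set.Icc h i) T =
      schurFunction μ
  comm : ∀ i j, 1 < i → i < n → 1 < j → j < n → 3 ≤ |(i : ℤ) - j| →
    ∀ T, φ j (φ i T) = φ i (φ j T)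

/-- `ψ 0` together with `{ψ i}_{1 < i < n}` is a queer dual equivalence for `(A, Des)`. The class
`[S]_{≤ i}` is generated by `ψ h` for `h ≤ i`, `h ≠ 1`. -/
structure IsQueerDualEquivalence {A : Type*} [Fintype A] (n : ℕ) (Des : A → Finset ℕ)
    (ψ : ℕ → A → A) : Prop where
  dual : IsDualEquivalence n Des ψ
  involutive_zero : Function.Involutive (ψ 0)
  schurP_class : ∀ i, 1 ≤ i → i ≤ 3 → i < n → ∀ S, ∃ γ : StrictPartition (i + 1),
    classQSym (i + 1) (fun U => Des U ∩ Finset.Icc 1 i) ψ {h | h ≤ i ∧ h ≠ 1} S = schurP γ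
  comm : ∀ i, 3 < i → i < n → ∀ S, ψ 0 (ψ i S) = ψ i (ψ 0 S)
  /-- Members of `[S]_{≤ k}` are reached from `S` by applying the `ψ h` with `h ≤ k`, `h ≠ 1`, in
  the order of some list of indices that uses `k` at most twice. -/
  two_edge : ∀ k, k < n → ∀ S T, GenEquiv ψ {h | h ≤ k ∧ h ≠ 1} S T →
    ∃ l : List ℕ, (∀ h ∈ l, h ≤ k ∧ h ≠ 1) ∧ l.count k ≤ 2 ∧
      T = l.foldl (fun U h => ψ h U) S

/-! A signed standard tableau is determined by the word of the diagonals of its letters 1, 2, ...,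
n. The absolute values of this word record the growth of a shifted shape, the signs off the main
diagonal are arbitrary, the descent set is the ascent set of the word, and `d i` for i > 1 changes
only the letters i - 1, i, i + 1. So everything is proved for such words (`IsWordModel`). Growth is
encoded by particles: a new cell of content c moves a particle from site c to site c + 1, and the
tableau conditions become exclusion. A straight shape starts from the sea `vacuum`. For a shifted
shape a particle at site k ≥ 1 is a part of size k, and site 0 is an unlimited reservoir.

Schur classes. The shifted diagram is doubled to a straight one: a letter on absolute diagonal k
occupies one of two cells of contents -k and k + 1, as chosen by its mark, and its mirror image then
fills the other cell. Given a factor of the word, its letters are slid by jeu de taquin to the left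
through all earlier cells and through the mirror images (`doubleSort`), which rectifies the factor
to the content word of a standard Young tableau with the same ascents. Slides commute with Haiman's
elementary dual equivalences, and sorting turns each `d i` into such an equivalence
(`doubleSort_mapTriple`). The tableaux of one straight shape form a single orbit
(`HopPath.dual_connected`), so rectification maps a class onto all tableaux of that shape. It is
injective on the class: the mirror images rectify to a word whose ascents are complementary
throughout the orbit; such a word is determined by these ascents (`HopPath.eq_of_ascAt`), and slides
are reversible (`SignedPath.eq_of_sortAfter_eq`). Thus each class has a Schur generating function,
for factors of every length.

Schur P-classes and the two-edge condition. All signed words of one shifted shape with k + 1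
letters, k ≥ 1, are connected by the involutions of index at most k, with k used at most twice
(`SignedPath.reach`). This goes by induction on the length: words with equal last letter need no k,
words whose last letters differ in absolute value need one, and opposite last letters are joined
through another removable corner or, if there is none, by one move that toggles the last letter. The
commutations hold because the moves concern disjoint sets of letters. -/

/-! ### Hop paths -/

/-- The move of a particle from site `c` to site `c + 1`. -/
def hop (g : ℤ → ℤ) (c : ℤ) : ℤ → ℤ :=
  fun x => g x - (if x = c then 1 else 0) + (if x = c + 1 then 1 else 0)

/-- Every site in `R` holds at most one particle. -/
def HopShape (R : Set ℤ) (g : ℤ → ℤ) : Prop := ∀ c ∈ R, g c = 0 ∨ g c = 1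

/-- A sequence of hops all of whose intermediate configurations are exclusive on `R`. -/
def HopPath (R : Set ℤ) : (ℤ → ℤ) → List ℤ → Prop
  | g, [] => HopShape R g
  | g, c :: w => HopShape R g ∧ HopPath R (hop g c) w

theorem hop_foldl_apply (w : List ℤ) (g : ℤ → ℤ) (x : ℤ) :
    w.foldl hop g x = g x - w.count x + w.count (x - 1) := by
  induction w generalizing g with
  | nil => simp
  | cons c w ih =>
    simp only [List.foldl_cons, ih, hop, List.count_cons, beq_iff_eq]
    split_ifs <;> push_cast <;> omega

theorem hop_foldl_perm {w w' : List ℤ} (h : w.Perm w') (g : ℤ → ℤ) :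
    w.foldl hop g = w'.foldl hop g := by
  funext x
  simp only [hop_foldl_apply, h.count_eq]

theorem HopPath.shape {R : Set ℤ} {g : ℤ → ℤ} {w : List ℤ} (h : HopPath R g w) :
    HopShape R g := by
  cases w with
  | nil => exact h
  | cons c w => exact h.1

theorem hopPath_append {R : Set ℤ} {g : ℤ → ℤ} {v w : List ℤ} :
    HopPath R g (v ++ w) ↔ HopPath R g v ∧ HopPath R (v.foldl hop g) w := by
  induction v generalizing g with
  | nil => exact ⟨fun h => ⟨h.shape, h⟩, fun h => h.2⟩
  | cons c v ih => simp only [List.cons_append, HopPath, ih, List.foldl_cons, and_assoc]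

theorem HopPath.end_shape {R : Set ℤ} {g : ℤ → ℤ} {w : List ℤ} (h : HopPath R g w) :
    HopShape R (w.foldl hop g) := by
  have : HopPath R g (w ++ []) := by simpa using h
  exact (hopPath_append.1 this).2

/-- Between two hops out of site `a`, this site must be refilled by a hop of content `a - 1`, and
site `a + 1` must be vacated by a hop of content `a + 1`. This is the reason for this lemma and the
next two: no hop, or one hop, in between is too few, and two must be exactly these. -/
theorem HopPath.ne {g : ℤ → ℤ} {a b : ℤ} {w : List ℤ} (h : HopPath Set.univ g (a :: b :: w)) :
    a ≠ b := by
  rintro rfl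
  have h1 := h.1 a trivial
  have h3 := h.2.2.shape a trivial
  simp only [hop] at h3
  split_ifs at h3 <;> omega

theorem HopPath.ne₂ {g : ℤ → ℤ} {a b c : ℤ} {w : List ℤ}
    (h : HopPath Set.univ g (a :: b :: c :: w)) : a ≠ c := by
  rintro rfl
  have e := h.ne
  have h1 := h.1 a trivial
  have h2 := h.1 (a + 1) trivial
  have h3 := h.2.1 a trivial
  have h4 := h.2.1 (a + 1) trivial
  have h5 := h.2.2.1 a trivial
  have h6 := h.2.2.1 (a + 1) trivial
  have h7 := h.2.2.2.shape a trivial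
  have h8 := h.2.2.2.shape (a + 1) trivial
  simp only [hop] at *
  split_ifs at * <;> omega

theorem HopPath.gap {g : ℤ → ℤ} {a b c : ℤ} {w : List ℤ}
    (h : HopPath Set.univ g (a :: b :: c :: a :: w)) :
    b = a - 1 ∧ c = a + 1 ∨ b = a + 1 ∧ c = a - 1 := by
  have e := h.ne
  have e1 := h.ne₂
  have h1 := h.1 a trivial
  have h2 := h.1 (a + 1) trivial
  have h3 := h.2.1 a trivial
  have h4 := h.2.1 (a + 1) trivial
  have h7 := h.2.2.2.2.shape a trivial
  have h8 := h.2.2.2.2.shape (a + 1) trivial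
  simp only [hop, if_true, add_eq_right, one_ne_zero, if_false, left_eq_add] at h3 h4 h7 h8
  simp only [e, e1, if_false] at h7
  split_ifs at h7 h8 <;> omega

/-- Hops at distance at least two involve disjoint pairs of sites. -/
theorem HopPath.swap {R : Set ℤ} {g : ℤ → ℤ} {a b : ℤ} {w : List ℤ}
    (h : HopPath R g (a :: b :: w)) (hab : 2 ≤ |a - b|) : HopPath R g (b :: a :: w) := by
  have hc : hop (hop g a) b = hop (hop g b) a := by
    funext x
    simp only [hop]
    ring
  have hab' : 2 ≤ a - b ∨ 2 ≤ b - a := by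
    rcases abs_cases (a - b) with h | h <;> omega
  refine ⟨h.1, ?_, hc ▸ h.2.2⟩
  intro c hcR
  have h1 := h.1 c hcR
  have h2 := h.2.1 c hcR
  have h3 := h.2.2.shape c hcR
  simp only [hop] at *
  split_ifs at * <;> omega

/-- A configuration from which no particle can hop back. -/
def IsHopStart (R : Set ℤ) (g : ℤ → ℤ) : Prop :=
  ∀ x, (x ∈ R → g x = 0) → g (x + 1) = 1 → False

/-- A hop path can be rearranged to end in any hop that can be taken back. -/
theorem HopPath.exists_perm_concat {R : Set ℤ} {g : ℤ → ℤ} (hg : IsHopStart R g)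
    (w : List ℤ) (hw : HopPath R g w)
    (hw' : ∀ c ∈ w, c + 1 ∈ R) (x : ℤ) (hx1 : x + 1 ∈ R)
    (h0 : x ∈ R → w.foldl hop g x = 0) (h1 : w.foldl hop g (x + 1) = 1) :
    ∃ v, HopPath R g (v ++ [x]) ∧ (v ++ [x]).Perm w := by
  induction w using List.reverseRecOn with
  | nil => exact (hg x h0 h1).elim
  | append_singleton w a ih =>
    by_cases hax : a = x
    · exact ⟨w, hax ▸ hw, by rw [hax]⟩
    obtain ⟨hw1, hw2, hw3⟩ := hopPath_append.1 hw
    have ha1 : a + 1 ∈ R := hw' a (by simp)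
    have e1 := hw2 (a + 1) ha1
    have e2 := hw3 (a + 1) ha1
    rw [List.foldl_append] at h0 h1
    simp only [List.foldl_cons, List.foldl_nil] at h0 h1
    simp only [hop, if_true, add_eq_right] at h0 h1 e2
    -- The last hop `a` is not `x + 1`, which would have left site `x + 1`, and not `x - 1`, which
    -- would have filled site `x`. So it is at distance at least two from `x`: the hop `x` could
    -- already be taken back before it, and the two commute.
    have n1 : x + 1 ≠ a := by
      intro h
      have e3 := hw2 a (h ▸ hx1)
      have e4 := hw3 a (h ▸ hx1)
      simp only [hop, if_true] at e4
      rw [if_neg (by omega)] at e4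
      rw [if_pos h, if_neg (by omega)] at h1
      rw [h] at h1
      omega
    have n2 : x ≠ a + 1 := by
      intro h
      have := h0 (h ▸ ha1)
      rw [if_neg (by omega), if_pos h] at this
      rw [h] at this
      omega
    obtain ⟨v, hv, hvw⟩ := ih hw1 (fun c hc => hw' c (by simp [hc]))
      (by
        intro hxR
        have := h0 hxR
        rw [if_neg (by omega), if_neg (by omega)] at this
        omega)
      (by
        rw [if_neg (by omega), if_neg (by omega)] at h1
        omega)
    refine ⟨v ++ [a], ?_, ?_⟩
    · have h2 : HopPath R g ((v ++ [x]) ++ [a]) :=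
        hopPath_append.2 ⟨hv, by rw [hop_foldl_perm hvw]; exact ⟨hw2, hw3⟩⟩
      rw [List.append_assoc] at h2 ⊢
      obtain ⟨h3, h4⟩ := hopPath_append.1 h2
      refine hopPath_append.2 ⟨h3, HopPath.swap h4 ?_⟩
      rcases abs_cases (x - a) with h | h <;> omega
    · have h2 : (v ++ [a] ++ [x]).Perm (v ++ [x] ++ [a]) := by
        simp only [List.append_assoc]
        exact List.Perm.append_left v (List.Perm.swap _ _ _)
      exact h2.trans (hvw.append_right [a])

/-- Between an empty site and a later occupied site there is a particle that can hop back. -/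
theorem exists_hop_back {R : Set ℤ} {g : ℤ → ℤ} (hg : HopShape R g) {p q : ℤ} (hpq : p < q)
    (hR : ∀ c, p < c → c ≤ q → c ∈ R) (hp : g p = 0) (hq : g q = 1) :
    ∃ x, p ≤ x ∧ x < q ∧ g x = 0 ∧ g (x + 1) = 1 := by
  obtain ⟨k, rfl⟩ : ∃ k : ℕ, q = p + 1 + k := ⟨(q - p - 1).toNat, by omega⟩
  clear hpq
  induction k with
  | zero => exact ⟨p, le_rfl, by simp, hp, by simpa using hq⟩
  | succ k ih =>
    rcases hg (p + 1 + k) (hR _ (by omega) (by push_cast; omega)) with h | h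
    · exact ⟨p + 1 + k, by omega, by push_cast; omega, h, by
        rw [show p + 1 + (k : ℤ) + 1 = p + 1 + ((k + 1 : ℕ) : ℤ) by push_cast; ring]; exact hq⟩
    · obtain ⟨x, h1, h2, h3⟩ := ih (fun c h1 h2 => hR c h1 (by push_cast; omega)) h
      exact ⟨x, h1, by push_cast; omega, h3⟩

/-! ### Elementary dual equivalence on straight content words. -/

/-- Apply a map to the three letters of a word that start at position `j`. -/
def mapTriple (t : ℤ → ℤ → ℤ → ℤ × ℤ × ℤ) : ℕ → List ℤ → List ℤ
  | 0, x :: y :: z :: w => (t x y z).1 :: (t x y z).2.1 :: (t x y z).2.2 :: w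
  | j + 1, x :: w => x :: mapTriple t j w
  | _, w => w

theorem mapTriple_length (t : ℤ → ℤ → ℤ → ℤ × ℤ × ℤ) (j : ℕ) (w : List ℤ) :
    (mapTriple t j w).length = w.length := by
  fun_induction mapTriple t j w <;> simp_all

theorem mapTriple_append_right (t : ℤ → ℤ → ℤ → ℤ × ℤ × ℤ) (j : ℕ) (v w : List ℤ) :
    mapTriple t (v.length + j) (v ++ w) = v ++ mapTriple t j w := by
  induction v with
  | nil => simp
  | cons c v ih =>
    rw [List.length_cons, show v.length + 1 + j = (v.length + j) + 1 by omega]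
    simp [mapTriple, ih]

theorem mapTriple_append_left (t : ℤ → ℤ → ℤ → ℤ × ℤ × ℤ) (j : ℕ) (v w : List ℤ)
    (h : j + 3 ≤ v.length) : mapTriple t j (v ++ w) = mapTriple t j v ++ w := by
  fun_induction mapTriple t j v with
  | case1 x y z v => simp [mapTriple]
  | case2 j x v ih => simp at h; simp [mapTriple, ih (by omega)]
  | case3 j v h1 h2 =>
    exfalso
    rcases j with _ | j
    · rcases v with _ | ⟨x, _ | ⟨y, _ | ⟨z, v⟩⟩⟩ <;> simp at h
      exact h1 x y z v rfl rfl
    · rcases v with _ | ⟨x, v⟩ <;> simp at h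
      exact h2 j x v rfl rfl

/-- Successive application of `mapTriple` at the positions in a list. -/
def mapTriples (t : ℤ → ℤ → ℤ → ℤ × ℤ × ℤ) (q : List ℕ) (w : List ℤ) : List ℤ :=
  q.foldl (fun u j => mapTriple t j u) w

theorem mapTriples_length (t : ℤ → ℤ → ℤ → ℤ × ℤ × ℤ) (q : List ℕ) (w : List ℤ) :
    (mapTriples t q w).length = w.length := by
  induction q generalizing w with
  | nil => rfl
  | cons j q ih => exact (ih _).trans (mapTriple_length t j w)

theorem mapTriples_append (t : ℤ → ℤ → ℤ → ℤ × ℤ × ℤ) (p q : List ℕ) (w : List ℤ) :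
    mapTriples t (p ++ q) w = mapTriples t q (mapTriples t p w) := by
  simp [mapTriples]

theorem mapTriples_append_left (t : ℤ → ℤ → ℤ → ℤ × ℤ × ℤ) (q : List ℕ) (v w : List ℤ)
    (h : ∀ j ∈ q, j + 3 ≤ v.length) : mapTriples t q (v ++ w) = mapTriples t q v ++ w := by
  induction q generalizing v with
  | nil => rfl
  | cons j q ih =>
    simp only [mapTriples, List.foldl_cons]
    rw [mapTriple_append_left t j v w (h j (by simp))]
    exact ih _ fun i hi => by rw [mapTriple_length]; exact h i (by simp [hi])

/-- The elementary dual equivalence on three contents: exchange the largest and the smallest,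
unless the median is in the middle. -/
def dualTriple (x y z : ℤ) : ℤ × ℤ × ℤ :=
  if (x ≤ y ∧ y ≤ z) ∨ (z ≤ y ∧ y ≤ x) then (x, y, z)
  else if (y < x ∧ x < z) ∨ (z < x ∧ x < y) then (x, z, y) else (y, x, z)

theorem dualTriple_cases (x y z : ℤ) :
    dualTriple x y z = (x, y, z) ∨ dualTriple x y z = (x, z, y) ∨ dualTriple x y z = (y, x, z) := by
  unfold dualTriple
  split_ifs <;> simp

theorem mapTriple_dual_perm (j : ℕ) (w : List ℤ) : (mapTriple dualTriple j w).Perm w := by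
  fun_induction mapTriple dualTriple j w with
  | case1 x y z w =>
    rcases dualTriple_cases x y z with h | h | h <;> rw [h]
    · exact (List.Perm.swap _ _ _).cons _
    · exact List.Perm.swap _ _ _
  | case2 j x w ih => exact ih.cons _
  | case3 => exact List.Perm.refl _

theorem mapTriples_dual_perm (q : List ℕ) (w : List ℤ) : (mapTriples dualTriple q w).Perm w := by
  induction q generalizing w with
  | nil => exact List.Perm.refl _
  | cons j q ih => exact (ih _).trans (mapTriple_dual_perm j w)

/-- The two exchanged contents lie strictly on either side of the third, hence differ by at least
two. -/
theorem HopPath.mapTriple_dual {g : ℤ → ℤ} {w : List ℤ} (h : HopPath Set.univ g w) (j : ℕ) :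
    HopPath Set.univ g (mapTriple dualTriple j w) := by
  induction w generalizing g j with
  | nil => cases j <;> exact h
  | cons x w ih =>
    rcases j with _ | j
    · rcases w with _ | ⟨y, _ | ⟨z, w⟩⟩
      · exact h
      · exact h
      have e1 := h.ne
      have e2 := h.2.ne
      have e3 := h.ne₂
      simp only [mapTriple, dualTriple]
      split_ifs with c1 c2
      · exact h
      · exact ⟨h.1, h.2.swap (by rcases abs_cases (y - z) with h | h <;> omega)⟩
      · exact h.swap (by rcases abs_cases (x - y) with h | h <;> omega)
    · exact ⟨h.1, ih h.2 j⟩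

theorem HopPath.mapTriples_dual {g : ℤ → ℤ} {w : List ℤ} (h : HopPath Set.univ g w)
    (q : List ℕ) : HopPath Set.univ g (mapTriples dualTriple q w) := by
  induction q generalizing w with
  | nil => exact h
  | cons j q ih => exact ih (h.mapTriple_dual j)

/-- The configuration of the empty partition. -/
def vacuum : ℤ → ℤ := fun c => if c ≤ 0 then 1 else 0

theorem isHopStart_vacuum : IsHopStart Set.univ vacuum := by
  intro x h0 h1
  have := h0 trivial
  simp only [vacuum] at *
  split_ifs at * <;> omega

theorem HopPath.concat_apply {g : ℤ → ℤ} {w : List ℤ} {a : ℤ}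
    (h : HopPath Set.univ g (w ++ [a])) :
    w.foldl hop g a = 1 ∧ w.foldl hop g (a + 1) = 0 := by
  obtain ⟨-, h1, h2⟩ := hopPath_append.1 h
  have e1 := h1 a trivial
  have e2 := h1 (a + 1) trivial
  have e3 := h2 a trivial
  have e4 := h2 (a + 1) trivial
  simp only [hop, if_true, add_eq_right, one_ne_zero, if_false, left_eq_add] at e3 e4
  omega

/-- Two hops of different content that can be taken back can be the last two, after one of
intermediate content. -/
theorem HopPath.exists_between {R : Set ℤ} {g : ℤ → ℤ} (hg : IsHopStart R g) {w : List ℤ}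
    (h : HopPath R g w) (hw : ∀ c ∈ w, c + 1 ∈ R) {a b : ℤ} (hab : a < b)
    (hR : ∀ c, a < c → c ∈ R) (ha0 : a ∈ R → w.foldl hop g a = 0)
    (ha1 : w.foldl hop g (a + 1) = 1) (hb0 : w.foldl hop g b = 0)
    (hb1 : w.foldl hop g (b + 1) = 1) :
    ∃ v x, a < x ∧ x < b ∧ HopPath R g (v ++ [x, a, b]) ∧ (v ++ [x, a, b]).Perm w := by
  have hne : b ≠ a + 1 := by
    rintro rfl
    omega
  have apply_of_perm : ∀ {v u : List ℤ} {c : ℤ}, (v ++ [c]).Perm u → ∀ x,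
      u.foldl hop g x = hop (v.foldl hop g) c x := fun hp x => by
    rw [← hop_foldl_perm hp]; simp
  -- Taking back `a` and then `b` leaves site `a + 1` empty and site `b` occupied, so a further hop
  -- `x` strictly between `a` and `b` can be taken back.
  obtain ⟨u, hu, hup⟩ := h.exists_perm_concat hg w hw a (hR _ (by omega)) ha0 ha1
  have hu1 := (hopPath_append.1 hu).1
  have hU := apply_of_perm hup
  rw [hU] at ha1 hb0 hb1
  simp only [hop, if_true, add_eq_right, add_left_inj] at ha1 hb0 hb1
  rw [if_neg (by omega), if_neg (by omega)] at hb0 hb1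
  obtain ⟨v, hv, hvp⟩ := hu1.exists_perm_concat hg u
    (fun c hc => hw c (hup.subset (by simp [hc]))) b (hR _ (by omega)) (fun _ => by omega) (by omega)
  have hv1 := (hopPath_append.1 hv).1
  have hV := apply_of_perm hvp
  rw [hV] at ha1 hb0 hb1
  simp only [hop, if_true, one_ne_zero, if_false, left_eq_add, add_left_inj] at ha1 hb0 hb1
  rw [if_neg (by omega), if_neg (by omega)] at ha1
  obtain ⟨x, hx1, hx2, hx3, hx4⟩ := exists_hop_back hv1.end_shape (p := a + 1) (q := b) (by omega)
    (fun c hc _ => hR c (by omega)) (by omega) (by omega)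
  obtain ⟨t, ht, htp⟩ := hv1.exists_perm_concat hg v
    (fun c hc => hw c (hup.subset (by simp [hvp.subset (by simp [hc] : c ∈ v ++ [b])]))) x
    (hR _ (by omega)) (fun _ => hx3) hx4
  have hp1 : (t ++ [x, a, b]).Perm (t ++ [x] ++ [b] ++ [a]) := by
    simp only [List.append_assoc]
    exact List.Perm.append_left t ((List.Perm.swap _ _ _).cons _)
  have hp2 : (t ++ [x] ++ [b] ++ [a]).Perm w :=
    (((htp.append_right [b]).trans hvp).append_right [a]).trans hup
  refine ⟨t, x, by omega, hx2, ?_, hp1.trans hp2⟩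
  have h1 : HopPath R g (t ++ [x] ++ [b] ++ [a]) := by
    refine hopPath_append.2 ⟨hopPath_append.2 ⟨ht, ?_⟩, ?_⟩
    · rw [hop_foldl_perm htp]; exact (hopPath_append.1 hv).2
    · rw [hop_foldl_perm ((htp.append_right [b]).trans hvp)]; exact (hopPath_append.1 hu).2
  rw [List.append_assoc] at h1
  obtain ⟨h2, h3⟩ := hopPath_append.1 h1
  have := hopPath_append.2 ⟨h2, HopPath.swap h3 (by rcases abs_cases (b - a) with h | h <;> omega)⟩
  simpa using this

theorem HopPath.concat_apply' {R : Set ℤ} {g : ℤ → ℤ} {w : List ℤ} {a : ℤ}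
    (h : HopPath R g (w ++ [a])) (ha : a + 1 ∈ R) :
    (a ∈ R → (w ++ [a]).foldl hop g a = 0) ∧ (w ++ [a]).foldl hop g (a + 1) = 1 := by
  obtain ⟨-, h1, h2⟩ := hopPath_append.1 h
  rw [List.foldl_append]
  have e2 := h1 _ ha
  have e4 := h2 _ ha
  simp only [List.foldl_cons, List.foldl_nil] at *
  simp only [hop, if_true, add_eq_right, one_ne_zero, if_false, left_eq_add] at *
  refine ⟨fun haR => ?_, by omega⟩
  have e1 := h1 a haR
  have e3 := h2 a haR
  simp only [hop, if_true, left_eq_add, one_ne_zero, if_false] at e3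
  omega

/-- Straight content words of the same shape are connected by elementary dual equivalences. -/
theorem HopPath.dual_connected (n : ℕ) : ∀ w w' : List ℤ, w.length = n →
    HopPath Set.univ vacuum w → HopPath Set.univ vacuum w' → w.Perm w' →
    ∃ q : List ℕ, (∀ j ∈ q, j + 3 ≤ n) ∧ mapTriples dualTriple q w = w' := by
  induction n with
  | zero =>
    intro w w' hn _ _ hp
    rw [List.length_eq_zero_iff] at hn
    subst hn
    exact ⟨[], by simp, by simpa [mapTriples] using hp.symm.eq_nil.symm⟩
  | succ n ih =>
    have key : ∀ (v v' : List ℤ) (a : ℤ), v.length = n → HopPath Set.univ vacuum (v ++ [a]) →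
        HopPath Set.univ vacuum (v' ++ [a]) → (v ++ [a]).Perm (v' ++ [a]) →
        ∃ q : List ℕ, (∀ j ∈ q, j + 3 ≤ n + 1) ∧
          mapTriples dualTriple q (v ++ [a]) = v' ++ [a] := by
      intro v v' a hn h h' hp
      obtain ⟨q, hq, e⟩ := ih v v' hn (hopPath_append.1 h).1 (hopPath_append.1 h').1
        ((List.perm_append_right_iff _).1 hp)
      refine ⟨q, fun j hj => (hq j hj).trans (by omega), ?_⟩
      rw [mapTriples_append_left _ _ _ _ (fun j hj => hn ▸ hq j hj), e]
    -- Haiman's argument: two removable corners `a < b` can be filled last, after a corner `x` of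
    -- intermediate content. The median `x` comes first, so a single elementary dual equivalence
    -- exchanges `a` and `b`. The rest is induction on words with equal last letter (`key`).
    have key2 : ∀ (v v' : List ℤ) (a b : ℤ), a < b → v.length = n → v'.length = n →
        HopPath Set.univ vacuum (v ++ [a]) →
        HopPath Set.univ vacuum (v' ++ [b]) → (v ++ [a]).Perm (v' ++ [b]) →
        (∃ q : List ℕ, (∀ j ∈ q, j + 3 ≤ n + 1) ∧
          mapTriples dualTriple q (v ++ [a]) = v' ++ [b]) ∧
        (∃ q : List ℕ, (∀ j ∈ q, j + 3 ≤ n + 1) ∧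
          mapTriples dualTriple q (v' ++ [b]) = v ++ [a]) := by
      intro v v' a b hab hn hn' h h' hp
      have hE := hop_foldl_perm hp vacuum
      obtain ⟨u, x, hax, hxb, hu, hup⟩ := h.exists_between isHopStart_vacuum
        (fun _ _ => trivial) hab (fun _ _ => trivial) (h.concat_apply' trivial).1
        (h.concat_apply' trivial).2 (by rw [hE]; exact (h'.concat_apply' trivial).1 trivial)
        (by rw [hE]; exact (h'.concat_apply' trivial).2)
      have hl := hup.length_eq
      simp only [List.length_append, List.length_cons, List.length_nil] at hl
      have m1 : mapTriple dualTriple u.length (u ++ [x, b, a]) = u ++ [x, a, b] := by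
        rw [← Nat.add_zero u.length, mapTriple_append_right]
        simp only [mapTriple, dualTriple]
        rw [if_neg (by omega), if_pos (by omega)]
      have m2 : mapTriple dualTriple u.length (u ++ [x, a, b]) = u ++ [x, b, a] := by
        rw [← Nat.add_zero u.length, mapTriple_append_right]
        simp only [mapTriple, dualTriple]
        rw [if_neg (by omega), if_pos (by omega)]
      have hu2 : HopPath Set.univ vacuum (u ++ [x, b] ++ [a]) := by
        have := hu.mapTriple_dual u.length
        rw [m2] at this
        simpa using this
      have hu' : HopPath Set.univ vacuum (u ++ [x, a] ++ [b]) := by simpa using hu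
      have hp1 : (u ++ [x, b] ++ [a]).Perm (v ++ [a]) := by
        have := mapTriple_dual_perm u.length (u ++ [x, a, b])
        rw [m2] at this
        simpa using this.trans hup
      have hp2 : (u ++ [x, a] ++ [b]).Perm (v' ++ [b]) := by simpa using hup.trans hp
      have hlu : (u ++ [x, b]).length = n := by simp; omega
      have hlu' : (u ++ [x, a]).length = n := by simp; omega
      constructor
      · obtain ⟨q1, hq1, e1⟩ := key v (u ++ [x, b]) a hn h hu2 hp1.symm
        obtain ⟨q2, hq2, e2⟩ := key (u ++ [x, a]) v' b hlu' hu' h' hp2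
        refine ⟨q1 ++ ([u.length] ++ q2), ?_, ?_⟩
        · simp only [List.mem_append, List.mem_singleton]
          rintro j (hj | rfl | hj)
          · exact hq1 j hj
          · omega
          · exact hq2 j hj
        · rw [mapTriples_append, e1, mapTriples_append, ← e2]
          congr 1
          simpa [mapTriples] using m1
      · obtain ⟨q1, hq1, e1⟩ := key v' (u ++ [x, a]) b hn' h' hu' hp2.symm
        obtain ⟨q2, hq2, e2⟩ := key (u ++ [x, b]) v a hlu hu2 h hp1
        refine ⟨q1 ++ ([u.length] ++ q2), ?_, ?_⟩
        · simp only [List.mem_append, List.mem_singleton]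
          rintro j (hj | rfl | hj)
          · exact hq1 j hj
          · omega
          · exact hq2 j hj
        · rw [mapTriples_append, e1, mapTriples_append, ← e2]
          congr 1
          simpa [mapTriples] using m2
    intro w w' hn h h' hp
    obtain ⟨v, a, rfl⟩ : ∃ v a, w = v ++ [a] :=
      ⟨_, _, (List.dropLast_append_getLast (by rintro rfl; simp at hn)).symm⟩
    have hn' := hp.length_eq.symm.trans hn
    obtain ⟨v', b, rfl⟩ : ∃ v a, w' = v ++ [a] :=
      ⟨_, _, (List.dropLast_append_getLast (by rintro rfl; simp at hn')).symm⟩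
    simp only [List.length_append, List.length_cons, List.length_nil] at hn hn'
    rcases lt_trichotomy a b with hab | rfl | hab
    · exact (key2 v v' a b hab (by omega) (by omega) h h' hp).1
    · exact key v v' a (by omega) h h' hp
    · exact (key2 v' v b a hab (by omega) (by omega) h' h hp.symm).2

/-- The letters at positions `j` and `j + 1` (from `0`) ascend. -/
def AscAt : ℕ → List ℤ → Prop
  | 0, x :: y :: _ => x < y
  | j + 1, _ :: w => AscAt j w
  | _, _ => False

theorem ascAt_append_right (j : ℕ) (v w : List ℤ) :
    AscAt (v.length + j) (v ++ w) ↔ AscAt j w := by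
  induction v with
  | nil => simp
  | cons c v ih =>
    rw [List.length_cons, show v.length + 1 + j = (v.length + j) + 1 by omega]
    simpa [AscAt] using ih

theorem ascAt_append_left (j : ℕ) (v w : List ℤ) (h : j + 2 ≤ v.length) :
    AscAt j (v ++ w) ↔ AscAt j v := by
  induction v generalizing j with
  | nil => simp at h
  | cons c v ih =>
    rcases j with _ | j
    · rcases v with _ | ⟨d, v⟩
      · simp at h
      · rfl
    · exact ih j (by simpa using h)

/-- Straight content words are determined by the ascents of all words that arise from them by
elementary dual equivalences. -/
theorem HopPath.eq_of_ascAt (n : ℕ) : ∀ w w' : List ℤ, w.length = n → w'.length = n →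
    HopPath Set.univ vacuum w → HopPath Set.univ vacuum w' →
    (∀ q : List ℕ, (∀ j ∈ q, j + 3 ≤ n) → ∀ j, j + 2 ≤ n →
      (AscAt j (mapTriples dualTriple q w) ↔ AscAt j (mapTriples dualTriple q w'))) →
    w = w' := by
  induction n with
  | zero =>
    intro w w' h h' _ _ _
    rw [List.length_eq_zero_iff] at h h'
    rw [h, h']
  | succ n ih =>
    -- If both `a < b` can be added after `v`, some removable content `x` of the shape of `v`
    -- satisfies `a < x < b`. Moves inside `v` bring `x` to its end, and then `x, a` descends while
    -- `x, b` ascends.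
    have key : ∀ (v : List ℤ) (a b : ℤ), a < b → v.length = n →
        HopPath Set.univ vacuum (v ++ [a]) → HopPath Set.univ vacuum (v ++ [b]) →
        (∀ q : List ℕ, (∀ j ∈ q, j + 3 ≤ n + 1) → ∀ j, j + 2 ≤ n + 1 →
          (AscAt j (mapTriples dualTriple q (v ++ [a])) ↔
            AscAt j (mapTriples dualTriple q (v ++ [b])))) → False := by
      intro v a b hab hn h h' hq
      have ha := h.concat_apply
      have hb := h'.concat_apply
      have hv := (hopPath_append.1 h).1
      have hne : b ≠ a + 1 := by rintro rfl; omega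
      obtain ⟨x, hx1, hx2, hx3, hx4⟩ := exists_hop_back hv.end_shape (p := a + 1) (q := b)
        (by omega) (fun _ _ _ => trivial) ha.2 hb.1
      obtain ⟨u, hu, hup⟩ := hv.exists_perm_concat isHopStart_vacuum v
        (fun _ _ => trivial) x trivial (fun _ => hx3) hx4
      obtain ⟨q, hq1, hq2⟩ := HopPath.dual_connected n v _ hn hv hu hup.symm
      have hl := hup.length_eq
      simp only [List.length_append, List.length_cons, List.length_nil] at hl
      have := hq q (fun j hj => (hq1 j hj).trans (by omega)) u.length (by omega)
      rw [mapTriples_append_left _ _ _ _ (fun j hj => hn ▸ hq1 j hj),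
        mapTriples_append_left _ _ _ _ (fun j hj => hn ▸ hq1 j hj), hq2,
        List.append_assoc, List.append_assoc, ← Nat.add_zero u.length,
        ascAt_append_right, ascAt_append_right] at this
      simp only [List.cons_append, List.nil_append, AscAt] at this
      omega
    intro w w' hn hn' h h' hq
    obtain ⟨v, a, rfl⟩ : ∃ v a, w = v ++ [a] :=
      ⟨_, _, (List.dropLast_append_getLast (by rintro rfl; simp at hn)).symm⟩
    obtain ⟨v', b, rfl⟩ : ∃ v a, w' = v ++ [a] :=
      ⟨_, _, (List.dropLast_append_getLast (by rintro rfl; simp at hn')).symm⟩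
    simp only [List.length_append, List.length_cons, List.length_nil, Nat.add_right_cancel_iff]
      at hn hn'
    obtain rfl : v = v' := by
      refine ih v v' hn hn' (hopPath_append.1 h).1 (hopPath_append.1 h').1 fun q hq1 j hj => ?_
      have := hq q (fun j hj => (hq1 j hj).trans (by omega)) j (by omega)
      rwa [mapTriples_append_left _ _ _ _ (fun j hj => hn ▸ hq1 j hj),
        mapTriples_append_left _ _ _ _ (fun j hj => hn' ▸ hq1 j hj),
        ascAt_append_left _ _ _ (by rw [mapTriples_length]; omega),
        ascAt_append_left _ _ _ (by rw [mapTriples_length]; omega)] at this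
    rcases lt_trichotomy a b with hab | rfl | hab
    · exact (key v a b hab hn h h' hq).elim
    · rfl
    · exact (key v b a hab hn h' h fun q h1 j h2 => (hq q h1 j h2).symm).elim

/-! ### Sliding letters through ghosts -/

/-- The content of a letter of content `x` after it has slid to the left through a ghost of
content `a`. -/
def slideLetter (a x : ℤ) : ℤ := if a = x + 1 ∨ x = a + 1 then a else x

/-- The content of a ghost of content `a` after a letter of content `x` has slid through it. -/
def slideGhost (a x : ℤ) : ℤ := if a = x + 1 ∨ x = a + 1 then x else a

/-- Slide a letter to the left through a word of ghosts. -/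
def passLetter : List ℤ → ℤ → ℤ × List ℤ
  | [], x => (x, [])
  | a :: G, x => (slideLetter a (passLetter G x).1,
      slideGhost a (passLetter G x).1 :: (passLetter G x).2)

/-- Slide a ghost to the right through a word of letters. -/
def pushGhost : ℤ → List ℤ → List ℤ × ℤ
  | a, [] => ([], a)
  | a, x :: w => (slideLetter a x :: (pushGhost (slideGhost a x) w).1,
      (pushGhost (slideGhost a x) w).2)

/-- Slide a word of letters to the left through a word of ghosts. -/
def passWord : List ℤ → List ℤ → List ℤ × List ℤ
  | G, [] => ([], G)
  | G, x :: w => ((passLetter G x).1 :: (passWord (passLetter G x).2 w).1,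
      (passWord (passLetter G x).2 w).2)

theorem slide_cases (a x : ℤ) :
    ((a = x + 1 ∨ x = a + 1) ∧ slideLetter a x = a ∧ slideGhost a x = x) ∨
      (¬ (a = x + 1 ∨ x = a + 1) ∧ slideLetter a x = x ∧ slideGhost a x = a) := by
  unfold slideLetter slideGhost
  split_ifs with h
  · exact Or.inl ⟨h, rfl, rfl⟩
  · exact Or.inr ⟨h, rfl, rfl⟩

/-- If the contents are adjacent, the word keeps them in place and letter and ghost exchange cells;
otherwise the two contents are interchanged. Adjacency is visible afterwards, so a slide can be
reversed. -/
theorem slide_injective {a x b y : ℤ} (h1 : slideLetter a x = slideLetter b y)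
    (h2 : slideGhost a x = slideGhost b y) : a = b ∧ x = y := by
  have := slide_cases a x
  have := slide_cases b y
  omega

theorem passLetter_length (G : List ℤ) (x : ℤ) : (passLetter G x).2.length = G.length := by
  induction G with
  | nil => rfl
  | cons a G ih => simp [passLetter, ih]

theorem passWord_length (G w : List ℤ) :
    (passWord G w).1.length = w.length ∧ (passWord G w).2.length = G.length := by
  induction w generalizing G with
  | nil => exact ⟨rfl, rfl⟩
  | cons x w ih => simp [passWord, ih, passLetter_length]

theorem passLetter_append (A B : List ℤ) (x : ℤ) :
    passLetter (A ++ B) x = ((passLetter A (passLetter B x).1).1,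
      (passLetter A (passLetter B x).1).2 ++ (passLetter B x).2) := by
  induction A with
  | nil => rfl
  | cons a A ih => simp [passLetter, ih]

theorem passLetter_injective {G G' : List ℤ} {x x' : ℤ} (h : passLetter G x = passLetter G' x') :
    G = G' ∧ x = x' := by
  induction G generalizing G' with
  | nil =>
    rcases G' with _ | ⟨a, G'⟩
    · simpa [passLetter] using h
    · simp [passLetter] at h
  | cons a G ih =>
    rcases G' with _ | ⟨b, G'⟩
    · simp [passLetter] at h
    · simp only [passLetter, Prod.mk.injEq, List.cons.injEq] at h
      obtain ⟨h1, h2⟩ := slide_injective h.1 h.2.1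
      obtain ⟨rfl, rfl⟩ := ih (Prod.ext h2 h.2.2)
      exact ⟨by rw [h1], rfl⟩

theorem passWord_injective {G G' w w' : List ℤ} (h : passWord G w = passWord G' w') :
    G = G' ∧ w = w' := by
  induction w generalizing G G' w' with
  | nil =>
    rcases w' with _ | ⟨y, w'⟩
    · simpa [passWord] using h
    · simp [passWord] at h
  | cons x w ih =>
    rcases w' with _ | ⟨y, w'⟩
    · simp [passWord] at h
    · simp only [passWord, Prod.mk.injEq, List.cons.injEq] at h
      obtain ⟨h1, rfl⟩ := ih (Prod.ext h.1.2 h.2)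
      obtain ⟨rfl, rfl⟩ := passLetter_injective (Prod.ext h.1.1 h1)
      exact ⟨rfl, rfl⟩

/-- The rectangle of elementary slides may be evaluated letter by letter or ghost by ghost. This
allows inductions on the ghosts. -/
theorem passWord_cons_ghost (a : ℤ) (G w : List ℤ) :
    passWord (a :: G) w = ((pushGhost a (passWord G w).1).1,
      (pushGhost a (passWord G w).1).2 :: (passWord G w).2) := by
  induction w generalizing a G with
  | nil => rfl
  | cons x w ih => simp [passWord, passLetter, pushGhost, ih]

theorem HopPath.slide {g : ℤ → ℤ} {a x : ℤ} {w : List ℤ}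
    (h : HopPath Set.univ g (a :: x :: w)) :
    HopPath Set.univ g (slideLetter a x :: slideGhost a x :: w) := by
  have hne := h.ne
  rcases slide_cases a x with ⟨-, e1, e2⟩ | ⟨h1, e1, e2⟩ <;> rw [e1, e2]
  · exact h
  · exact h.swap (by rcases abs_cases (a - x) with h | h <;> omega)

theorem HopPath.passLetter {g : ℤ → ℤ} {G t : List ℤ} {x : ℤ}
    (h : HopPath Set.univ g (G ++ x :: t)) :
    HopPath Set.univ g ((passLetter G x).1 :: ((passLetter G x).2 ++ t)) := by
  induction G generalizing g with
  | nil => exact h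
  | cons a G ih => exact HopPath.slide ⟨h.1, ih h.2⟩

theorem HopPath.passWord {g : ℤ → ℤ} {G w t : List ℤ}
    (h : HopPath Set.univ g (G ++ (w ++ t))) :
    HopPath Set.univ g ((passWord G w).1 ++ ((passWord G w).2 ++ t)) := by
  induction w generalizing g G with
  | nil => exact h
  | cons x w ih =>
    have h1 := HopPath.passLetter h
    exact ⟨h1.1, ih h1.2⟩

/-! ### Slides commute with elementary dual equivalence and preserve ascents. -/

theorem HopPath.gap' {g : ℤ → ℤ} {a b c d : ℤ} {w : List ℤ}
    (h : HopPath Set.univ g (a :: b :: c :: d :: w)) :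
    a ≠ d ∨ b = a - 1 ∧ c = a + 1 ∨ b = a + 1 ∧ c = a - 1 := by
  by_cases hd : a = d
  · subst hd
    exact Or.inr h.gap
  · exact Or.inl hd

theorem dualTriple_eq_self {x y z : ℤ} (h : (x ≤ y ∧ y ≤ z) ∨ (z ≤ y ∧ y ≤ x)) :
    dualTriple x y z = (x, y, z) := if_pos h

theorem dualTriple_of_first {x y z : ℤ} (h : (y < x ∧ x < z) ∨ (z < x ∧ x < y)) :
    dualTriple x y z = (x, z, y) := by
  rw [dualTriple, if_neg (by omega), if_pos h]

theorem dualTriple_of_last {x y z : ℤ} (h : (y < z ∧ z < x) ∨ (x < z ∧ z < y)) :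
    dualTriple x y z = (y, x, z) := by
  rw [dualTriple, if_neg (by omega), if_neg (by omega)]

theorem slide_lt_slide {a x y : ℤ} (n1 : a ≠ x) (n2 : x ≠ y) (n3 : a ≠ y) :
    slideLetter a x < slideLetter (slideGhost a x) y ↔ x < y := by
  grind [slideLetter, slideGhost]

theorem slideGhost_lt {a b x : ℤ} (n1 : a ≠ b) (n2 : b ≠ x) (n3 : a ≠ x) :
    slideGhost a (slideLetter b x) < slideGhost b x ↔ a < b := by
  grind [slideLetter, slideGhost]

theorem pushGhost_first {a x y z : ℤ} (n1 : a ≠ x) (n2 : x ≠ y) (n3 : y ≠ z) (n4 : a ≠ y)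
    (h : (y < x ∧ x < z) ∨ (z < x ∧ x < y)) (n6 : a ≠ z) :
    pushGhost a [x, z, y] = ([slideLetter a x, slideLetter (slideGhost (slideGhost a x) y) z,
      slideLetter (slideGhost a x) y], slideGhost (slideGhost (slideGhost a x) y) z) := by
  simp only [pushGhost, Prod.mk.injEq, List.cons.injEq, and_true, true_and]
  refine ⟨⟨?_, ?_⟩, ?_⟩ <;>
  (rcases slide_cases a x with ⟨c1, e1, f1⟩ | ⟨c1, e1, f1⟩ <;> rw [f1]) <;>
  grind [slideLetter, slideGhost]

theorem pushGhost_last {a x y z : ℤ} (n1 : a ≠ x) (n2 : x ≠ y) (n3 : y ≠ z) (n4 : a ≠ y)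
    (h : (y < z ∧ z < x) ∨ (x < z ∧ z < y)) (n6 : a ≠ z) :
    pushGhost a [y, x, z] = ([slideLetter (slideGhost a x) y, slideLetter a x,
      slideLetter (slideGhost (slideGhost a x) y) z],
      slideGhost (slideGhost (slideGhost a x) y) z) := by
  simp only [pushGhost, Prod.mk.injEq, List.cons.injEq, and_true]
  refine ⟨⟨?_, ?_, ?_⟩, ?_⟩ <;>
  (rcases slide_cases a x with ⟨c1, e1, f1⟩ | ⟨c1, e1, f1⟩ <;> try rw [e1]) <;> (try rw [f1]) <;>
  (rcases slide_cases a y with ⟨c2, e2, f2⟩ | ⟨c2, e2, f2⟩ <;> try rw [e2]) <;> (try rw [f2]) <;>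
  grind [slideLetter, slideGhost]

theorem slide_lt_slide₂ {a x y z : ℤ} (n1 : a ≠ x) (n2 : x ≠ y) (n3 : y ≠ z) (n4 : a ≠ y)
    (n5 : x ≠ z) (n6 : a ≠ z) :
    slideLetter a x < slideLetter (slideGhost (slideGhost a x) y) z ↔ x < z := by
  (rcases slide_cases a x with ⟨c1, e1, f1⟩ | ⟨c1, e1, f1⟩ <;> rw [e1, f1]) <;>
  grind [slideLetter, slideGhost]

/-- For `a ≠ z` the slides keep the relative order of the three letters, so the same exchange
applies before and after. If `a = z`, then `x` and `y` are the two neighbours of `a`, and the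
exchange of the first two letters becomes an exchange of the last two. -/
theorem pushGhost_triple {a x y z : ℤ} (n1 : a ≠ x) (n2 : x ≠ y) (n3 : y ≠ z) (n4 : a ≠ y)
    (n5 : x ≠ z) (n6 : a ≠ z ∨ x = a - 1 ∧ y = a + 1 ∨ x = a + 1 ∧ y = a - 1) :
    pushGhost a (mapTriple dualTriple 0 [x, y, z]) =
      (mapTriple dualTriple 0 (pushGhost a [x, y, z]).1, (pushGhost a [x, y, z]).2) := by
  by_cases haz : a = z
  · subst haz
    rcases n6 with n6 | ⟨rfl, rfl⟩ | ⟨rfl, rfl⟩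
    · exact absurd rfl n6
    all_goals
      rw [mapTriple, dualTriple_of_last (by omega)]
      simp only [pushGhost]
      rw [mapTriple, dualTriple_of_first (by simp [slideLetter, slideGhost]; try omega)]
      simp [slideLetter, slideGhost]
      try omega
  have l1 := slide_lt_slide n1 n2 n4
  have l3 := slide_lt_slide₂ n1 n2 n3 n4 n5 haz
  have l2 : slideLetter (slideGhost a x) y < slideLetter (slideGhost (slideGhost a x) y) z ↔
      y < z := slide_lt_slide (by grind [slideGhost]) n3 (by grind [slideGhost])
  have l4 : slideLetter a x ≠ slideLetter (slideGhost a x) y := by grind [slideLetter, slideGhost]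
  have l5 : slideLetter (slideGhost a x) y ≠ slideLetter (slideGhost (slideGhost a x) y) z := by
    grind [slideLetter, slideGhost]
  have l6 : slideLetter a x ≠ slideLetter (slideGhost (slideGhost a x) y) z := by
    rcases slide_cases a x with ⟨c1, e1, f1⟩ | ⟨c1, e1, f1⟩ <;> rw [e1, f1] <;>
      grind [slideLetter, slideGhost]
  have p1 := fun h => pushGhost_first (a := a) n1 n2 n3 n4 h haz
  have p2 := fun h => pushGhost_last (a := a) n1 n2 n3 n4 h haz
  have e : (pushGhost a [x, y, z]) = ([slideLetter a x, slideLetter (slideGhost a x) y,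
    slideLetter (slideGhost (slideGhost a x) y) z],
      slideGhost (slideGhost (slideGhost a x) y) z) := rfl
  rw [e]
  generalize slideLetter (slideGhost (slideGhost a x) y) z = Z at *
  generalize slideLetter (slideGhost a x) y = Y at *
  generalize slideLetter a x = X at *
  simp only [mapTriple]
  by_cases c1 : (x ≤ y ∧ y ≤ z) ∨ (z ≤ y ∧ y ≤ x)
  · have c1' : (X ≤ Y ∧ Y ≤ Z) ∨ (Z ≤ Y ∧ Y ≤ X) := by omega
    rw [dualTriple_eq_self c1, dualTriple_eq_self c1']
    exact e
  by_cases c2 : (y < x ∧ x < z) ∨ (z < x ∧ x < y)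
  · have c2' : (Y < X ∧ X < Z) ∨ (Z < X ∧ X < Y) := by omega
    rw [dualTriple_of_first c2, dualTriple_of_first c2']
    exact p1 c2
  · have c3 : (y < z ∧ z < x) ∨ (x < z ∧ z < y) := by omega
    have c3' : (Y < Z ∧ Z < X) ∨ (X < Z ∧ Z < Y) := by omega
    rw [dualTriple_of_last c3, dualTriple_of_last c3']
    exact p2 c3

theorem passLetter_first {a b c x : ℤ} (n1 : a ≠ b) (n2 : b ≠ c) (n3 : c ≠ x) (n4 : a ≠ c)
    (n5 : b ≠ x) (n6 : a ≠ x) (h : (b < a ∧ a < c) ∨ (c < a ∧ a < b)) :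
    passLetter [a, c, b] x = ((passLetter [a, b, c] x).1,
      [slideGhost a (slideLetter b (slideLetter c x)), slideGhost c x,
        slideGhost b (slideLetter c x)]) := by
  simp only [passLetter, Prod.mk.injEq, List.cons.injEq, and_true]
  refine ⟨?_, ?_, ?_, ?_⟩ <;>
  (rcases slide_cases c x with ⟨c1, e1, f1⟩ | ⟨c1, e1, f1⟩ <;> try rw [e1]) <;> 
  (rcases slide_cases b x with ⟨c2, e2, f2⟩ | ⟨c2, e2, f2⟩ <;> try rw [e2]) <;> (try rw [f2]) <;>
  grind [slideLetter, slideGhost]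

theorem passLetter_last {a b c x : ℤ} (n1 : a ≠ b) (n2 : b ≠ c) (n3 : c ≠ x) (n4 : a ≠ c)
    (n5 : b ≠ x) (n6 : a ≠ x) (h : (b < c ∧ c < a) ∨ (a < c ∧ c < b)) :
    passLetter [b, a, c] x = ((passLetter [a, b, c] x).1,
      [slideGhost b (slideLetter c x), slideGhost a (slideLetter b (slideLetter c x)),
        slideGhost c x]) := by
  simp only [passLetter, Prod.mk.injEq, List.cons.injEq, and_true]
  refine ⟨?_, ?_, ?_⟩ <;>
  (rcases slide_cases c x with ⟨c1, e1, f1⟩ | ⟨c1, e1, f1⟩ <;> try rw [e1]) <;>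
  grind [slideLetter, slideGhost]

theorem slideGhost_lt₂ {a b c x : ℤ} (n3 : c ≠ x) (n4 : a ≠ c)
    (n5 : b ≠ x) (n6 : a ≠ x) :
    slideGhost a (slideLetter b (slideLetter c x)) < slideGhost c x ↔ a < c := by
  (rcases slide_cases c x with ⟨c1, e1, f1⟩ | ⟨c1, e1, f1⟩ <;> rw [e1, f1]) <;>
  grind [slideLetter, slideGhost]

/-- The counterpart of `pushGhost_triple` for three ghosts; in the exceptional case an exchange of
the last two ghosts becomes one of the first two. -/
theorem passLetter_triple {a b c x : ℤ} (n1 : a ≠ b) (n2 : b ≠ c) (n3 : c ≠ x) (n4 : a ≠ c)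
    (n5 : b ≠ x) (n6 : a ≠ x ∨ b = a - 1 ∧ c = a + 1 ∨ b = a + 1 ∧ c = a - 1) :
    passLetter (mapTriple dualTriple 0 [a, b, c]) x =
      ((passLetter [a, b, c] x).1, mapTriple dualTriple 0 (passLetter [a, b, c] x).2) := by
  by_cases haz : a = x
  · subst haz
    rcases n6 with n6 | ⟨rfl, rfl⟩ | ⟨rfl, rfl⟩
    · exact absurd rfl n6
    all_goals
      rw [mapTriple, dualTriple_of_first (by omega)]
      simp only [passLetter]
      rw [mapTriple, dualTriple_of_last (by simp [slideLetter, slideGhost]; try omega)]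
      simp [slideLetter, slideGhost]
      try omega
  have l1 : slideGhost a (slideLetter b (slideLetter c x)) < slideGhost b (slideLetter c x) ↔
    a < b := slideGhost_lt n1 (by grind [slideLetter]) (by grind [slideLetter])
  have l3 := slideGhost_lt₂ n3 n4 n5 haz
  have l2 : slideGhost b (slideLetter c x) < slideGhost c x ↔ b < c := slideGhost_lt n2 n3 n5
  have l4 : slideGhost a (slideLetter b (slideLetter c x)) ≠ slideGhost b (slideLetter c x) := by
    grind [slideLetter, slideGhost]
  have l5 : slideGhost b (slideLetter c x) ≠ slideGhost c x := by
    grind [slideLetter, slideGhost]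
  have l6 : slideGhost a (slideLetter b (slideLetter c x)) ≠ slideGhost c x := by
    rcases slide_cases c x with ⟨c1, e1, f1⟩ | ⟨c1, e1, f1⟩ <;> rw [e1, f1] <;>
      grind [slideLetter, slideGhost]
  have p1 := fun h => passLetter_first n1 n2 n3 n4 n5 haz h
  have p2 := fun h => passLetter_last n1 n2 n3 n4 n5 haz h
  have e : (passLetter [a, b, c] x).2 = [slideGhost a (slideLetter b (slideLetter c x)),
    slideGhost b (slideLetter c x), slideGhost c x] := rfl
  rw [e]
  generalize slideGhost a (slideLetter b (slideLetter c x)) = X at *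
  generalize slideGhost b (slideLetter c x) = Y at *
  generalize slideGhost c x = Z at *
  simp only [mapTriple]
  by_cases c1 : (a ≤ b ∧ b ≤ c) ∨ (c ≤ b ∧ b ≤ a)
  · have c1' : (X ≤ Y ∧ Y ≤ Z) ∨ (Z ≤ Y ∧ Y ≤ X) := by omega
    rw [dualTriple_eq_self c1, dualTriple_eq_self c1']
    exact Prod.ext rfl e
  by_cases c2 : (b < a ∧ a < c) ∨ (c < a ∧ a < b)
  · have c2' : (Y < X ∧ X < Z) ∨ (Z < X ∧ X < Y) := by omega
    rw [dualTriple_of_first c2, dualTriple_of_first c2']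
    exact p1 c2
  · have c3 : (b < c ∧ c < a) ∨ (a < c ∧ c < b) := by omega
    have c3' : (Y < Z ∧ Z < X) ∨ (X < Z ∧ Z < Y) := by omega
    rw [dualTriple_of_last c3, dualTriple_of_last c3']
    exact p2 c3

theorem pushGhost_mapTriple {g : ℤ → ℤ} {a : ℤ} {w : List ℤ}
    (h : HopPath Set.univ g (a :: w)) (j : ℕ) :
    pushGhost a (mapTriple dualTriple j w) =
      (mapTriple dualTriple j (pushGhost a w).1, (pushGhost a w).2) := by
  induction w generalizing g a j with
  | nil => cases j <;> rfl
  | cons x w ih =>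
    rcases j with _ | j
    · rcases w with _ | ⟨y, _ | ⟨z, w⟩⟩
      · rfl
      · rfl
      have := pushGhost_triple h.ne h.2.ne h.2.2.ne h.ne₂ h.2.ne₂ h.gap'
      simp only [mapTriple, pushGhost, Prod.mk.injEq, List.cons.injEq, and_true] at this ⊢
      obtain ⟨⟨e1, e2, e3⟩, e4⟩ := this
      rw [e4]
      exact ⟨⟨e1, e2, e3, rfl⟩, rfl⟩
    · have := ih h.slide.2 j
      simp [mapTriple, pushGhost, this]

theorem passWord_mapTriple {g : ℤ → ℤ} {G w : List ℤ}
    (h : HopPath Set.univ g (G ++ w)) (j : ℕ) :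
    passWord G (mapTriple dualTriple j w) =
      (mapTriple dualTriple j (passWord G w).1, (passWord G w).2) := by
  induction G generalizing g with
  | nil =>
    have e : ∀ v, passWord [] v = (v, []) := by
      intro v
      induction v with
      | nil => rfl
      | cons x v ih => simp [passWord, passLetter, ih]
    rw [e, e]
  | cons a G ih =>
    rw [passWord_cons_ghost, passWord_cons_ghost, ih h.2]
    have h1 : HopPath Set.univ g ((a :: (passWord G w).1) ++ (passWord G w).2) := by
      have := HopPath.passWord (t := []) (by simpa using h.2)
      exact ⟨h.1, by simpa using this⟩
    rw [pushGhost_mapTriple (hopPath_append.1 h1).1]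

theorem passLetter_mapTriple {g : ℤ → ℤ} {G : List ℤ} {x : ℤ}
    (h : HopPath Set.univ g (G ++ [x])) (j : ℕ) :
    passLetter (mapTriple dualTriple j G) x =
      ((passLetter G x).1, mapTriple dualTriple j (passLetter G x).2) := by
  induction G generalizing g j with
  | nil => cases j <;> rfl
  | cons a G ih =>
    rcases j with _ | j
    · rcases G with _ | ⟨b, _ | ⟨c, G⟩⟩
      · rfl
      · rfl
      have h1 : HopPath Set.univ g (a :: b :: c :: (passLetter G x).1 :: (passLetter G x).2) := by
        have := HopPath.passLetter (t := []) h.2.2.2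
        exact ⟨h.1, h.2.1, h.2.2.1, by simpa using this⟩
      have := passLetter_triple h1.ne h1.2.ne h1.2.2.ne h1.ne₂ h1.2.ne₂ h1.gap'
      simp only [mapTriple, passLetter, Prod.mk.injEq, List.cons.injEq, and_true] at this ⊢
      exact this
    · have := ih h.2 j
      simp [mapTriple, passLetter, this]

theorem ascAt_pushGhost {g : ℤ → ℤ} {a : ℤ} {w : List ℤ}
    (h : HopPath Set.univ g (a :: w)) (j : ℕ) :
    AscAt j (pushGhost a w).1 ↔ AscAt j w := by
  induction w generalizing g a j with
  | nil => cases j <;> rfl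
  | cons x w ih =>
    rcases j with _ | j
    · rcases w with _ | ⟨y, w⟩
      · rfl
      · exact slide_lt_slide h.ne h.2.ne h.ne₂
    · exact ih h.slide.2 j

theorem ascAt_passWord {g : ℤ → ℤ} {G w : List ℤ}
    (h : HopPath Set.univ g (G ++ w)) (j : ℕ) :
    AscAt j (passWord G w).1 ↔ AscAt j w := by
  induction G generalizing g with
  | nil =>
    have e : ∀ v, passWord [] v = (v, []) := by
      intro v
      induction v with
      | nil => rfl
      | cons x v ih => simp [passWord, passLetter, ih]
    rw [e]
  | cons a G ih =>
    rw [passWord_cons_ghost]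
    have h1 : HopPath Set.univ g ((a :: (passWord G w).1) ++ (passWord G w).2) := by
      have := HopPath.passWord (t := []) (by simpa using h.2)
      exact ⟨h.1, by simpa using this⟩
    exact (ascAt_pushGhost (hopPath_append.1 h1).1 j).trans (ih h.2)

theorem ascAt_passLetter {g : ℤ → ℤ} {G : List ℤ} {x : ℤ}
    (h : HopPath Set.univ g (G ++ [x])) (j : ℕ) :
    AscAt j (passLetter G x).2 ↔ AscAt j G := by
  induction G generalizing g j with
  | nil => cases j <;> rfl
  | cons a G ih =>
    rcases j with _ | j
    · rcases G with _ | ⟨b, G⟩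
      · rfl
      have h1 : HopPath Set.univ g (a :: b :: (passLetter G x).1 :: (passLetter G x).2) := by
        have := HopPath.passLetter (t := []) h.2.2
        exact ⟨h.1, h.2.1, by simpa using this⟩
      exact slideGhost_lt h1.ne h1.2.ne h1.ne₂
    · exact ih h.2 j

/-! ### The doubling of a word of signed contents -/

/-- The content in the doubled diagram of a letter on diagonal `d`. -/
def letterContent (d : ℤ) : ℤ := if d ≤ 0 then d else d + 1

/-- The content in the doubled diagram of the mirror image of a letter on diagonal `d`. -/
def mirrorContent (d : ℤ) : ℤ := if d ≤ 0 then 1 - d else -d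

/-- Each letter followed by its mirror image. -/
def doubleWord : List ℤ → List ℤ
  | [] => []
  | x :: w => letterContent x :: mirrorContent x :: doubleWord w

/-- Slide the letters of a doubled word, one after the other, to the left through the ghosts `G` and
the mirror images. -/
def doubleSort : List ℤ → List ℤ → List ℤ × List ℤ
  | G, [] => ([], G)
  | G, x :: w => ((passLetter G (letterContent x)).1 ::
      (doubleSort ((passLetter G (letterContent x)).2 ++ [mirrorContent x]) w).1,
      (doubleSort ((passLetter G (letterContent x)).2 ++ [mirrorContent x]) w).2)

theorem doubleWord_append (v w : List ℤ) : doubleWord (v ++ w) = doubleWord v ++ doubleWord w := by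
  induction v with
  | nil => rfl
  | cons x v ih => simp [doubleWord, ih]

theorem doubleSort_length (G w : List ℤ) :
    (doubleSort G w).1.length = w.length ∧
      (doubleSort G w).2.length = G.length + w.length := by
  induction w generalizing G with
  | nil => exact ⟨rfl, rfl⟩
  | cons x w ih =>
    simp only [doubleSort, List.length_cons, ih, List.length_append, passLetter_length,
      List.length_nil, true_and]
    omega

theorem HopPath.doubleSort {g : ℤ → ℤ} {G w : List ℤ}
    (h : HopPath Set.univ g (G ++ doubleWord w)) :
    HopPath Set.univ g ((doubleSort G w).1 ++ (doubleSort G w).2) := by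
  induction w generalizing g G with
  | nil => simpa [_root_.doubleSort, doubleWord] using h
  | cons x w ih =>
    have h1 := HopPath.passLetter h
    exact ⟨h1.1, ih (by simpa using h1.2)⟩

theorem mirrorContent_injective {x y : ℤ} (h : mirrorContent x = mirrorContent y) : x = y := by
  unfold mirrorContent at h
  split_ifs at h <;> omega

theorem doubleSort_injective {G G' w w' : List ℤ} (hw : w.length = w'.length)
    (h : doubleSort G w = doubleSort G' w') : G = G' ∧ w = w' := by
  induction w generalizing G G' w' with
  | nil =>
    rcases w' with _ | ⟨y, w'⟩
    · simpa [doubleSort] using h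
    · simp at hw
  | cons x w ih =>
    rcases w' with _ | ⟨y, w'⟩
    · simp at hw
    simp only [doubleSort, Prod.mk.injEq, List.cons.injEq] at h
    obtain ⟨h1, rfl⟩ := ih (by simpa using hw) (Prod.ext h.1.2 h.2)
    obtain ⟨h2, h3⟩ := List.append_inj' h1 rfl
    obtain rfl := mirrorContent_injective (by simpa using h3)
    exact ⟨(passLetter_injective (Prod.ext h.1.1 h2)).1, rfl⟩

theorem doubleSort_mapTriple_ghost {g : ℤ → ℤ} {G w : List ℤ}
    (h : HopPath Set.univ g (G ++ doubleWord w)) {j : ℕ} (hj : j + 3 ≤ G.length) :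
    doubleSort (mapTriple dualTriple j G) w =
      ((doubleSort G w).1, mapTriple dualTriple j (doubleSort G w).2) := by
  induction w generalizing g G with
  | nil => rfl
  | cons x w ih =>
    have h1 := HopPath.passLetter h
    have h2 : HopPath Set.univ g (G ++ [letterContent x]) := by
      rw [doubleWord, ← List.singleton_append, ← List.append_assoc] at h
      exact (hopPath_append.1 h).1
    simp only [doubleSort]
    rw [passLetter_mapTriple h2]
    simp only
    rw [← mapTriple_append_left _ _ _ _ (by rw [passLetter_length]; exact hj),
      ih (by simpa using h1.2) (by simp [passLetter_length]; omega)]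

theorem ascAt_doubleSort_ghost {g : ℤ → ℤ} {G w : List ℤ}
    (h : HopPath Set.univ g (G ++ doubleWord w)) {j : ℕ} (hj : j + 2 ≤ G.length) :
    AscAt j (doubleSort G w).2 ↔ AscAt j G := by
  induction w generalizing g G with
  | nil => rfl
  | cons x w ih =>
    have h1 := HopPath.passLetter h
    have h2 : HopPath Set.univ g (G ++ [letterContent x]) := by
      rw [doubleWord, ← List.singleton_append, ← List.append_assoc] at h
      exact (hopPath_append.1 h).1
    simp only [doubleSort]
    rw [ih (by simpa using h1.2) (by simp [passLetter_length]; omega),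
      ascAt_append_left _ _ _ (by rw [passLetter_length]; exact hj), ascAt_passLetter h2]

/-! ### Sorting turns the involutions into elementary dual equivalences. -/

/-- The elementary involution on the diagonals of three consecutive letters. -/
def signedTriple (x y z : ℤ) : ℤ × ℤ × ℤ :=
  if (x ≤ y ∧ y ≤ z) ∨ (z ≤ y ∧ y ≤ x) then (x, y, z)
  else if x = z then (x, -y, z)
  else if (y < x ∧ x < z) ∨ (z < x ∧ x < y) then
    if |y| = |z| + 1 ∨ |z| = |y| + 1 then (x, -y, -z) else (x, z, y)
  else if |x| = |y| + 1 ∨ |y| = |x| + 1 then (-x, -y, z) else (y, x, z)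

/-- As in `HopPath.gap`: without a hop of content `a - 1` site `a` is not refilled, and without one
of content `a + 1` site `a + 1` is not vacated. -/
theorem HopPath.mem_of_repeat {g : ℤ → ℤ} {a : ℤ} {v w : List ℤ}
    (h : HopPath Set.univ g (a :: (v ++ a :: w))) (hv : a ∉ v) : a - 1 ∈ v ∧ a + 1 ∈ v := by
  have h1 := h.1
  have h2 := h.2.shape
  obtain ⟨-, h4⟩ := hopPath_append.1 h.2
  have h5 := h4.1
  have h6 := h4.2.shape
  have c0 := List.count_eq_zero.2 hv
  by_contra hc
  have h1a := h1 a trivial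
  have h1b := h1 (a + 1) trivial
  have h2a := h2 a trivial
  have h2b := h2 (a + 1) trivial
  have h5a := h5 a trivial
  have h5b := h5 (a + 1) trivial
  have h6a := h6 a trivial
  have h6b := h6 (a + 1) trivial
  simp only [hop, hop_foldl_apply, if_true, add_eq_right, one_ne_zero, if_false, left_eq_add,
    add_sub_cancel_right, c0] at *
  have c1 : (a - 1 ∈ v → False) ∨ (a + 1 ∈ v → False) := by tauto
  rcases c1 with c1 | c1 <;> have := List.count_eq_zero.2 c1 <;> simp only [this] at * <;> omega

/-- Between two equal contents of the doubled word both neighbouring contents must occur. The few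
contents available here allow this only for two letters on the main diagonal that enclose a letter
on diagonal 1 or -1. -/
theorem HopPath.double_facts {g : ℤ → ℤ} {x y z : ℤ} {w : List ℤ}
    (h : HopPath Set.univ g (doubleWord (x :: y :: z :: w))) :
    x ≠ y ∧ x ≠ -y ∧ y ≠ z ∧ y ≠ -z ∧
      (x ≠ z ∧ x ≠ -z ∨ x = 0 ∧ z = 0 ∧ (y = 1 ∨ y = -1)) := by
  have key : ∀ {g : ℤ → ℤ} {x y : ℤ} {w : List ℤ},
      HopPath Set.univ g (doubleWord (x :: y :: w)) → x ≠ y ∧ x ≠ -y := by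
    intro g x y w h
    have h1 := h.ne
    have h2 := h.ne₂
    have h3 := h.2.ne
    have h4 := h.2.ne₂
    have h5 := h.gap'
    simp only [letterContent, mirrorContent] at *
    split_ifs at * <;> omega
  obtain ⟨a1, a2⟩ := key h
  obtain ⟨b1, b2⟩ := key h.2.2
  refine ⟨a1, a2, b1, b2, ?_⟩
  have e1 : letterContent x = letterContent z → _ := fun e =>
    HopPath.mem_of_repeat (v := [mirrorContent x, letterContent y, mirrorContent y])
      (w := mirrorContent z :: doubleWord w) (by simpa [doubleWord, e] using h)
  have e2 : letterContent x = mirrorContent z → _ := fun e =>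
    HopPath.mem_of_repeat
      (v := [mirrorContent x, letterContent y, mirrorContent y, letterContent z])
      (w := doubleWord w) (by simpa [doubleWord, e] using h)
  simp only [List.mem_cons, List.not_mem_nil, or_false] at e1 e2
  simp only [letterContent, mirrorContent] at *
  split_ifs at * <;> omega

/-- The letters of a doubled word of length three, after sorting. -/
def sortedLetters (x y z : ℤ) : List ℤ :=
  [letterContent x, slideLetter (mirrorContent x) (letterContent y),
    slideLetter (slideGhost (mirrorContent x) (letterContent y))
      (slideLetter (mirrorContent y) (letterContent z))]

/-- The mirror images of a doubled word of length three, after sorting. -/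
def sortedMirrors (x y z : ℤ) : List ℤ :=
  [slideGhost (slideGhost (mirrorContent x) (letterContent y))
      (slideLetter (mirrorContent y) (letterContent z)),
    slideGhost (mirrorContent y) (letterContent z), mirrorContent z]

/-- The mirror image of one letter lies on the same side of the doubled diagram as the next letter
only if exactly one of the two diagonals is positive. Only then can the contents be adjacent, and
they are so exactly if the absolute diagonals are. -/
theorem slide_mirror (x y : ℤ) (h2 : x ≠ -y) :
    ((x ≤ 0 ∧ 0 < y ∨ y ≤ 0 ∧ 0 < x) ∧ (|x| = |y| + 1 ∨ |y| = |x| + 1) ∧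
      slideLetter (mirrorContent x) (letterContent y) = mirrorContent x ∧
      slideGhost (mirrorContent x) (letterContent y) = letterContent y) ∨
    (¬ ((x ≤ 0 ∧ 0 < y ∨ y ≤ 0 ∧ 0 < x) ∧ (|x| = |y| + 1 ∨ |y| = |x| + 1)) ∧
      slideLetter (mirrorContent x) (letterContent y) = letterContent y ∧
      slideGhost (mirrorContent x) (letterContent y) = mirrorContent x) := by
  have := slide_cases (mirrorContent x) (letterContent y)
  rcases abs_cases x with ⟨e, _⟩ | ⟨e, _⟩ <;> rcases abs_cases y with ⟨f, _⟩ | ⟨f, _⟩ <;>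
    rw [e, f] <;> simp only [letterContent, mirrorContent] at * <;> split_ifs at * <;> omega

theorem sorted_lt {x y z : ℤ} (a1 : x ≠ y) (a2 : x ≠ -y) (b1 : y ≠ z) (b2 : y ≠ -z)
    (c1 : x ≠ z) (c2 : x ≠ -z) {p q r s t u : ℤ} (hW : sortedLetters x y z = [p, q, r])
    (hS : sortedMirrors x y z = [s, t, u]) :
    ((p < q ↔ x < y) ∧ (q < r ↔ y < z) ∧ (p < r ↔ x < z) ∧ p ≠ q ∧ q ≠ r ∧ p ≠ r) ∧
    ((t < s ↔ x < y) ∧ (u < t ↔ y < z) ∧ (u < s ↔ x < z) ∧ s ≠ t ∧ t ≠ u ∧ s ≠ u) := by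
  simp only [sortedLetters, sortedMirrors, List.cons.injEq, and_true] at hW hS
  obtain ⟨rfl, rfl, rfl⟩ := hW
  obtain ⟨rfl, rfl, rfl⟩ := hS
  rcases slide_mirror x y a2 with ⟨d1, d2, e1, e2⟩ | ⟨d1, e1, e2⟩ <;>
  rcases slide_mirror y z b2 with ⟨d3, d4, e3, e4⟩ | ⟨d3, e3, e4⟩ <;>
  rw [e1, e2, e3, e4] <;> clear e1 e2 e3 e4 <;>
  refine ⟨⟨?_, ?_, ?_, ?_, ?_, ?_⟩, ⟨?_, ?_, ?_, ?_, ?_, ?_⟩⟩ <;>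
  grind [slideLetter, slideGhost, letterContent, mirrorContent]

/-- The reason for the case distinction in the involutions: toggling both marks for adjacent
absolute diagonals, and swapping the values otherwise, both become after sorting the same exchange
of two neighbouring contents, among the letters and among the mirror images. -/
theorem sorted_first {x y z : ℤ} (h : (y < x ∧ x < z) ∨ (z < x ∧ x < y)) (a2 : x ≠ -y)
    (b2 : y ≠ -z) (c2 : x ≠ -z) {p q r s t u : ℤ}
    (hW : sortedLetters x y z = [p, q, r]) (hS : sortedMirrors x y z = [s, t, u]) {y' z' : ℤ}
    (h' : (|y| = |z| + 1 ∨ |z| = |y| + 1) ∧ y' = -y ∧ z' = -z ∨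
      ¬ (|y| = |z| + 1 ∨ |z| = |y| + 1) ∧ y' = z ∧ z' = y) :
    sortedLetters x y' z' = [p, r, q] ∧ sortedMirrors x y' z' = [s, u, t] := by
  simp only [sortedLetters, sortedMirrors, List.cons.injEq, and_true] at hW hS ⊢
  obtain ⟨rfl, rfl, rfl⟩ := hW
  obtain ⟨rfl, rfl, rfl⟩ := hS
  rcases slide_mirror x y a2 with ⟨d1, d2, e1, e2⟩ | ⟨d1, e1, e2⟩ <;>
  rcases slide_mirror y z b2 with ⟨d3, d4, e3, e4⟩ | ⟨d3, e3, e4⟩ <;>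
  rw [e1, e2, e3, e4] <;> clear e1 e2 e3 e4 <;>
  rcases h' with ⟨h', rfl, rfl⟩ | ⟨h', rfl, rfl⟩ <;>
  refine ⟨⟨?_, ?_, ?_⟩, ?_, ?_, ?_⟩ <;>
  grind [slideLetter, slideGhost, letterContent, mirrorContent]

theorem sorted_last {x y z : ℤ} (h : (y < z ∧ z < x) ∨ (x < z ∧ z < y)) (a2 : x ≠ -y)
    (b2 : y ≠ -z) (c2 : x ≠ -z) {p q r s t u : ℤ}
    (hW : sortedLetters x y z = [p, q, r]) (hS : sortedMirrors x y z = [s, t, u]) {x' y' : ℤ}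
    (h' : (|x| = |y| + 1 ∨ |y| = |x| + 1) ∧ x' = -x ∧ y' = -y ∨
      ¬ (|x| = |y| + 1 ∨ |y| = |x| + 1) ∧ x' = y ∧ y' = x) :
    sortedLetters x' y' z = [q, p, r] ∧ sortedMirrors x' y' z = [t, s, u] := by
  simp only [sortedLetters, sortedMirrors, List.cons.injEq, and_true] at hW hS ⊢
  obtain ⟨rfl, rfl, rfl⟩ := hW
  obtain ⟨rfl, rfl, rfl⟩ := hS
  rcases slide_mirror x y a2 with ⟨d1, d2, e1, e2⟩ | ⟨d1, e1, e2⟩ <;>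
  rcases slide_mirror y z b2 with ⟨d3, d4, e3, e4⟩ | ⟨d3, e3, e4⟩ <;>
  rw [e1, e2, e3, e4] <;> clear e1 e2 e3 e4 <;>
  rcases h' with ⟨h', rfl, rfl⟩ | ⟨h', rfl, rfl⟩ <;>
  refine ⟨⟨?_, ?_, ?_⟩, ?_, ?_, ?_⟩ <;>
  grind [slideLetter, slideGhost, letterContent, mirrorContent]

theorem mapTriple_of_length_lt (t : ℤ → ℤ → ℤ → ℤ × ℤ × ℤ) {j : ℕ} {w : List ℤ}
    (h : w.length < j + 3) : mapTriple t j w = w := by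
  induction w generalizing j with
  | nil => cases j <;> rfl
  | cons x w ih =>
    rcases j with _ | j
    · rcases w with _ | ⟨y, _ | ⟨z, w⟩⟩
      · rfl
      · rfl
      · exact absurd h (by simp)
    · simp only [mapTriple]
      rw [ih (by simp at h; omega)]

theorem signedTriple_zero (y : ℤ) (hy : y = 1 ∨ y = -1) : signedTriple 0 y 0 = (0, -y, 0) := by
  rcases hy with rfl | rfl <;> decide

theorem sorted_signedTriple {x y z : ℤ} (a1 : x ≠ y) (a2 : x ≠ -y) (b1 : y ≠ z) (b2 : y ≠ -z)
    (c : x ≠ z ∧ x ≠ -z ∨ x = 0 ∧ z = 0 ∧ (y = 1 ∨ y = -1)) :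
    sortedLetters (signedTriple x y z).1 (signedTriple x y z).2.1 (signedTriple x y z).2.2 =
        mapTriple dualTriple 0 (sortedLetters x y z) ∧
      sortedMirrors (signedTriple x y z).1 (signedTriple x y z).2.1 (signedTriple x y z).2.2 =
        mapTriple dualTriple 0 (sortedMirrors x y z) := by
  rcases c with ⟨c1, c2⟩ | ⟨rfl, rfl, hy⟩
  swap
  -- The triples 0, ±1, 0, where the involution toggles one mark, are computed directly.
  · rw [signedTriple_zero y hy]
    rcases hy with rfl | rfl <;> decide
  obtain ⟨p, q, r, hW⟩ : ∃ p q r, sortedLetters x y z = [p, q, r] := ⟨_, _, _, rfl⟩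
  obtain ⟨s, t, u, hS⟩ : ∃ p q r, sortedMirrors x y z = [p, q, r] := ⟨_, _, _, rfl⟩
  obtain ⟨⟨l1, l2, l3, l4, l5, l6⟩, m1, m2, m3, m4, m5, m6⟩ := sorted_lt a1 a2 b1 b2 c1 c2 hW hS
  by_cases h1 : (x ≤ y ∧ y ≤ z) ∨ (z ≤ y ∧ y ≤ x)
  · have h2 : (p ≤ q ∧ q ≤ r) ∨ (r ≤ q ∧ q ≤ p) := by omega
    have h3 : (s ≤ t ∧ t ≤ u) ∨ (u ≤ t ∧ t ≤ s) := by omega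
    rw [signedTriple, if_pos h1, hW, hS, mapTriple, mapTriple, dualTriple_eq_self h2,
      dualTriple_eq_self h3]
    simp
  by_cases h2 : (y < x ∧ x < z) ∨ (z < x ∧ x < y)
  · have h3 : (q < p ∧ p < r) ∨ (r < p ∧ p < q) := by omega
    have h4 : (t < s ∧ s < u) ∨ (u < s ∧ s < t) := by omega
    rw [signedTriple, if_neg h1, if_neg c1, if_pos h2, hW, hS, mapTriple, mapTriple,
      dualTriple_of_first h3, dualTriple_of_first h4]
    split_ifs with h5
    · exact sorted_first h2 a2 b2 c2 hW hS (Or.inl ⟨h5, rfl, rfl⟩)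
    · exact sorted_first h2 a2 b2 c2 hW hS (Or.inr ⟨h5, rfl, rfl⟩)
  · have h2' : (y < z ∧ z < x) ∨ (x < z ∧ z < y) := by omega
    have h3 : (q < r ∧ r < p) ∨ (p < r ∧ r < q) := by omega
    have h4 : (t < u ∧ u < s) ∨ (s < u ∧ u < t) := by omega
    rw [signedTriple, if_neg h1, if_neg c1, if_neg h2, hW, hS, mapTriple, mapTriple,
      dualTriple_of_last h3, dualTriple_of_last h4]
    split_ifs with h5
    · exact sorted_last h2' a2 b2 c2 hW hS (Or.inl ⟨h5, rfl, rfl⟩)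
    · exact sorted_last h2' a2 b2 c2 hW hS (Or.inr ⟨h5, rfl, rfl⟩)

/-- The order of the slides is immaterial: three letters may first be sorted among their own mirror
images and then slid through `G`. -/
theorem doubleSort_triple (G : List ℤ) (x y z : ℤ) (w : List ℤ) :
    doubleSort G (x :: y :: z :: w) =
      ((passWord G (sortedLetters x y z)).1 ++
        (doubleSort ((passWord G (sortedLetters x y z)).2 ++ sortedMirrors x y z) w).1,
        (doubleSort ((passWord G (sortedLetters x y z)).2 ++ sortedMirrors x y z) w).2) := by
  simp only [doubleSort, passLetter_append, passLetter, passWord, sortedLetters, sortedMirrors,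
    List.cons_append, List.nil_append, List.append_assoc]

theorem HopPath.sorted {g : ℤ → ℤ} {G : List ℤ} {x y z : ℤ} {w : List ℤ}
    (h : HopPath Set.univ g (G ++ doubleWord (x :: y :: z :: w))) :
    HopPath Set.univ g (G ++ (sortedLetters x y z ++ (sortedMirrors x y z ++ doubleWord w))) := by
  obtain ⟨h1, h2⟩ := hopPath_append.1 h
  refine hopPath_append.2 ⟨h1, ?_⟩
  have h3 : HopPath Set.univ (G.foldl hop g) ([] ++ doubleWord ([x, y, z] ++ w)) := h2
  rw [doubleWord_append, ← List.append_assoc] at h3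
  obtain ⟨h4, h5⟩ := hopPath_append.1 h3
  have h6 := h4.doubleSort
  rw [doubleSort_triple] at h6
  have e : _root_.passWord [] (sortedLetters x y z) = (sortedLetters x y z, []) := rfl
  simp only [e, List.nil_append] at h6
  rw [← List.append_assoc]
  refine hopPath_append.2 ⟨h6, ?_⟩
  have hp : (sortedLetters x y z ++ sortedMirrors x y z).Perm ([] ++ doubleWord [x, y, z]) := by
    have key : ∀ a b, [slideLetter a b, slideGhost a b].Perm [a, b] := by
      intro a b
      rcases slide_cases a b with ⟨-, e1, e2⟩ | ⟨-, e1, e2⟩ <;> rw [e1, e2]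
      exact List.Perm.swap _ _ _
    rw [List.perm_iff_count]
    intro c
    have k1 := (key (mirrorContent x) (letterContent y)).count_eq c
    have k2 := (key (mirrorContent y) (letterContent z)).count_eq c
    have k3 := (key (slideGhost (mirrorContent x) (letterContent y))
      (slideLetter (mirrorContent y) (letterContent z))).count_eq c
    simp only [sortedLetters, sortedMirrors, doubleWord, List.count_append, List.count_cons,
      List.count_nil] at *
    omega
  rwa [hop_foldl_perm hp]

/-- Sorting a doubled word turns the elementary involutions into elementary dual equivalences. -/
theorem doubleSort_mapTriple {g : ℤ → ℤ} {G w : List ℤ}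
    (h : HopPath Set.univ g (G ++ doubleWord w)) (j : ℕ) :
    doubleSort G (mapTriple signedTriple j w) =
      (mapTriple dualTriple j (doubleSort G w).1,
        mapTriple dualTriple (G.length + j) (doubleSort G w).2) := by
  rcases lt_or_ge w.length (j + 3) with hlt | hge
  · rw [mapTriple_of_length_lt _ hlt, mapTriple_of_length_lt _ (by rwa [(doubleSort_length G w).1]),
      mapTriple_of_length_lt _ (by rw [(doubleSort_length G w).2]; omega)]
  induction w generalizing g G j with
  | nil => simp at hge
  | cons x w ih =>
    rcases j with _ | j
    · obtain ⟨y, z, w, rfl⟩ : ∃ y z v, w = y :: z :: v := by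
        rcases w with _ | ⟨y, _ | ⟨z, w⟩⟩
        · simp at hge
        · simp at hge
        · exact ⟨y, z, w, rfl⟩
      have hs := h.sorted
      have h1 : HopPath Set.univ g (G ++ sortedLetters x y z) := by
        rw [← List.append_assoc] at hs
        exact (hopPath_append.1 hs).1
      have h2 := hs.passWord
      rw [← List.append_assoc (passWord _ _).2] at h2
      obtain ⟨a1, a2, b1, b2, c⟩ := HopPath.double_facts (hopPath_append.1 h).2
      obtain ⟨e1, e2⟩ := sorted_signedTriple a1 a2 b1 b2 c
      have hl := (passWord_length G (sortedLetters x y z)).2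
      -- The exchange inside the sorted triple is carried along: for the letters through `G` by
      -- `passWord_mapTriple`, for the mirror images past the later letters by
      -- `doubleSort_mapTriple_ghost`.
      rw [mapTriple, doubleSort_triple, e1, e2, passWord_mapTriple h1, doubleSort_triple]
      simp only
      rw [← mapTriple_append_right, doubleSort_mapTriple_ghost (hopPath_append.1 h2).2
        (by simp [sortedMirrors]), hl,
        mapTriple_append_left _ _ _ _ (by rw [(passWord_length _ _).1]; simp [sortedLetters])]
    · have h1 := HopPath.passLetter h
      have := ih (G := (passLetter G (letterContent x)).2 ++ [mirrorContent x])
        (by simpa using h1.2) j (by simp at hge; omega)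
      rw [List.length_append, passLetter_length, List.length_singleton] at this
      simp only [mapTriple, doubleSort, this]
      rw [add_right_comm, add_assoc]

/-- Slides preserve ascents. The contents of a letter and of its mirror image add up to 1, so the
mirror images compare in the opposite way. -/
theorem ascAt_doubleSort {g : ℤ → ℤ} {G w : List ℤ}
    (h : HopPath Set.univ g (G ++ doubleWord w)) (j : ℕ) :
    (AscAt j (doubleSort G w).1 ↔ AscAt j w) ∧
      (j + 2 ≤ w.length → (AscAt (G.length + j) (doubleSort G w).2 ↔ ¬ AscAt j w)) := by
  induction w generalizing g G j with
  | nil => exact ⟨by cases j <;> rfl, by simp⟩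
  | cons x w ih =>
    rcases j with _ | j
    · rcases w with _ | ⟨y, w⟩
      · exact ⟨Iff.rfl, by simp⟩
      have hs : HopPath Set.univ g (G ++ ([letterContent x,
          slideLetter (mirrorContent x) (letterContent y)] ++
          ([slideGhost (mirrorContent x) (letterContent y), mirrorContent y] ++
            doubleWord w))) := by
        obtain ⟨h1, h2⟩ := hopPath_append.1 h
        exact hopPath_append.2 ⟨h1, h2.1, h2.2.slide⟩
      have hxy : x ≠ y ∧ x ≠ -y := by
        have h1 := (hopPath_append.1 h).2
        have e1 := h1.ne
        have e2 := h1.ne₂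
        have e3 := h1.2.ne
        have e4 := h1.2.ne₂
        have e5 := h1.gap'
        simp only [letterContent, mirrorContent] at *
        split_ifs at * <;> omega
      have h1 : HopPath Set.univ g (G ++ [letterContent x,
          slideLetter (mirrorContent x) (letterContent y)]) := by
        rw [← List.append_assoc] at hs
        exact (hopPath_append.1 hs).1
      have h2 := hs.passWord
      rw [← List.append_assoc (_root_.passWord _ _).2] at h2
      have e : doubleSort G (x :: y :: w) = ((passWord G [letterContent x,
          slideLetter (mirrorContent x) (letterContent y)]).1 ++ (doubleSort ((passWord G
            [letterContent x, slideLetter (mirrorContent x) (letterContent y)]).2 ++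
          [slideGhost (mirrorContent x) (letterContent y), mirrorContent y]) w).1,
          (doubleSort ((passWord G
            [letterContent x, slideLetter (mirrorContent x) (letterContent y)]).2 ++
          [slideGhost (mirrorContent x) (letterContent y), mirrorContent y]) w).2) := by
        simp only [doubleSort, passLetter_append, passLetter, passWord,
          List.cons_append, List.nil_append, List.append_assoc]
      have hl := (passWord_length G [letterContent x,
          slideLetter (mirrorContent x) (letterContent y)]).2
      rw [e]
      constructor
      · simp only
        rw [ascAt_append_left _ _ _ (by rw [(passWord_length _ _).1]; simp), ascAt_passWord h1]
        simp only [AscAt]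
        rcases slide_mirror x y hxy.2 with ⟨d1, d2, e1, e2⟩ | ⟨d1, e1, e2⟩ <;> rw [e1] <;>
          grind [letterContent, mirrorContent]
      · intro _
        simp only
        rw [ascAt_doubleSort_ghost (hopPath_append.1 h2).2 (by simp [hl]), ← hl,
          ascAt_append_right]
        simp only [AscAt]
        rcases slide_mirror x y hxy.2 with ⟨d1, d2, e1, e2⟩ | ⟨d1, e1, e2⟩ <;> rw [e2] <;>
          grind [letterContent, mirrorContent]
    · have h1 := HopPath.passLetter h
      have := ih (G := (passLetter G (letterContent x)).2 ++ [mirrorContent x])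
        (by simpa using h1.2) j
      rw [List.length_append, passLetter_length, List.length_singleton] at this
      simp only [doubleSort, AscAt, List.length_cons]
      rw [show G.length + (j + 1) = G.length + 1 + j by omega]
      exact ⟨this.1, fun h => this.2 (by omega)⟩

/-! ### Words of signed contents -/

/-- The words of diagonals of signed standard tableaux: the absolute values form the content word
of a shifted standard tableau. -/
def SignedPath (w : List ℤ) : Prop := HopPath (Set.Ici 1) 0 (w.map abs)

theorem isHopStart_zero : IsHopStart (Set.Ici 1) 0 := by
  intro x _ h
  simp at h

/-- The configuration of the doubled diagram. -/
def doubleState (h : ℤ → ℤ) : ℤ → ℤ :=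
  fun c => if 2 ≤ c then h (c - 1) else if c = 1 then 0 else 1 - h (1 - c)

theorem doubleState_zero : doubleState 0 = vacuum := by
  funext c
  simp only [doubleState, vacuum, Pi.zero_apply]
  split_ifs <;> omega

/-- A part k ≥ 1 of a strict partition appears in the doubled diagram as a particle at site k + 1
and a hole at site 1 - k. Enlarging the part moves both, by hops of contents k + 1 and -k, and the
sign of `x` decides which of them comes first. -/
theorem doubleState_hop (h : ℤ → ℤ) (x : ℤ) :
    hop (hop (doubleState h) (letterContent x)) (mirrorContent x) =
      doubleState (hop h |x|) := by
  funext c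
  rcases abs_cases x with ⟨e, hx⟩ | ⟨e, hx⟩ <;> rw [e] <;>
    simp only [hop, doubleState, letterContent, mirrorContent] <;> split_ifs <;> omega

theorem hopShape_doubleState {h : ℤ → ℤ} (hs : HopShape (Set.Ici 1) h) :
    HopShape Set.univ (doubleState h) := by
  intro c _
  simp only [doubleState]
  split_ifs with h1 h2
  · exact hs (c - 1) (by simp only [Set.mem_Ici]; omega)
  · exact Or.inl rfl
  · have := hs (1 - c) (by simp only [Set.mem_Ici]; omega)
    omega

theorem HopPath.to_double {h : ℤ → ℤ} {w : List ℤ} (hw : HopPath (Set.Ici 1) h (w.map abs)) :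
    HopPath Set.univ (doubleState h) (doubleWord w) := by
  induction w generalizing h with
  | nil => exact hopShape_doubleState hw
  | cons x w ih =>
    refine ⟨hopShape_doubleState hw.1, ?_, doubleState_hop h x ▸ ih hw.2⟩
    have h0 := hopShape_doubleState hw.1
    have h2 := hopShape_doubleState hw.2.shape
    rw [← doubleState_hop] at h2
    intro c _
    have k0 := h0 c trivial
    have k2 := h2 c trivial
    have e : doubleState h 1 = 0 := rfl
    -- On the main diagonal the order of the two hops is forced: one particle moves from site 0
    -- through site 1 to site 2.
    by_cases hx : x = 0
    · subst hx
      simp only [hop, letterContent, mirrorContent] at *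
      by_cases hc : c = 1
      · subst hc
        simp [e]
      · split_ifs at * <;> omega
    · simp only [hop, letterContent, mirrorContent] at *
      split_ifs at * <;> omega

theorem SignedPath.to_double {w : List ℤ} (hw : SignedPath w) :
    HopPath Set.univ vacuum (doubleWord w) :=
  doubleState_zero ▸ HopPath.to_double hw

theorem HopPath.ne_of_nonneg {g : ℤ → ℤ} {a b : ℤ} {w : List ℤ} (ha : 0 ≤ a)
    (h : HopPath (Set.Ici 1) g (a :: b :: w)) : a ≠ b := by
  rintro rfl
  have h1 := h.1 (a + 1) (by simp only [Set.mem_Ici]; omega)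
  have h3 := h.2.2.shape (a + 1) (by simp only [Set.mem_Ici]; omega)
  simp only [hop] at h3
  split_ifs at h3 <;> omega

/-- Toggles do not change absolute values, and letters are exchanged only if their absolute values
are neither equal nor adjacent, so that the hops commute. -/
theorem HopPath.map_abs_triple {g : ℤ → ℤ} {w : List ℤ}
    (h : HopPath (Set.Ici 1) g (w.map abs)) (j : ℕ) :
    HopPath (Set.Ici 1) g ((mapTriple signedTriple j w).map abs) := by
  induction w generalizing g j with
  | nil => cases j <;> exact h
  | cons x w ih =>
    rcases j with _ | j
    · rcases w with _ | ⟨y, _ | ⟨z, w⟩⟩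
      · exact h
      · exact h
      have e1 : |x| ≠ |y| := HopPath.ne_of_nonneg (abs_nonneg _) h
      have e2 : |y| ≠ |z| := HopPath.ne_of_nonneg (abs_nonneg _) h.2
      simp only [mapTriple, signedTriple]
      split_ifs with c1 c2 c3 c4 c5
      · exact h
      · simpa using h
      · simpa using h
      · exact ⟨h.1, h.2.swap (by rcases abs_cases (|y| - |z|) with h | h <;> omega)⟩
      · simpa using h
      · exact h.swap (by rcases abs_cases (|x| - |y|) with h | h <;> omega)
    · exact ⟨h.1, ih h.2 j⟩

theorem SignedPath.map_triples {v w : List ℤ} (h : SignedPath (v ++ w)) (q : List ℕ) :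
    SignedPath (v ++ mapTriples signedTriple q w) := by
  induction q generalizing w with
  | nil => exact h
  | cons j q ih =>
    refine ih ?_
    have := HopPath.map_abs_triple h (v.length + j)
    rwa [mapTriple_append_right] at this

theorem map_abs_mapTriple_perm (j : ℕ) (w : List ℤ) :
    ((mapTriple signedTriple j w).map abs).Perm (w.map abs) := by
  fun_induction mapTriple signedTriple j w with
  | case1 x y z w =>
    simp only [signedTriple]
    split_ifs <;> simp only [List.map_cons, abs_neg] <;>
      first
        | exact List.Perm.refl _
        | exact (List.Perm.swap _ _ _).cons _
        | exact List.Perm.swap _ _ _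
  | case2 j x w ih => exact ih.cons _
  | case3 => exact List.Perm.refl _

/-! ### Orbits of factors of signed content words -/

/-- The straight content word to which the factor `w` is sorted, when it comes after `v`. -/
def sortAfter (v w : List ℤ) : List ℤ := (doubleSort (doubleWord v) w).1

theorem SignedPath.double_append {v w : List ℤ} (h : SignedPath (v ++ w)) :
    HopPath Set.univ vacuum (doubleWord v ++ doubleWord w) := by
  rw [← doubleWord_append]
  exact h.to_double

theorem SignedPath.doubleSort_mapTriples {v w : List ℤ} (h : SignedPath (v ++ w)) (q : List ℕ) :
    doubleSort (doubleWord v) (mapTriples signedTriple q w) =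
      (mapTriples dualTriple q (doubleSort (doubleWord v) w).1,
        mapTriples dualTriple (q.map ((doubleWord v).length + ·))
          (doubleSort (doubleWord v) w).2) := by
  induction q generalizing w with
  | nil => rfl
  | cons j q ih =>
    have := ih (w := mapTriple signedTriple j w) (h.map_triples [j])
    rw [doubleSort_mapTriple h.double_append] at this
    exact this

theorem SignedPath.sortAfter_mapTriples {v w : List ℤ} (h : SignedPath (v ++ w)) (q : List ℕ) :
    sortAfter v (mapTriples signedTriple q w) =
      mapTriples dualTriple q (sortAfter v w) := by
  rw [sortAfter, h.doubleSort_mapTriples]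
  rfl

theorem sortAfter_length (v w : List ℤ) : (sortAfter v w).length = w.length :=
  (doubleSort_length _ _).1

theorem SignedPath.hopPath_sortAfter {v w : List ℤ} (h : SignedPath (v ++ w)) :
    HopPath Set.univ vacuum (sortAfter v w) :=
  (hopPath_append.1 h.double_append.doubleSort).1

theorem SignedPath.ascAt_sortAfter {v w : List ℤ} (h : SignedPath (v ++ w)) (j : ℕ) :
    AscAt j (sortAfter v w) ↔ AscAt j w :=
  (ascAt_doubleSort h.double_append j).1

theorem mapTriples_append_right (t : ℤ → ℤ → ℤ → ℤ × ℤ × ℤ) (q : List ℕ) (v w : List ℤ) :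
    mapTriples t (q.map (v.length + ·)) (v ++ w) = v ++ mapTriples t q w := by
  induction q generalizing w with
  | nil => rfl
  | cons j q ih =>
    have := ih (mapTriple t j w)
    rw [← mapTriple_append_right] at this
    exact this

theorem passWord_mapTriples {g : ℤ → ℤ} {G w : List ℤ}
    (h : HopPath Set.univ g (G ++ w)) (q : List ℕ) :
    passWord G (mapTriples dualTriple q w) =
      (mapTriples dualTriple q (passWord G w).1, (passWord G w).2) := by
  induction q generalizing w with
  | nil => rfl
  | cons j q ih =>
    obtain ⟨h1, h2⟩ := hopPath_append.1 h
    have := ih (w := mapTriple dualTriple j w) (hopPath_append.2 ⟨h1, h2.mapTriple_dual j⟩)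
    rw [passWord_mapTriple h] at this
    exact this

/-- Two words in one orbit that are sorted to the same straight content word are equal. -/
theorem SignedPath.eq_of_sortAfter_eq {v w : List ℤ} (h : SignedPath (v ++ w)) {p : List ℕ}
    (he : sortAfter v (mapTriples signedTriple p w) = sortAfter v w) :
    mapTriples signedTriple p w = w := by
  have hd := h.double_append
  have hA := h.doubleSort_mapTriples
  have hpath := hd.doubleSort
  have hl := doubleSort_length (doubleWord v) w
  -- Throughout the orbit the mirror images have the ascents complementary to those of the sorted
  -- letters.
  have hasc : ∀ q j, j + 2 ≤ w.length →
      (AscAt ((doubleWord v).length + j)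
        (doubleSort (doubleWord v) (mapTriples signedTriple q w)).2 ↔
      ¬ AscAt j (mapTriples dualTriple q (sortAfter v w))) := by
    intro q j hj
    rw [← h.sortAfter_mapTriples, (h.map_triples q).ascAt_sortAfter]
    exact (ascAt_doubleSort (h.map_triples q).double_append j).2 (by rwa [mapTriples_length])
  rw [h.sortAfter_mapTriples] at he
  -- `P` consists of the ghosts coming from `v`, and `C` of those that are mirror images of letters
  -- of `w`.
  obtain ⟨P, C, hPC, hPl⟩ : ∃ P C, (doubleSort (doubleWord v) w).2 = P ++ C ∧
      P.length = (doubleWord v).length := by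
    refine ⟨_, _, (List.take_append_drop (doubleWord v).length _).symm, ?_⟩
    rw [List.length_take]
    omega
  have hCl : C.length = w.length := by
    have := congrArg List.length hPC
    rw [List.length_append, hPl, hl.2] at this
    omega
  rw [hPC] at hpath hA
  simp only [← hPl, mapTriples_append_right] at hA
  rw [← List.append_assoc] at hpath
  set A := (doubleSort (doubleWord v) w).1 with hAdef
  have hAs : sortAfter v w = A := rfl
  rw [hAs] at he hasc
  -- Sliding `C` to the left through `A` and `P` rectifies the mirror images to a straight content
  -- word, with the same ascents and the same moves.
  have hD := passWord_mapTriples hpath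
  have hDl := (passWord_length (A ++ P) C).1
  have hDpath : HopPath Set.univ vacuum (passWord (A ++ P) C).1 := by
    have := HopPath.passWord (G := A ++ P) (w := C) (t := [])
      (by rw [List.append_nil]; exact hpath)
    exact (hopPath_append.1 this).1
  have hasc2 : ∀ q j, j + 2 ≤ w.length →
      (AscAt j (mapTriples dualTriple q (passWord (A ++ P) C).1) ↔
        ¬ AscAt j (mapTriples dualTriple q A)) := by
    intro q j hj
    rw [← hasc q j hj, hA q, ← hPl, ascAt_append_right]
    have h1 : HopPath Set.univ vacuum ((A ++ P) ++ mapTriples dualTriple q C) := by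
      obtain ⟨h1, h2⟩ := hopPath_append.1 hpath
      exact hopPath_append.2 ⟨h1, h2.mapTriples_dual q⟩
    have := ascAt_passWord h1 j
    rwa [hD q] at this
  -- Since `p` fixes `A`, the rectified mirror images and their image under `p` have the same
  -- ascents after all moves `q`, so they coincide. Reversing the slides then gives `C` and finally
  -- `w`.
  have hDe : (passWord (A ++ P) C).1 =
      mapTriples dualTriple p (passWord (A ++ P) C).1 := by
    refine HopPath.eq_of_ascAt w.length _ _ (by omega) (by rw [mapTriples_length]; omega) hDpath
      (hDpath.mapTriples_dual p) fun q _ j hj => ?_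
    rw [hasc2 q j hj, ← mapTriples_append, hasc2 (p ++ q) j hj, mapTriples_append, he]
  have hCe : C = mapTriples dualTriple p C := by
    refine (passWord_injective (G := A ++ P) (G' := A ++ P) ?_).2
    rw [hD p]
    exact Prod.ext hDe rfl
  refine (doubleSort_injective (mapTriples_length _ _ _)
    (G := doubleWord v) (G' := doubleWord v) ?_).2
  rw [hA p, he, ← hCe, ← hPC]

/-! ### Connectedness of signed content words -/

/-- The elementary involutions on words of diagonals. -/
def signedMove : ℕ → List ℤ → List ℤ
  | 0, x :: y :: w => x :: -y :: w
  | i + 2, w => mapTriple signedTriple i w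
  | _, w => w

theorem signedMove_length (i : ℕ) (w : List ℤ) : (signedMove i w).length = w.length := by
  unfold signedMove
  split
  · rfl
  · exact mapTriple_length _ _ _
  · rfl

theorem signedMove_append {i : ℕ} {v : List ℤ} (w : List ℤ) (h : i + 1 ≤ v.length)
    (h2 : 2 ≤ v.length) : signedMove i (v ++ w) = signedMove i v ++ w := by
  rcases i with _ | _ | i
  · rcases v with _ | ⟨x, _ | ⟨y, v⟩⟩
    · simp at h2
    · simp at h2
    · rfl
  · rfl
  · exact mapTriple_append_left _ _ _ _ (by omega)

theorem map_abs_signedMove_perm (i : ℕ) (w : List ℤ) :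
    ((signedMove i w).map abs).Perm (w.map abs) := by
  unfold signedMove
  split
  · simp
  · exact map_abs_mapTriple_perm _ _
  · exact List.Perm.refl _

theorem SignedPath.move {w : List ℤ} (h : SignedPath w) (i : ℕ) :
    SignedPath (signedMove i w) := by
  unfold signedMove
  split
  · simpa [SignedPath] using h
  · exact HopPath.map_abs_triple h _
  · exact h

/-- Successive application of the involutions whose indices are listed. -/
def signedMoves (l : List ℕ) (w : List ℤ) : List ℤ := l.foldl (fun u i => signedMove i u) w

theorem signedMoves_append (l l' : List ℕ) (w : List ℤ) :
    signedMoves (l ++ l') w = signedMoves l' (signedMoves l w) := by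
  simp [signedMoves]

theorem signedMoves_append_word {l : List ℕ} {v : List ℤ} (w : List ℤ)
    (h : ∀ i ∈ l, i + 1 ≤ v.length) (h2 : 2 ≤ v.length) :
    signedMoves l (v ++ w) = signedMoves l v ++ w := by
  induction l generalizing v with
  | nil => rfl
  | cons i l ih =>
    have := ih (v := signedMove i v) (fun j hj => by rw [signedMove_length]; exact h j (by simp [hj]))
      (by rwa [signedMove_length])
    rw [← signedMove_append w (h i (by simp)) h2] at this
    exact this

/-- `w'` is reached from `w` by involutions of index at most `k`, using `k` at most `m` times. -/
def Reach (k m : ℕ) (w w' : List ℤ) : Prop :=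
  ∃ l : List ℕ, (∀ h ∈ l, h ≤ k ∧ h ≠ 1) ∧ l.count k ≤ m ∧ w' = signedMoves l w

theorem Reach.trans {k m m' : ℕ} {u v w : List ℤ} (h : Reach k m u v) (h' : Reach k m' v w) :
    Reach k (m + m') u w := by
  obtain ⟨l, h1, h2, rfl⟩ := h
  obtain ⟨l', h1', h2', rfl⟩ := h'
  refine ⟨l ++ l', ?_, ?_, (signedMoves_append _ _ _).symm⟩
  · intro i hi
    rcases List.mem_append.1 hi with hi | hi
    · exact h1 i hi
    · exact h1' i hi
  · rw [List.count_append]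
    omega

theorem Reach.mono {k m m' : ℕ} {u v : List ℤ} (h : Reach k m u v) (hm : m ≤ m') :
    Reach k m' u v := by
  obtain ⟨l, h1, h2, h3⟩ := h
  exact ⟨l, h1, h2.trans hm, h3⟩

theorem Reach.append {k m : ℕ} {u v w : List ℤ} (h : Reach k m u v) (h1 : k + 1 ≤ u.length)
    (h2 : 2 ≤ u.length) : Reach (k + 1) 0 (u ++ w) (v ++ w) := by
  obtain ⟨l, h3, h4, rfl⟩ := h
  refine ⟨l, fun i hi => ⟨(h3 i hi).1.trans (by omega), (h3 i hi).2⟩, ?_, ?_⟩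
  · rw [Nat.le_zero, List.count_eq_zero]
    intro hk
    have := (h3 _ hk).1
    omega
  · exact (signedMoves_append_word w (fun i hi => by have := (h3 i hi).1; omega) h2).symm

theorem reach_triple {k : ℕ} (s : List ℤ) {x y z p q r : ℤ} (hk : k = s.length + 2)
    (h : signedTriple x y z = (p, q, r)) : Reach k 1 (s ++ [x, y, z]) (s ++ [p, q, r]) := by
  refine ⟨[k], by simp; omega, by simp, ?_⟩
  subst hk
  have := mapTriple_append_right signedTriple 0 s [x, y, z]
  simp only [add_zero, mapTriple, h] at this
  exact this.symm

/-- Removable contents of the configuration of a shifted content word. -/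
def IsRemovable (g : ℤ → ℤ) (c : ℤ) : Prop := (1 ≤ c → g c = 0) ∧ 0 ≤ c ∧ g (c + 1) = 1

/-- Descending from `q` through occupied sites ends above an empty site or above the reservoir at
site 0. -/
theorem exists_isRemovable_lt {g : ℤ → ℤ} (hg : HopShape (Set.Ici 1) g) {q : ℤ} (hq : 1 ≤ q)
    (h : g q = 1) : ∃ x, x < q ∧ IsRemovable g x := by
  obtain ⟨k, rfl⟩ : ∃ k : ℕ, q = 1 + k := ⟨(q - 1).toNat, by omega⟩
  induction k with
  | zero => exact ⟨0, by simp, by simp, le_rfl, by simpa using h⟩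
  | succ k ih =>
    rcases hg (1 + k) (by simp only [Set.mem_Ici]; omega) with h0 | h1
    · refine ⟨1 + k, by push_cast; omega, fun _ => h0, by omega, ?_⟩
      rw [show (1 : ℤ) + k + 1 = 1 + ((k + 1 : ℕ) : ℤ) by push_cast; ring]
      exact h
    · obtain ⟨x, hx, hx'⟩ := ih (by omega) h1
      exact ⟨x, by push_cast; omega, hx'⟩

theorem signed_length_two {w : List ℤ} (h : SignedPath w) (hl : w.length = 2) :
    w = [0, 1] ∨ w = [0, -1] := by
  obtain ⟨x, y, rfl⟩ := List.length_eq_two.1 hl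
  have h1 : HopPath (Set.Ici 1) 0 [|x|, |y|] := h
  have hx := h1.2.1 (|x|) 
  have hx1 := h1.2.1 (|x| + 1) (by simp only [Set.mem_Ici]; have := abs_nonneg x; omega)
  have hy := h1.2.2 (|y|)
  have hy1 := h1.2.2 (|y| + 1) (by simp only [Set.mem_Ici]; have := abs_nonneg y; omega)
  have n1 := abs_nonneg x
  have n2 := abs_nonneg y
  simp only [hop, Set.mem_Ici, Pi.zero_apply] at hx hx1 hy hy1
  have e1 : |x| = 0 := by split_ifs at hx <;> omega
  have e2 : |y| = 1 := by split_ifs at hy hy1 <;> omega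
  rcases abs_cases x with h | h <;> rcases abs_cases y with h' | h' <;> simp <;> omega

theorem SignedPath.isRemovable_concat {w : List ℤ} {u : ℤ} (h : SignedPath (w ++ [u])) :
    IsRemovable (((w ++ [u]).map abs).foldl hop 0) |u| := by
  have h1 : HopPath (Set.Ici 1) 0 (w.map abs ++ [|u|]) := by simpa [SignedPath] using h
  have := h1.concat_apply' (by simp only [Set.mem_Ici]; have := abs_nonneg u; omega)
  rw [List.map_append]
  exact ⟨this.1, abs_nonneg u, this.2⟩

/-- Rearrangements of a shifted content word that end in a given removable content. -/
theorem HopPath.exists_concat_of_isRemovable {a : List ℤ} (h : HopPath (Set.Ici 1) 0 a)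
    (ha : ∀ c ∈ a, 0 ≤ c) {c : ℤ} (hc : IsRemovable (a.foldl hop 0) c) :
    ∃ v, HopPath (Set.Ici 1) 0 (v ++ [c]) ∧ (v ++ [c]).Perm a ∧
      ∀ x, (v.foldl hop 0) x = a.foldl hop 0 x + (if x = c then 1 else 0) -
        (if x = c + 1 then 1 else 0) := by
  obtain ⟨h1, h2, h3⟩ := hc
  obtain ⟨v, hv, hp⟩ := h.exists_perm_concat isHopStart_zero a
    (fun c hc => by simp only [Set.mem_Ici]; have := ha c hc; omega) c
    (by simp only [Set.mem_Ici]; omega) h1 h3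
  refine ⟨v, hv, hp, fun x => ?_⟩
  rw [← hop_foldl_perm hp, List.foldl_append]
  simp only [List.foldl_cons, List.foldl_nil, hop]
  ring

/-- The configuration before a last hop of content `c`. -/
def unhop (g : ℤ → ℤ) (c : ℤ) : ℤ → ℤ :=
  fun x => g x + (if x = c then 1 else 0) - (if x = c + 1 then 1 else 0)

theorem HopPath.exists_concat_three {a : List ℤ} (h : HopPath (Set.Ici 1) 0 a)
    (ha : ∀ c ∈ a, 0 ≤ c) {x y z : ℤ} (hz : IsRemovable (a.foldl hop 0) z)
    (hy : IsRemovable (unhop (a.foldl hop 0) z) y)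
    (hx : IsRemovable (unhop (unhop (a.foldl hop 0) z) y) x) :
    ∃ t, HopPath (Set.Ici 1) 0 (t ++ [x, y, z]) ∧ (t ++ [x, y, z]).Perm a := by
  obtain ⟨v, hv, hvp, hvs⟩ := h.exists_concat_of_isRemovable ha hz
  have e1 : unhop (a.foldl hop 0) z = v.foldl hop 0 := funext fun x => (hvs x).symm
  rw [e1] at hx hy
  have hvn : ∀ c ∈ v, 0 ≤ c := fun c hc => ha c (hvp.subset (by simp [hc]))
  obtain ⟨u, hu, hup, hus⟩ :=
    (hopPath_append.1 hv).1.exists_concat_of_isRemovable hvn hy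
  have e2 : unhop (v.foldl hop 0) y = u.foldl hop 0 := funext fun x => (hus x).symm
  rw [e2] at hx
  have hun : ∀ c ∈ u, 0 ≤ c := fun c hc => hvn c (hup.subset (by simp [hc]))
  obtain ⟨t, ht, htp, -⟩ :=
    (hopPath_append.1 hu).1.exists_concat_of_isRemovable hun hx
  have hq := (htp.append_right [y]).trans hup
  refine ⟨t, ?_, ?_⟩
  · have : HopPath (Set.Ici 1) 0 (t ++ [x] ++ [y] ++ [z]) := by
      refine hopPath_append.2 ⟨hopPath_append.2 ⟨ht, ?_⟩, ?_⟩
      · rw [hop_foldl_perm htp]; exact (hopPath_append.1 hu).2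
      · rw [hop_foldl_perm hq]; exact (hopPath_append.1 hv).2
    simpa using this
  · simpa using (hq.append_right [z]).trans hvp

/-- If `1` is the only removable content, then the part `3` is occupied, except for the partition
whose only part is `2`. -/
theorem HopPath.apply_three {a : List ℤ} (h : HopPath (Set.Ici 1) 0 a)
    (ha : ∀ c ∈ a, 0 ≤ c) (hl : 3 ≤ a.length)
    (hr : ∀ c, IsRemovable (a.foldl hop 0) c ↔ c = 1) : a.foldl hop 0 3 = 1 := by
  have hs := h.end_shape
  obtain ⟨v, hv, hvp, hvs⟩ := h.exists_concat_of_isRemovable ha ((hr 1).2 rfl)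
  obtain ⟨h1, -, h2⟩ := (hr 1).2 rfl
  generalize a.foldl hop 0 = g at *
  rcases hs 3 (by simp) with h3 | h3
  swap
  · exact h3
  exfalso
  -- A part larger than 3 while 3 is not a part would yield a removable content of at least 3.
  have hz : ∀ k, 3 ≤ k → g k = 0 := by
    intro k hk
    rcases hs k (by simp only [Set.mem_Ici]; omega) with h4 | h4
    · exact h4
    exfalso
    have hk3 : k ≠ 3 := by rintro rfl; omega
    obtain ⟨x, hx1, hx2, hx3, hx4⟩ := exists_hop_back hs (p := 3) (q := k) (by omega)
      (fun c _ _ => by simp only [Set.mem_Ici]; omega) h3 h4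
    have := (hr x).1 ⟨fun _ => hx3, by omega, hx4⟩
    omega
  have hvl := hvp.length_eq
  simp only [List.length_append, List.length_singleton] at hvl
  have hvn : ∀ c ∈ v, 0 ≤ c := fun c hc => ha c (hvp.subset (by simp [hc]))
  -- Now 2 is the only part, and before the last hop the only part is 1. Hence the hop before it has
  -- content 0 and starts from the empty shape, contrary to the length of the word.
  obtain ⟨u, b, rfl⟩ : ∃ s u, v = s ++ [u] :=
    ⟨_, _, (List.dropLast_append_getLast (by rintro rfl; simp at hvl; omega)).symm⟩
  simp only [List.length_append, List.length_singleton] at hvl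
  have hb0 := hvn b (by simp)
  have hb := ((hopPath_append.1 hv).1.concat_apply' (by simp only [Set.mem_Ici]; omega)).2
  rw [hvs] at hb
  obtain rfl : b = 0 := by
    have h1 := h1 le_rfl
    by_contra hne
    by_cases hb1 : b = 1
    · subst hb1; norm_num at hb; norm_num at h2; omega
    · have := hz (b + 1 ) 
      split_ifs at hb <;> omega
  obtain ⟨t, d, rfl⟩ : ∃ s e, u = s ++ [e] :=
    ⟨_, _, (List.dropLast_append_getLast (by rintro rfl; simp at hvl; omega)).symm⟩
  have hd0 := hvn d (by simp)
  have hd := ((hopPath_append.1 (hopPath_append.1 hv).1).1.concat_apply'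
    (by simp only [Set.mem_Ici]; omega)).2
  have hd' := hvs (d + 1)
  rw [List.foldl_append] at hd'
  simp only [List.foldl_cons, List.foldl_nil, hop] at hd'
  rw [hd] at hd'
  have h1 := h1 le_rfl
  have h2' : g 2 = 1 := h2
  by_cases hd1 : d = 0
  · subst hd1; norm_num at hd'; omega
  by_cases hd2 : d = 1
  · subst hd2; norm_num at hd'; omega
  · have := hz (d + 1) (by omega)
    split_ifs at hd' <;> omega

theorem map_abs_eq_self {v : List ℤ} (h : ∀ c ∈ v, 0 ≤ c) : v.map abs = v :=
  (List.map_congr_left fun c hc => abs_of_nonneg (h c hc)).trans (List.map_id v)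

/-- Members of a class of signed content words are connected by the elementary involutions of index
at most `k`, using `k` at most twice. -/
theorem SignedPath.reach (k : ℕ) : ∀ w w' : List ℤ, w.length = k + 2 → SignedPath w →
    SignedPath w' → (w.map abs).Perm (w'.map abs) → Reach (k + 1) 2 w w' := by
  induction k with
  | zero =>
    intro w w' hl h h' hp
    have hl' : w'.length = 2 := by simpa using hp.length_eq.symm.trans (by simpa using hl)
    have e0 : Reach (0 + 1) 2 w w := ⟨[], by simp, by simp, rfl⟩
    have e1 : Reach (0 + 1) 2 w (signedMove 0 w) := ⟨[0], by simp, by simp, rfl⟩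
    rcases signed_length_two h hl with rfl | rfl <;>
      rcases signed_length_two h' hl' with rfl | rfl <;>
      first
        | exact e0
        | exact e1
  | succ k ih =>
    intro w w' hl h h' hp
    have hlen : ∀ {v : List ℤ}, (w.map abs).Perm (v.map abs) → v.length = k + 3 := fun hv => by
      have := hv.length_eq
      simp only [List.length_map] at this
      omega
    -- With equal last letters the induction hypothesis applies to the remaining letters, and its
    -- moves all have smaller index than the new top index.
    have same : ∀ {v v' : List ℤ} {s s' t : List ℤ} {u : ℤ}, v = s ++ t ++ [u] →
        v' = s' ++ [u] → SignedPath v → SignedPath v' →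
        (w.map abs).Perm (v.map abs) → (w.map abs).Perm (v'.map abs) →
        Reach (k + 1 + 1) 0 v v' := by
      rintro v v' s s' t u rfl rfl hv hv' hp hp'
      have l1 := hlen hp
      have l2 := hlen hp'
      rw [List.length_append, List.length_singleton] at l1 l2
      have hv1 : SignedPath (s ++ t) := by
        rw [SignedPath, List.map_append] at hv
        exact (hopPath_append.1 hv).1
      have hv2 : SignedPath s' := by
        rw [SignedPath, List.map_append] at hv'
        exact (hopPath_append.1 hv').1
      have hp1 := hp.symm.trans hp'
      rw [List.map_append, List.map_append (l₁ := s')] at hp1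
      have := ih _ _ (by omega) hv1 hv2 ((List.perm_append_right_iff _).1 hp1)
      exact this.append (by omega) (by omega)
    obtain ⟨g, hg⟩ : ∃ g, g = (w.map abs).foldl hop 0 := ⟨_, rfl⟩
    have hshape : HopShape (Set.Ici 1) g := hg ▸ HopPath.end_shape h
    have hnn : ∀ c ∈ w.map abs, 0 ≤ c := by
      intro c hc
      obtain ⟨x, -, rfl⟩ := List.mem_map.1 hc
      exact abs_nonneg x
    -- words whose last letters have different absolute values
    have edge : ∀ {v v' s s' : List ℤ} {u u' : ℤ}, v = s ++ [u] → v' = s' ++ [u'] →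
        |u| < |u'| → IsRemovable g |u| → IsRemovable g |u'| → SignedPath v → SignedPath v' →
        (w.map abs).Perm (v.map abs) → (w.map abs).Perm (v'.map abs) →
        Reach (k + 1 + 1) 1 v v' ∧ Reach (k + 1 + 1) 1 v' v := by
      intro v v' s s' u u' e e' hlt hr hr' hv hv' hp hp'
      obtain ⟨t, x, hx1, hx2, ht, htp⟩ := HopPath.exists_between isHopStart_zero h
        (fun c hc => by simp only [Set.mem_Ici]; have := hnn c hc; omega) hlt
        (fun c hc => by simp only [Set.mem_Ici]; have := abs_nonneg u; omega)
        (by rw [← hg]; exact hr.1) (by rw [← hg]; exact hr.2.2)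
        (by rw [← hg]; exact hr'.1 (by have := abs_nonneg u; omega)) (by rw [← hg]; exact hr'.2.2)
      have htn : ∀ c ∈ t, 0 ≤ c := fun c hc => hnn c (htp.subset (by simp [hc]))
      have hte := map_abs_eq_self htn
      -- With the sign of `u'`, the letter `X` lies strictly between `u` and `u'`. As its absolute
      -- value lies between theirs as well, these are not adjacent, so the top move swaps the last
      -- two letters of `X, u, u'`.
      obtain ⟨X, hXa, hXs⟩ : ∃ X : ℤ, |X| = x ∧ (0 < u' ∧ X = x ∨ u' < 0 ∧ X = -x) := by
        have := abs_nonneg u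
        rcases abs_cases u' with h | h
        · exact ⟨x, abs_of_nonneg (by omega), by omega⟩
        · exact ⟨-x, by rw [abs_neg, abs_of_nonneg (by omega)], by omega⟩
      have a1 : (t ++ [X, u, u']).map abs = t ++ [x, |u|, |u'|] := by simp [hte, hXa]
      have a2 : ((t ++ [X, u', u]).map abs).Perm ((t ++ [X, u, u']).map abs) := by
        simp only [List.map_append, List.map_cons, List.map_nil]
        exact List.Perm.append_left _ ((List.Perm.swap _ _ _).cons _)
      have p1 : SignedPath (t ++ [X, u, u']) := by rw [SignedPath, a1]; exact ht
      have t1 : signedTriple X u u' = (X, u', u) := by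
        rcases abs_cases u with h | h <;> rcases abs_cases u' with h' | h' <;>
        rw [signedTriple, if_neg (by omega), if_neg (by omega), if_pos (by omega),
          if_neg (by omega)]
      have t2 : signedTriple X u' u = (X, u, u') := by
        rcases abs_cases u with h | h <;> rcases abs_cases u' with h' | h' <;>
        rw [signedTriple, if_neg (by omega), if_neg (by omega), if_pos (by omega),
          if_neg (by omega)]
      have q1 : (w.map abs).Perm ((t ++ [X, u, u']).map abs) := a1 ▸ htp.symm
      have q2 : (w.map abs).Perm ((t ++ [X, u', u]).map abs) := q1.trans a2.symm
      have p2 : SignedPath (t ++ [X, u', u]) := by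
        have := HopPath.map_abs_triple p1 t.length
        have e := mapTriple_append_right signedTriple 0 t [X, u, u']
        rw [add_zero] at e
        rw [e] at this
        simp only [mapTriple, t1] at this
        exact this
      have l1 := hlen q1
      simp only [List.length_append, List.length_cons, List.length_nil] at l1
      have hk : k + 1 + 1 = t.length + 2 := by omega
      have r1 := reach_triple t hk t1
      have r2 := reach_triple t hk t2
      have s1 : t ++ [X, u, u'] = (t ++ [X, u]) ++ [] ++ [u'] := by simp
      have s2 : t ++ [X, u', u] = (t ++ [X, u']) ++ [] ++ [u] := by simp
      constructor
      · have c1 := same (t := []) (s' := t ++ [X, u']) (by simpa using e) (by simp) hv p2 hp q2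
        have c2 := same s1 e' p1 hv' q1 hp'
        simpa using (c1.trans r2).trans c2
      · have c1 := same (t := []) (s' := t ++ [X, u]) (by simpa using e') (by simp) hv' p1 hp' q1
        have c2 := same s2 e p2 hv q2 hp
        simpa using (c1.trans r1).trans c2
    obtain ⟨s, u, rfl⟩ : ∃ s u, w = s ++ [u] :=
      ⟨_, _, (List.dropLast_append_getLast (by rintro rfl; simp at hl)).symm⟩
    have hl' := hlen hp
    obtain ⟨s', u', rfl⟩ : ∃ s u, w' = s ++ [u] :=
      ⟨_, _, (List.dropLast_append_getLast (by rintro rfl; simp at hl')).symm⟩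
    have hu : IsRemovable g |u| := hg ▸ h.isRemovable_concat
    have hu' : IsRemovable g |u'| := by
      rw [hg, hop_foldl_perm hp]
      exact h'.isRemovable_concat
    have hrefl := List.Perm.refl ((s ++ [u]).map abs)
    rcases lt_trichotomy |u| |u'| with hlt | heq | hlt
    · exact (edge rfl rfl hlt hu hu' h h' hrefl hp).1.mono (by omega)
    swap
    · exact (edge rfl rfl hlt hu' hu h' h hp hrefl).2.mono (by omega)
    by_cases huu : u = u'
    · subst huu
      exact (same (s := s) (t := []) (u := u) (by simp) rfl h h' hrefl hp).mono (by omega)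
    have hneg : u' = -u := by
      rcases abs_cases u with h | h <;> rcases abs_cases u' with h' | h' <;> omega
    -- The last letters are now opposite. Through a word that ends in another removable content, two
    -- edges connect them; this is where the top index may be needed twice.
    by_cases hj : ∃ j, IsRemovable g j ∧ j ≠ |u|
    · obtain ⟨j, hj, hju⟩ := hj
      obtain ⟨t, ht, htp, -⟩ := HopPath.exists_concat_of_isRemovable h hnn (hg ▸ hj)
      have hte : (t ++ [j]).map abs = t ++ [j] :=
        map_abs_eq_self fun c hc => hnn c (htp.subset hc)
      have hm : SignedPath (t ++ [j]) := by rw [SignedPath, hte]; exact ht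
      have hmp : ((s ++ [u]).map abs).Perm ((t ++ [j]).map abs) := by
        rw [hte]; exact htp.symm
      have hja : |j| = j := abs_of_nonneg hj.2.1
      have hrj : IsRemovable g |j| := by rw [hja]; exact hj
      rcases lt_or_gt_of_ne hju with hlt | hlt
      · exact (edge rfl rfl (by rw [hja]; exact hlt) hrj hu hm h hmp hrefl).2.trans
          (edge rfl rfl (by rw [← heq, hja]; exact hlt) hrj hu' hm h' hmp hp).1
      · exact (edge rfl rfl (by rw [hja]; exact hlt) hu hrj h hm hrefl hmp).1.trans
          (edge rfl rfl (by rw [← heq, hja]; exact hlt) hu' hrj h' hm hp hmp).2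
    have honly : ∀ j, IsRemovable g j ↔ j = |u| := fun j =>
      ⟨fun hj' => by_contra fun hne => hj ⟨j, hj', hne⟩, fun e => e ▸ hu⟩
    -- With a single removable content, the top move must itself toggle the last letter, together
    -- with an adjacent `Y`, while `X` in front of them is the median.
    have flip : ∀ t X Y, HopPath (Set.Ici 1) 0 (t ++ [|X|, |Y|, |u|]) →
        (t ++ [|X|, |Y|, |u|]).Perm ((s ++ [u]).map abs) →
        signedTriple X Y u = (X, -Y, -u) → Reach (k + 1 + 1) 2 (s ++ [u]) (s' ++ [u']) := by
      intro t X Y ht htp e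
      have hte := map_abs_eq_self fun c hc => hnn c (htp.subset (List.mem_append_left _ hc))
      have e1 : (t ++ [X, Y, u]).map abs = t ++ [|X|, |Y|, |u|] := by simp [hte]
      have e2 : (t ++ [X, -Y, -u]).map abs = t ++ [|X|, |Y|, |u|] := by simp [hte]
      have p1 : SignedPath (t ++ [X, Y, u]) := by rw [SignedPath, e1]; exact ht
      have p2 : SignedPath (t ++ [X, -Y, -u]) := by rw [SignedPath, e2]; exact ht
      have q1 : ((s ++ [u]).map abs).Perm ((t ++ [X, Y, u]).map abs) := by
        rw [e1]; exact htp.symm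
      have q2 : ((s ++ [u]).map abs).Perm ((t ++ [X, -Y, -u]).map abs) := by
        rw [e2]; exact htp.symm
      have l1 := hlen q1
      simp only [List.length_append, List.length_cons, List.length_nil] at l1
      have r := reach_triple (k := k + 1 + 1) t (by omega) e
      have c1 := same (s := s) (t := []) (u := u) (s' := t ++ [X, Y]) (by simp) (by simp) h p1 hrefl q1
      have c2 := same (s := t ++ [X, -Y]) (t := []) (u := u') (by simp [hneg]) rfl p2 h'
        q2 hp
      exact ((c1.trans r).trans c2).mono (by omega)
    have hu0 : u ≠ 0 := by rintro rfl; simp at hneg; exact huu hneg.symm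
    have hupos : 0 < |u| := abs_pos.2 hu0
    -- An occupied site here would give a removable content smaller than the only one.
    have hstate : ∀ j, 1 ≤ j → j ≤ |u| → g j = 0 := by
      intro j h1 h2
      rcases hshape j h1 with h3 | h3
      · exact h3
      obtain ⟨x, hx, hx'⟩ := exists_isRemovable_lt hshape h1 h3
      have := (honly x).1 hx'
      omega
    rcases Int.lt_or_le 1 |u| with hc | hc
    · have ha := hstate |u| (by omega) le_rfl
      have hb := hu.2.2
      obtain ⟨t, ht, htp⟩ := HopPath.exists_concat_three h hnn (x := |u| - 2) (y := |u| - 1)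
        (z := |u|) (hg ▸ hu)
        (by
          rw [← hg]
          refine ⟨fun h1 => ?_, by omega, ?_⟩
          · have := hstate (|u| - 1) h1 (by omega)
            simp only [unhop]; split_ifs <;> omega
          · rw [sub_add_cancel]
            simp only [unhop]; split_ifs <;> omega)
        (by
          rw [← hg]
          refine ⟨fun h1 => ?_, by omega, ?_⟩
          · have := hstate (|u| - 2) h1 (by omega)
            simp only [unhop]
            split_ifs <;> omega
          · have := hstate (|u| - 1) (by omega) (by omega)
            rw [show |u| - 2 + 1 = |u| - 1 by ring]
            simp only [unhop]
            split_ifs <;> omega)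
      rcases abs_cases u with ⟨e, _⟩ | ⟨e, _⟩
      · refine flip t (u - 2) (-(u - 1)) ?_ ?_ ?_
        · rw [abs_neg, abs_of_nonneg (a := u - 2) (by omega), abs_of_nonneg (a := u - 1) (by omega)]
          rwa [e] at ht ⊢
        · rw [abs_neg, abs_of_nonneg (a := u - 2) (by omega), abs_of_nonneg (a := u - 1) (by omega)]
          rwa [e] at htp ⊢
        · rw [signedTriple, if_neg (by omega), if_neg (by omega), if_pos (by omega), if_pos]
          rw [abs_neg, abs_of_nonneg (a := u - 1) (by omega), e]
          omega
      · refine flip t (u + 2) (-(u + 1)) ?_ ?_ ?_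
        · rw [abs_neg, abs_of_nonpos (a := u + 2) (by omega), abs_of_nonpos (a := u + 1) (by omega)]
          rw [e] at ht ⊢
          convert ht using 3 <;> ring_nf
        · rw [abs_neg, abs_of_nonpos (a := u + 2) (by omega), abs_of_nonpos (a := u + 1) (by omega)]
          rw [e] at htp ⊢
          convert htp using 3 <;> ring_nf
        · rw [signedTriple, if_neg (by omega), if_neg (by omega), if_pos (by omega), if_pos]
          rw [abs_neg, abs_of_nonpos (a := u + 1) (by omega), e]
          omega
    · have hu1 : |u| = 1 := by omega
      -- The smallest part is 2, and 3 is a part as well. Taking back the contents 1, 2, 0 in this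
      -- order shrinks 2 to 1, 3 to 2, and deletes the part 1, so the word may end in 0, 2, 1. With
      -- opposite signs on the last two, 0 is the median.
      have h3 := HopPath.apply_three h hnn (by simp at hl ⊢; omega) (by rw [← hg, ← hu1]; exact honly)
      have ha := hstate 1 le_rfl (by omega)
      have hb := hu.2.2
      rw [hu1] at hb
      norm_num at hb
      obtain ⟨t, ht, htp⟩ := HopPath.exists_concat_three h hnn (x := 0) (y := 2)
        (z := 1) (hg ▸ hu1 ▸ hu)
        (by
          rw [← hg] at h3 ⊢
          refine ⟨fun _ => ?_, by omega, ?_⟩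
          · simp [unhop, hb]
          · simp [unhop, h3])
        (by
          rw [← hg] at h3 ⊢
          refine ⟨fun h1 => by omega, le_rfl, ?_⟩
          simp [unhop, ha])
      refine flip t 0 (-2 * u) ?_ ?_ ?_
      · rw [abs_mul, hu1]; simpa using ht
      · rw [abs_mul, hu1]; simpa using htp
      · have : u = 1 ∨ u = -1 := by rcases abs_cases u with h | h <;> omega
        rcases this with rfl | rfl <;> decide

/-! ### Tableaux and their content words -/

/-- The word of the values of `f` at the letters `1, …, n`. -/
def letterList {n : ℕ} (f : Finset.Icc 1 n → ℤ) : List ℤ :=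
  List.ofFn fun j : Fin n => f ⟨j + 1, Finset.mem_Icc.2 (by omega)⟩

theorem letterList_length {n : ℕ} (f : Finset.Icc 1 n → ℤ) : (letterList f).length = n :=
  List.length_ofFn

theorem letterList_getElem {n : ℕ} (f : Finset.Icc 1 n → ℤ) {j : ℕ}
    (h : j < (letterList f).length) :
    (letterList f)[j] = f ⟨j + 1, Finset.mem_Icc.2 (by rw [letterList_length] at h; omega)⟩ := by
  simp [letterList]

theorem letterList_getElem_sub {n : ℕ} (f : Finset.Icc 1 n → ℤ) (p : Finset.Icc 1 n) :
    (letterList f)[(p : ℕ) - 1]'(by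
      have := Finset.mem_Icc.1 p.2
      rw [letterList_length]; omega) = f p := by
  rw [letterList_getElem]
  have := Finset.mem_Icc.1 p.2
  congr 1
  exact Subtype.ext (by simp only; omega)

theorem letterList_map {n : ℕ} (f : Finset.Icc 1 n → ℤ) (g : ℤ → ℤ) :
    (letterList f).map g = letterList fun p => g (f p) := by
  simp [letterList, List.map_ofFn, Function.comp_def]

theorem letterList_injective {n : ℕ} :
    Function.Injective (letterList : (Finset.Icc 1 n → ℤ) → List ℤ) := by
  intro f g h
  funext p
  rw [← letterList_getElem_sub f p, ← letterList_getElem_sub g p]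
  simp only [h]

theorem count_take_succ (w : List ℤ) {k : ℕ} (hk : k < w.length) (c : ℤ) :
    (w.take (k + 1)).count c = (w.take k).count c + if w[k] = c then 1 else 0 := by
  rw [List.take_succ_eq_append_getElem hk, List.count_append, List.count_singleton]
  simp

theorem count_take_mono (w : List ℤ) {k l : ℕ} (h : k ≤ l) (c : ℤ) :
    (w.take k).count c ≤ (w.take l).count c :=
  (List.take_sublist_take_left h).count_le c

theorem count_take_letterList {n : ℕ} (f : Finset.Icc 1 n → ℤ) (k : ℕ) (c : ℤ) :
    ((letterList f).take k).count c =
      (Finset.univ.filter fun p : Finset.Icc 1 n => (p : ℕ) ≤ k ∧ f p = c).card := by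
  induction k with
  | zero =>
    rw [eq_comm, List.take_zero, List.count_nil, Finset.card_eq_zero, Finset.filter_eq_empty_iff]
    rintro p - ⟨h, -⟩
    have := Finset.mem_Icc.1 p.2
    omega
  | succ k ih =>
    by_cases hk : k < n
    · rw [count_take_succ _ (by rwa [letterList_length]), ih, letterList_getElem]
      set q : Finset.Icc 1 n := ⟨k + 1, Finset.mem_Icc.2 (by omega)⟩ with hq
      have hle : ∀ p : Finset.Icc 1 n, (p : ℕ) ≤ k + 1 ↔ (p : ℕ) ≤ k ∨ p = q := by
        intro p
        rw [Subtype.ext_iff, hq]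
        simp only
        omega
      split_ifs with h
      · rw [← Finset.card_insert_of_notMem (a := q)]
        · congr 1
          ext p
          simp only [Finset.mem_insert, Finset.mem_filter, Finset.mem_univ, true_and, hle]
          constructor
          · rintro (rfl | ⟨h1, h2⟩)
            · exact ⟨Or.inr rfl, h⟩
            · exact ⟨Or.inl h1, h2⟩
          · rintro ⟨h1 | rfl, h2⟩
            · exact Or.inr ⟨h1, h2⟩
            · exact Or.inl rfl
        · simp [hq]
      · rw [add_zero]
        congr 1
        ext p
        simp only [Finset.mem_filter, Finset.mem_univ, true_and, hle]
        constructor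
        · rintro ⟨h1, h2⟩
          exact ⟨Or.inl h1, h2⟩
        · rintro ⟨h1 | rfl, h2⟩
          · exact ⟨h1, h2⟩
          · exact absurd h2 h
    · rw [List.take_of_length_le (by rw [letterList_length]; omega)]
      rw [List.take_of_length_le (by rw [letterList_length]; omega)] at ih
      rw [ih]
      congr 1
      ext p
      have := Finset.mem_Icc.1 p.2
      simp only [Finset.mem_filter, Finset.mem_univ, true_and]
      constructor <;> rintro ⟨h1, h2⟩ <;> exact ⟨by omega, h2⟩

theorem eq_range_card_of_lower {s : Finset ℕ} (h : ∀ x ∈ s, ∀ i < x, i ∈ s) :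
    s = Finset.range s.card := by
  symm
  apply Finset.eq_of_superset_of_card_ge
  · intro x hx
    have : Finset.range (x + 1) ⊆ s := fun i hi => by
      rcases Nat.lt_or_ge i x with h1 | h1
      · exact h x hx i h1
      · rw [Finset.mem_range] at hi
        rwa [show i = x by omega]
    have := Finset.card_le_card this
    rw [Finset.card_range] at this
    exact Finset.mem_range.2 this
  · simp

/-- In a filling that increases along diagonals, the number of occurrences of a diagonal in a prefix
of the content word tells which cells of that diagonal have been filled. -/
theorem lt_count_take_iff {X : Type*} {n : ℕ} (e : X ≃ Finset.Icc 1 n) {δ : X → ℤ}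
    {ι : X → ℕ} (hinj : ∀ x y, δ x = δ y → ι x = ι y → x = y)
    (hdown : ∀ x, ∀ i < ι x, ∃ y, δ y = δ x ∧ ι y = i ∧ e y < e x) (k : ℕ) (c : ℤ) (i : ℕ) :
    i < ((letterList fun p => δ (e.symm p)).take k).count c ↔
      ∃ x, δ x = c ∧ ι x = i ∧ (e x : ℕ) ≤ k := by
  set s := (Finset.univ.filter fun p : Finset.Icc 1 n => (p : ℕ) ≤ k ∧ δ (e.symm p) = c) with hs
  have hc : (s.image fun p => ι (e.symm p)).card = s.card := by
    refine Finset.card_image_of_injOn fun p hp q hq h => ?_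
    simp only [hs, Finset.coe_filter, Finset.mem_univ, true_and, Set.mem_ofPred_eq] at hp hq
    exact e.symm.injective (hinj _ _ (hp.2.trans hq.2.symm) h)
  -- Because entries increase along a diagonal, the indices of its cells filled so far form an
  -- initial segment.
  have hr := eq_range_card_of_lower (s := s.image fun p => ι (e.symm p)) (by
    intro a ha i hi
    obtain ⟨p, hp, rfl⟩ := Finset.mem_image.1 ha
    simp only [hs, Finset.mem_filter, Finset.mem_univ, true_and] at hp
    obtain ⟨y, h1, rfl, h2⟩ := hdown _ i hi
    refine Finset.mem_image.2 ⟨e y, ?_, by simp⟩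
    rw [Equiv.apply_symm_apply] at h2
    have h3 : (e y : ℕ) < p := h2
    simp only [hs, Finset.mem_filter, Finset.mem_univ, true_and, Equiv.symm_apply_apply]
    exact ⟨by omega, h1.trans hp.2⟩)
  rw [count_take_letterList, ← hs, ← hc, ← Finset.mem_range, ← hr, Finset.mem_image]
  constructor
  · rintro ⟨p, hp, rfl⟩
    simp only [hs, Finset.mem_filter, Finset.mem_univ, true_and] at hp
    exact ⟨e.symm p, hp.2, rfl, by simpa using hp.1⟩
  · rintro ⟨x, h1, rfl, h2⟩
    exact ⟨e x, by simp [hs, h1, h2], by simp⟩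

theorem exists_index_of_lt_count {c : ℤ} {w : List ℤ} {i : ℕ} (h : i < w.count c) :
    ∃ (j : ℕ) (hj : j < w.length), w[j] = c ∧ (w.take j).count c = i := by
  induction w generalizing i with
  | nil => simp at h
  | cons a w ih =>
    by_cases ha : a = c
    · subst ha
      rcases i with _ | i
      · exact ⟨0, by simp, rfl, rfl⟩
      · obtain ⟨j, hj, h1, h2⟩ := ih (i := i) (by simpa using h)
        exact ⟨j + 1, by simpa using hj, h1, by simp [h2]⟩
    · obtain ⟨j, hj, h1, h2⟩ := ih (i := i) (by simpa [List.count_cons, ha] using h)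
      exact ⟨j + 1, by simpa using hj, h1, by simp [ha, h2]⟩

/-- Cells indexed by the occurrences of the letters of a word are filled by this word. -/
theorem exists_filling {X : Type*} {w : List ℤ} {n : ℕ} (hn : w.length = n) {δ : X → ℤ}
    {ι : X → ℕ} (hinj : ∀ x y, δ x = δ y → ι x = ι y → x = y)
    (hX : ∀ c i, i < w.count c ↔ ∃ x, δ x = c ∧ ι x = i) :
    ∃ e : X ≃ Finset.Icc 1 n, (letterList fun p => δ (e.symm p)) = w ∧
      ∀ x k, (e x : ℕ) ≤ k ↔ ι x < (w.take k).count (δ x) := by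
  subst hn
  -- Each letter goes to the cell of its diagonal whose index is the number of earlier occurrences
  -- of that diagonal.
  have hex : ∀ p : Finset.Icc 1 w.length, ∃ x, ∃ h : (p : ℕ) - 1 < w.length,
      δ x = w[(p : ℕ) - 1] ∧ ι x = (w.take (p - 1)).count (δ x) := by
    intro p
    have hp := Finset.mem_Icc.1 p.2
    have hlt : (p : ℕ) - 1 < w.length := by omega
    obtain ⟨x, h1, h2⟩ := (hX w[(p : ℕ) - 1] ((w.take (p - 1)).count w[(p : ℕ) - 1])).1 (by
      have h1 := count_take_succ w hlt w[(p : ℕ) - 1]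
      have h2 := count_take_mono w (k := p - 1 + 1) (l := w.length) (by omega) w[(p : ℕ) - 1]
      rw [if_pos rfl] at h1
      rw [List.take_length] at h2
      omega)
    exact ⟨x, hlt, h1, by rw [h2, h1]⟩
  choose F hF1 hF2 hF3 using hex
  have key : ∀ (p : Finset.Icc 1 w.length) (k : ℕ), (p : ℕ) ≤ k ↔ ι (F p) < (w.take k).count (δ (F p)) := by
    intro p k
    have hp := Finset.mem_Icc.1 p.2
    have h1 := count_take_succ w (hF1 p) (δ (F p))
    rw [if_pos (hF2 p).symm, ← hF3 p] at h1
    constructor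
    · intro hk
      have := count_take_mono w (k := p - 1 + 1) (l := k) (by omega) (δ (F p))
      omega
    · intro hk
      by_contra hlt
      have := count_take_mono w (k := k) (l := p - 1) (by omega) (δ (F p))
      rw [← hF3 p] at this
      omega
  have hbij : Function.Bijective F := by
    constructor
    · intro p q h
      have h1 := fun k => (key p k).trans (h ▸ (key q k).symm)
      exact Subtype.ext (le_antisymm ((h1 q).2 le_rfl) ((h1 p).1 le_rfl))
    · intro x
      obtain ⟨j, hj, h1, h2⟩ := exists_index_of_lt_count ((hX (δ x) (ι x)).2 ⟨x, rfl, rfl⟩)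
      let p : Finset.Icc 1 w.length := ⟨j + 1, Finset.mem_Icc.2 (by omega)⟩
      have e1 : δ (F p) = δ x := (hF2 p).trans h1
      exact ⟨p, hinj _ _ e1 (by rw [hF3 p, e1]; exact h2)⟩
  refine ⟨(Equiv.ofBijective F hbij).symm, ?_, ?_⟩
  · refine List.ext_getElem (letterList_length _) fun j h1 h2 => ?_
    rw [letterList_getElem]
    exact hF2 _
  · intro x k
    obtain ⟨p, rfl⟩ := hbij.2 x
    rw [show F p = Equiv.ofBijective F hbij p from rfl, Equiv.symm_apply_apply]
    exact key p k

theorem hopPath_iff_take {R : Set ℤ} {g : ℤ → ℤ} {w : List ℤ} :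
    HopPath R g w ↔ ∀ k, HopShape R ((w.take k).foldl hop g) := by
  induction w generalizing g with
  | nil => simp [HopPath]
  | cons c w ih =>
    simp only [HopPath, ih]
    constructor
    · rintro ⟨h1, h2⟩ (_ | k)
      · exact h1
      · exact h2 k
    · exact fun h => ⟨h 0, fun k => h (k + 1)⟩

theorem ascAt_iff {j : ℕ} {w : List ℤ} : AscAt j w ↔ ∃ h : j + 1 < w.length, w[j] < w[j + 1] := by
  fun_induction AscAt j w with
  | case1 x y w => simp
  | case2 j x w ih => simp [ih]
  | case3 j w h1 h2 =>
    simp only [false_iff, not_exists]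
    intro h
    rcases w with _ | ⟨x, _ | ⟨y, w⟩⟩
    · simp at h
    · simp at h
    · rcases j with _ | j
      · exact (h1 x y w rfl rfl).elim
      · exact (h2 j x (y :: w) rfl rfl).elim

open Classical in
/-- The ascents, counted from `1`, of a word of diagonals. -/
noncomputable def ascents (n : ℕ) (w : List ℤ) : Finset ℕ :=
  (Finset.Ico 1 n).filter fun i => AscAt (i - 1) w

theorem ascAt_letterList {n : ℕ} (f : Finset.Icc 1 n → ℤ) {i : ℕ} (h : i ∈ Finset.Ico 1 n) :
    AscAt (i - 1) (letterList f) ↔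
      f ⟨i, Finset.mem_Icc.2 (by have := Finset.mem_Ico.1 h; omega)⟩ <
        f ⟨i + 1, Finset.mem_Icc.2 (by have := Finset.mem_Ico.1 h; omega)⟩ := by
  have := Finset.mem_Ico.1 h
  rw [ascAt_iff]
  simp only [letterList_length, letterList_getElem]
  have e : i - 1 + 1 = i := by omega
  simp only [e]
  exact ⟨fun h => h.2, fun h => ⟨by omega, h⟩⟩

theorem idxOf_lt_idxOf_iff {R : ℕ → ℕ → Prop} {l : List ℕ} (hl : l.Pairwise R)
    (hR : ∀ a b, R a b → ¬ R b a) {a b : ℕ} (ha : a ∈ l) (hb : b ∈ l) (hab : a ≠ b) :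
    l.idxOf a < l.idxOf b ↔ R a b := by
  have key : ∀ {a b}, a ∈ l → b ∈ l → l.idxOf a < l.idxOf b → R a b := by
    intro a b ha hb h
    have := List.pairwise_iff_getElem.1 hl _ _ (List.idxOf_lt_length_iff.2 ha)
      (List.idxOf_lt_length_iff.2 hb) h
    simpa using this
  refine ⟨key ha hb, fun h => ?_⟩
  rcases lt_trichotomy (l.idxOf a) (l.idxOf b) with h1 | h1 | h1
  · exact h1
  · exact absurd ((List.idxOf_inj ha).1 h1) hab
  · exact absurd (key hb ha h1) (hR _ _ h)

/-! ### Standard Young tableaux as hop paths from the vacuum. -/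

namespace StandardTableau

variable {μ : YoungDiagram} (T : StandardTableau μ)

theorem lt_of {x y : μ.cells} (hne : x ≠ y) (h1 : x.1.1 ≤ y.1.1) (h2 : x.1.2 ≤ y.1.2) :
    T.entry x < T.entry y := by
  have hz : (x.1.1, y.1.2) ∈ μ.cells := μ.up_left_mem h1 le_rfl y.2
  have a1 := T.row_le x ⟨_, hz⟩ rfl h2
  rcases Nat.lt_or_ge x.1.1 y.1.1 with h | h
  · exact lt_of_le_of_lt a1 (T.col_lt ⟨_, hz⟩ y rfl h)
  · have : (⟨_, hz⟩ : μ.cells) = y := Subtype.ext (Prod.ext (le_antisymm h1 h) rfl)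
    rw [this] at a1
    exact lt_of_le_of_ne a1 fun h => hne (T.entry.injective h)

/-- The word of the contents of the letters `1, 2, …` of a standard tableau. -/
def contentWord : List ℤ :=
  letterList fun p => ((T.entry.symm p).1.1 : ℤ) - (T.entry.symm p).1.2

theorem contentWord_length : T.contentWord.length = μ.card := letterList_length _

theorem lt_count_take {k : ℕ} {c : ℤ} {i : ℕ} :
    i < (T.contentWord.take k).count c ↔
      ∃ x : μ.cells, (x.1.1 : ℤ) - x.1.2 = c ∧ min x.1.1 x.1.2 = i ∧ (T.entry x : ℕ) ≤ k := by
  -- The smaller coordinate of a cell is its index along its diagonal.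
  refine lt_count_take_iff T.entry (δ := fun x => (x.1.1 : ℤ) - x.1.2)
    (ι := fun x => min x.1.1 x.1.2) ?_ ?_ k c i
  · intro x y h1 h2
    exact Subtype.ext (Prod.ext (by omega) (by omega))
  · intro x i hi
    have hm : (x.1.1 - (min x.1.1 x.1.2 - i), x.1.2 - (min x.1.1 x.1.2 - i)) ∈ μ.cells :=
      μ.up_left_mem (Nat.sub_le _ _) (Nat.sub_le _ _) x.2
    refine ⟨⟨_, hm⟩, by simp only; omega, by simp only; omega, T.lt_of ?_ ?_ ?_⟩
    · intro h
      have := congrArg (fun z : μ.cells => z.1.1) h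
      simp only at this
      omega
    · simp
    · simp

theorem lt_count {c : ℤ} {i : ℕ} :
    i < T.contentWord.count c ↔
      ∃ x : μ.cells, (x.1.1 : ℤ) - x.1.2 = c ∧ min x.1.1 x.1.2 = i := by
  have := T.lt_count_take (k := μ.card) (c := c) (i := i)
  rw [List.take_of_length_le (by rw [contentWord_length])] at this
  rw [this]
  exact ⟨fun ⟨x, h1, h2, _⟩ => ⟨x, h1, h2⟩,
    fun ⟨x, h1, h2⟩ => ⟨x, h1, h2, (Finset.mem_Icc.1 (T.entry x).2).2⟩⟩

/-- The shape is thus determined by the multiset of contents. -/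
theorem mem_iff {r c : ℕ} :
    (r, c) ∈ μ.cells ↔ min r c < T.contentWord.count ((r : ℤ) - c) := by
  rw [lt_count]
  constructor
  · exact fun h => ⟨⟨_, h⟩, rfl, rfl⟩
  · rintro ⟨x, h1, h2⟩
    have : x.1 = (r, c) := Prod.ext (by simp only; omega) (by simp only; omega)
    exact this ▸ x.2

theorem contentWord_injective :
    Function.Injective (contentWord : StandardTableau μ → List ℤ) := by
  intro T T' h
  apply entry_injective
  apply Equiv.ext
  intro x
  have key : ∀ (U : StandardTableau μ) (k : ℕ), (U.entry x : ℕ) ≤ k ↔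
      min x.1.1 x.1.2 < (U.contentWord.take k).count ((x.1.1 : ℤ) - x.1.2) := by
    intro U k
    rw [lt_count_take]
    constructor
    · exact fun h => ⟨x, rfl, rfl, h⟩
    · rintro ⟨y, h1, h2, h3⟩
      rwa [show x = y from Subtype.ext (Prod.ext (by omega) (by omega))]
  have h1 := fun k => (key T k).trans ((h ▸ key T' k).symm)
  exact Subtype.ext (le_antisymm ((h1 _).2 le_rfl) ((h1 _).1 le_rfl))

/-- The numbers of cells on the diagonals `x - 1` and `x` of a Young diagram are equal or differ by
one, in a direction given by the sign of `x`. This is exclusion at site `x`. -/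
theorem hopPath_contentWord : HopPath Set.univ vacuum T.contentWord := by
  rw [hopPath_iff_take]
  intro k x _
  rw [hop_foldl_apply]
  -- The cell of index i on diagonal c is (i + max c 0, i + max (-c) 0); the two inequalities say
  -- that the second cell lies weakly below and to the left of the first.
  have down : ∀ (c c' : ℤ) (i i' : ℕ), (i' : ℤ) + max c' 0 ≤ i + max c 0 →
      (i' : ℤ) + max (-c') 0 ≤ i + max (-c) 0 →
      i < (T.contentWord.take k).count c → i' < (T.contentWord.take k).count c' := by
    intro c c' i i' h1 h2 h
    obtain ⟨x, hx1, hx2, hx3⟩ := T.lt_count_take.1 h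
    have a1 : (i' + max c' 0).toNat ≤ x.1.1 := by omega
    have a2 : (i' + max (-c') 0).toNat ≤ x.1.2 := by omega
    have hm : ((i' + max c' 0).toNat, (i' + max (-c') 0).toNat) ∈ μ.cells :=
      μ.up_left_mem a1 a2 x.2
    refine T.lt_count_take.2 ⟨⟨_, hm⟩, by simp only; omega, by simp only; omega, ?_⟩
    by_cases he : (⟨_, hm⟩ : μ.cells) = x
    · rwa [he]
    · have : T.entry ⟨_, hm⟩ < T.entry x := T.lt_of he a1 a2
      rw [← Subtype.coe_lt_coe] at this
      omega
  have d1 := down x (x - 1)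
  have d2 := down (x - 1) x
  generalize (T.contentWord.take k).count x = a at *
  generalize (T.contentWord.take k).count (x - 1) = b at *
  simp only [vacuum]
  split_ifs with hx
  · have e1 := d1 (a - 1) (a - 2)
    have e2 := d2 (b - 1) (b - 1)
    by_contra hne
    rcases Nat.lt_or_ge a 2 with h | h
    · have := e2 (by omega) (by omega)
      omega
    · have := e1 (by omega) (by omega)
      by_cases hb : b = 0
      · omega
      have := e2 (by omega) (by omega)
      omega
  · have e1 := d1 (a - 1) (a - 1)
    have e2 := d2 (b - 1) (b - 2)
    by_contra hne
    rcases Nat.lt_or_ge b 2 with h | h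
    · have := e1 (by omega) (by omega)
      omega
    · have := e2 (by omega) (by omega)
      by_cases ha : a = 0
      · omega
      have := e1 (by omega) (by omega)
      omega

/-- Exclusion says that neighbouring diagonals interlace, which makes the cells filled at each stage
a lower set. -/
theorem exists_of_hopPath {v : List ℤ} (hv : HopPath Set.univ vacuum v) :
    ∃ (μ : YoungDiagram) (T : StandardTableau μ), T.contentWord = v := by
  rw [hopPath_iff_take] at hv
  have hstep : ∀ k x, (vacuum x - (v.take k).count x + (v.take k).count (x - 1) = 0 ∨
      vacuum x - (v.take k).count x + (v.take k).count (x - 1) = 1) := by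
    intro k x
    have := hv k x trivial
    rwa [hop_foldl_apply] at this
  have up : ∀ k r s : ℕ, min (r + 1) s < (v.take k).count (((r + 1 : ℕ) : ℤ) - s) →
      min r s < (v.take k).count ((r : ℤ) - s) := by
    intro k r s h
    have := hstep k (((r + 1 : ℕ) : ℤ) - s)
    rw [show (((r + 1 : ℕ) : ℤ) - s) - 1 = (r : ℤ) - s by push_cast; ring] at this
    simp only [vacuum] at this
    split_ifs at this <;> omega
  have left : ∀ k r s : ℕ, min r (s + 1) < (v.take k).count ((r : ℤ) - ((s + 1 : ℕ) : ℤ)) →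
      min r s < (v.take k).count ((r : ℤ) - s) := by
    intro k r s h
    have := hstep k ((r : ℤ) - s)
    rw [show ((r : ℤ) - s) - 1 = (r : ℤ) - ((s + 1 : ℕ) : ℤ) by push_cast; ring] at this
    simp only [vacuum] at this
    split_ifs at this <;> omega
  have lower : ∀ k {r r' s s' : ℕ}, r' ≤ r → s' ≤ s →
      min r s < (v.take k).count ((r : ℤ) - s) → min r' s' < (v.take k).count ((r' : ℤ) - s') := by
    intro k r r' s s' hr hs h
    have h1 : min r' s < (v.take k).count ((r' : ℤ) - s) := by
      induction r, hr using Nat.le_induction with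
      | base => exact h
      | succ r _ ih => exact ih (up k r s h)
    clear h
    induction s, hs using Nat.le_induction with
    | base => exact h1
    | succ s _ ih => exact ih (left k r' s h1)
  have hall : v.take v.length = v := List.take_length
  let cell : ℕ → ℕ × ℕ := fun j =>
    ((v.take j).count (v.getD j 0) + (v.getD j 0).toNat,
      (v.take j).count (v.getD j 0) + (-v.getD j 0).toNat)
  have hmem : ∀ r s : ℕ, (r, s) ∈ (Finset.range v.length).image cell ↔
      min r s < v.count ((r : ℤ) - s) := by
    intro r s
    simp only [Finset.mem_image, Finset.mem_range, cell, Prod.mk.injEq]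
    constructor
    · rintro ⟨j, hj, h1, h2⟩
      have e := count_take_succ v hj v[j]
      have e' := count_take_mono v (k := j + 1) (l := v.length) (by omega) v[j]
      rw [if_pos rfl] at e
      rw [hall] at e'
      rw [List.getD_eq_getElem _ _ hj] at h1 h2
      rw [show (r : ℤ) - s = v[j] by omega]
      omega
    · intro h
      obtain ⟨j, hj, h1, h2⟩ := exists_index_of_lt_count h
      refine ⟨j, hj, ?_⟩
      rw [List.getD_eq_getElem _ _ hj, h1]
      omega
  let μ : YoungDiagram := ⟨(Finset.range v.length).image cell, by
    rintro ⟨r, s⟩ ⟨r', s'⟩ hle h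
    rw [Finset.mem_coe, hmem] at h ⊢
    rw [← hall] at h ⊢
    exact lower _ hle.1 hle.2 h⟩
  have hinj : ∀ x y : μ.cells, (x.1.1 : ℤ) - x.1.2 = (y.1.1 : ℤ) - y.1.2 →
      min x.1.1 x.1.2 = min y.1.1 y.1.2 → x = y :=
    fun x y h1 h2 => Subtype.ext (Prod.ext (by omega) (by omega))
  have hX : ∀ c i, i < v.count c ↔
      ∃ x : μ.cells, (x.1.1 : ℤ) - x.1.2 = c ∧ min x.1.1 x.1.2 = i := by
    intro c i
    constructor
    · intro h
      have hm : (i + c.toNat, i + (-c).toNat) ∈ μ.cells := by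
        refine (hmem _ _).2 ?_
        rw [show ((i + c.toNat : ℕ) : ℤ) - ((i + (-c).toNat : ℕ) : ℤ) = c by omega]
        omega
      exact ⟨⟨_, hm⟩, by simp only; omega, by simp only; omega⟩
    · rintro ⟨⟨⟨r, s⟩, hx⟩, rfl, rfl⟩
      exact (hmem _ _).1 hx
  have hcard : v.length = μ.card := by
    obtain ⟨e, -⟩ := exists_filling rfl hinj hX
    have := Fintype.card_congr e
    simpa using this.symm
  obtain ⟨e, he, hk⟩ := exists_filling hcard hinj hX
  have hmono : ∀ x y : μ.cells, x.1.1 ≤ y.1.1 → x.1.2 ≤ y.1.2 → e x ≤ e y :=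
    fun x y h1 h2 => (hk x (e y)).2 (lower _ h1 h2 ((hk y (e y)).1 le_rfl))
  refine ⟨μ, ⟨e, fun x y h1 h2 => hmono x y h1.le h2, fun x y h1 h2 => ?_⟩, he⟩
  refine lt_of_le_of_ne (hmono x y h2.le h1.le) fun h => ?_
  rw [e.injective h] at h2
  exact lt_irrefl _ h2

theorem perm_contentWord (T T' : StandardTableau μ) : T.contentWord.Perm T'.contentWord := by
  rw [List.perm_iff_count]
  intro c
  have key := fun i => (T.lt_count (c := c) (i := i)).trans T'.lt_count.symm
  have h1 := key (T.contentWord.count c)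
  have h2 := key (T'.contentWord.count c)
  omega

theorem exists_contentWord_eq {v : List ℤ} (hv : HopPath Set.univ vacuum v)
    (hp : v.Perm T.contentWord) : ∃ T' : StandardTableau μ, T'.contentWord = v := by
  obtain ⟨μ', T', rfl⟩ := exists_of_hopPath hv
  have : μ = μ' := by
    refine YoungDiagram.ext ?_
    ext ⟨r, c⟩
    rw [T.mem_iff, T'.mem_iff, hp.count_eq]
  subst this
  exact ⟨T', rfl⟩

/-- The next letter is neither weakly below and left nor strictly above and right of the current
one; so it is read earlier exactly if it moves up and weakly left, which raises the content. -/
theorem lt_iff_of_succ {x y : μ.cells} (h : (T.entry y : ℕ) = T.entry x + 1) :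
    (x.1.1 < y.1.1 ∨ x.1.1 = y.1.1 ∧ y.1.2 < x.1.2) ↔
      (x.1.1 : ℤ) - x.1.2 < (y.1.1 : ℤ) - y.1.2 := by
  have hxy : x ≠ y := by rintro rfl; omega
  have hnot : ¬ (y.1.1 ≤ x.1.1 ∧ y.1.2 ≤ x.1.2) := by
    rintro ⟨h1, h2⟩
    have := T.lt_of hxy.symm h1 h2
    rw [← Subtype.coe_lt_coe] at this
    omega
  have hnot' : ¬ (x.1.1 < y.1.1 ∧ x.1.2 < y.1.2) := by
    rintro ⟨h1, h2⟩
    have hz : (x.1.1, y.1.2) ∈ μ.cells := μ.up_left_mem h1.le le_rfl y.2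
    have a1 := T.lt_of (x := x) (y := ⟨_, hz⟩) (fun h => by rw [h] at h2; simp at h2) le_rfl h2.le
    have a2 := T.lt_of (x := ⟨_, hz⟩) (y := y) (fun h => by rw [← h] at h1; simp at h1) h1.le le_rfl
    rw [← Subtype.coe_lt_coe] at a1 a2
    omega
  have hrow : ¬ (x.1.1 = y.1.1 ∧ x.1.2 + 1 < y.1.2) := by
    rintro ⟨h1, h2⟩
    have hz : (x.1.1, x.1.2 + 1) ∈ μ.cells := μ.up_left_mem h1.le h2.le y.2
    have a1 := T.lt_of (x := x) (y := ⟨_, hz⟩)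
      (fun h => by have := congrArg (fun z : μ.cells => z.1.2) h; simp at this) le_rfl (by simp)
    have a2 := T.lt_of (x := ⟨_, hz⟩) (y := y) (fun h => by rw [← h] at h2; simp at h2) h1.le h2.le
    rw [← Subtype.coe_lt_coe] at a1 a2
    omega
  constructor
  · rintro h
    omega
  · intro h
    omega

/-- The cell `x` is read before `y` in the row reading word. -/
def ReadBefore (x y : μ.cells) : Prop := y.1.1 < x.1.1 ∨ y.1.1 = x.1.1 ∧ x.1.2 < y.1.2

theorem mem_rowWord (x : μ.cells) : (T.entry x : ℕ) ∈ T.rowWord := by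
  obtain ⟨⟨r, c⟩, hx⟩ := x
  have h1 : (μ.col c).card ≤ μ.card := Finset.card_le_card (Finset.filter_subset _ _)
  have h2 : (μ.row r).card ≤ μ.card := Finset.card_le_card (Finset.filter_subset _ _)
  rw [← YoungDiagram.colLen_eq_card] at h1
  rw [← YoungDiagram.rowLen_eq_card] at h2
  have h3 := YoungDiagram.mem_iff_lt_colLen.1 (show (r, c) ∈ μ from hx)
  have h4 := YoungDiagram.mem_iff_lt_rowLen.1 (show (r, c) ∈ μ from hx)
  simp only [rowWord, List.mem_flatMap, List.mem_reverse, List.mem_range, List.mem_filterMap]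
  refine ⟨r, by omega, c, by omega, ?_⟩
  rw [dif_pos hx]

theorem pairwise_rowWord : T.rowWord.Pairwise fun a b =>
    ∃ x y : μ.cells, (T.entry x : ℕ) = a ∧ (T.entry y : ℕ) = b ∧ ReadBefore x y := by
  rw [rowWord, List.pairwise_flatMap]
  constructor
  · intro r _
    rw [List.pairwise_filterMap]
    refine List.pairwise_lt_range.imp fun {c c'} hc a ha b hb => ?_
    split_ifs at ha hb with h1 h2
    cases ha
    cases hb
    exact ⟨_, _, rfl, rfl, Or.inr ⟨rfl, hc⟩⟩
  · rw [List.pairwise_reverse]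
    refine List.pairwise_lt_range.imp fun {r r'} hr a ha b hb => ?_
    simp only [List.mem_filterMap] at ha hb
    obtain ⟨c, -, hc⟩ := ha
    obtain ⟨c', -, hc'⟩ := hb
    split_ifs at hc hc'
    cases hc
    cases hc'
    exact ⟨_, _, rfl, rfl, Or.inl hr⟩

theorem wordDescents_rowWord :
    wordDescents μ.card T.rowWord = ascents μ.card T.contentWord := by
  classical
  unfold wordDescents ascents
  refine Finset.filter_congr fun i hi => ?_
  rw [contentWord, ascAt_letterList _ hi]
  have hi' := Finset.mem_Ico.1 hi
  obtain ⟨x, hx⟩ := T.entry.surjective ⟨i, Finset.mem_Icc.2 (by omega)⟩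
  obtain ⟨y, hy⟩ := T.entry.surjective ⟨i + 1, Finset.mem_Icc.2 (by omega)⟩
  have ex : (T.entry x : ℕ) = i := by rw [hx]
  have ey : (T.entry y : ℕ) = i + 1 := by rw [hy]
  have hinj : ∀ {x y : μ.cells}, (T.entry x : ℕ) = T.entry y → x = y :=
    fun h => T.entry.injective (Subtype.ext h)
  rw [← hx, ← hy]
  simp only [Equiv.symm_apply_apply]
  have hR : ∀ a b, (∃ x y : μ.cells, (T.entry x : ℕ) = a ∧ (T.entry y : ℕ) = b ∧
      ReadBefore x y) → ¬ ∃ x y : μ.cells, (T.entry x : ℕ) = b ∧ (T.entry y : ℕ) = a ∧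
      ReadBefore x y := by
    rintro a b ⟨x, y, h1, h2, h3⟩ ⟨y', x', h1', h2', h3'⟩
    rw [hinj (h1'.trans h2.symm), hinj (h2'.trans h1.symm)] at h3'
    unfold ReadBefore at h3 h3'
    omega
  have key := idxOf_lt_idxOf_iff T.pairwise_rowWord hR (T.mem_rowWord y) (T.mem_rowWord x)
    (by omega)
  rw [← T.lt_iff_of_succ (by rw [ex, ey])]
  simp only [ex, ey] at key
  rw [key]
  constructor
  · rintro ⟨x', y', h1, h2, h3⟩
    rw [hinj (h1.trans ey.symm), hinj (h2.trans ex.symm)] at h3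
    unfold ReadBefore at h3
    omega
  · intro h
    refine ⟨y, x, ey, ex, ?_⟩
    unfold ReadBefore
    omega

end StandardTableau

/-- The Schur function of the words with given contents. -/
theorem exists_schurFunction_eq {v : List ℤ} (hv : HopPath Set.univ vacuum v) :
    ∃ μ : YoungDiagram, μ.card = v.length ∧ ∀ {A : Type*} (s : Finset A) (f : A → List ℤ),
      Set.InjOn f s → (∀ u, (∃ a ∈ s, f a = u) ↔ HopPath Set.univ vacuum u ∧ u.Perm v) →
      ∑ a ∈ s, fundamentalQSym v.length (ascents v.length (f a)) = schurFunction μ := by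
  classical
  obtain ⟨μ, T, rfl⟩ := StandardTableau.exists_of_hopPath hv
  refine ⟨μ, T.contentWord_length.symm, fun {A} s f hf h => ?_⟩
  rw [T.contentWord_length, schurFunction, ← Finset.sum_image (f := fun u =>
    fundamentalQSym μ.card (ascents μ.card u)) hf]
  simp only [StandardTableau.wordDescents_rowWord]
  rw [← Finset.sum_image (f := fun u => fundamentalQSym μ.card (ascents μ.card u))
    (StandardTableau.contentWord_injective.injOn (s := _))]
  refine Finset.sum_congr ?_ fun _ _ => rfl
  ext u
  rw [Finset.mem_image, h]
  simp only [Finset.mem_image, Finset.mem_univ, true_and]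
  constructor
  · rintro ⟨h1, h2⟩
    exact T.exists_contentWord_eq h1 h2
  · rintro ⟨T', rfl⟩
    exact ⟨T'.hopPath_contentWord, T'.perm_contentWord T⟩

/-! ### Signed standard tableaux as signed words. -/

theorem StrictPartition.diagram_injective {n : ℕ} :
    Function.Injective (diagram : StrictPartition n → YoungDiagram) := by
  rintro ⟨d, _, _⟩ ⟨d', _, _⟩ h
  cases h
  rfl

theorem StrictPartition.lt_of_mem_shiftedCells {n : ℕ} {γ : StrictPartition n} {r c : ℕ}
    (h : (r, c) ∈ γ.shiftedCells) : c < n := by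
  have h1 := mem_shiftedCells.1 h
  have h2 := γ.add_rowLen_le (Nat.zero_le r) (by omega)
  have h3 : (γ.diagram.row 0).card ≤ γ.diagram.card :=
    Finset.card_le_card (Finset.filter_subset _ _)
  rw [← YoungDiagram.rowLen_eq_card, γ.card_eq] at h3
  omega

namespace SignedStandardTableau

variable {n : ℕ} {γ : StrictPartition n} (S : SignedStandardTableau γ)

/-- The word of the diagonals of the letters `1, 2, …` of a signed standard tableau. -/
def diagWord : List ℤ := letterList S.1.diag

theorem diagWord_length : S.diagWord.length = n := letterList_length _

theorem map_abs_diagWord :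
    S.diagWord.map abs =
      letterList fun p => ((S.1.entry.symm p).1.2 : ℤ) - (S.1.entry.symm p).1.1 := by
  rw [diagWord, letterList_map]
  congr 1
  funext p
  have := S.1.abs_diag (S.1.entry.symm p)
  rwa [Equiv.apply_symm_apply] at this

theorem lt_count_take {k : ℕ} {c : ℤ} {i : ℕ} :
    i < ((S.diagWord.map abs).take k).count c ↔
      ∃ x : γ.shiftedCells, (x.1.2 : ℤ) - x.1.1 = c ∧ x.1.1 = i ∧ (S.1.entry x : ℕ) ≤ k := by
  rw [map_abs_diagWord]
  refine lt_count_take_iff S.1.entry (δ := fun x => (x.1.2 : ℤ) - x.1.1)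
    (ι := fun x => x.1.1) ?_ ?_ k c i
  · intro x y h1 h2
    exact Subtype.ext (Prod.ext (by omega) (by omega))
  · rintro ⟨⟨r, c⟩, hx⟩ i hi
    have hx' := StrictPartition.mem_shiftedCells.1 hx
    simp only at hi
    have hl := γ.add_rowLen_le (r := i) (s := r) (by omega) (by omega)
    have hm : (i, i + c - r) ∈ γ.shiftedCells :=
      StrictPartition.mem_shiftedCells.2 ⟨by omega, by omega⟩
    refine ⟨⟨_, hm⟩, by simp only; omega, rfl, S.2.lt_of ?_ ?_ ?_⟩
    · intro h
      have := congrArg (fun z : γ.shiftedCells => z.1.1) h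
      simp only at this
      omega
    · simp only; omega
    · simp only; omega

theorem lt_count {c : ℤ} {i : ℕ} :
    i < (S.diagWord.map abs).count c ↔
      ∃ x : γ.shiftedCells, (x.1.2 : ℤ) - x.1.1 = c ∧ x.1.1 = i := by
  have := S.lt_count_take (k := n) (c := c) (i := i)
  rw [List.take_of_length_le (by rw [List.length_map, diagWord_length])] at this
  rw [this]
  exact ⟨fun ⟨x, h1, h2, _⟩ => ⟨x, h1, h2⟩,
    fun ⟨x, h1, h2⟩ => ⟨x, h1, h2, (Finset.mem_Icc.1 (S.1.entry x).2).2⟩⟩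

/-- The diagonals of the shifted diagram are the columns of the unshifted one. -/
theorem mem_iff {r c : ℕ} :
    (r, c) ∈ γ.diagram.cells ↔ r < (S.diagWord.map abs).count (c : ℤ) := by
  rw [lt_count]
  have hiff : (r, c) ∈ γ.diagram.cells ↔ (r, r + c) ∈ γ.shiftedCells := by
    rw [StrictPartition.mem_shiftedCells, YoungDiagram.mem_cells, YoungDiagram.mem_iff_lt_rowLen]
    omega
  rw [hiff]
  constructor
  · exact fun h => ⟨⟨_, h⟩, by simp, rfl⟩
  · rintro ⟨x, h1, h2⟩
    have : x.1 = (r, r + c) := Prod.ext (by simp only; omega) (by simp only; omega)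
    exact this ▸ x.2

theorem shape_eq_of_perm {γ' : StrictPartition n} (S' : SignedStandardTableau γ')
    (h : (S.diagWord.map abs).Perm (S'.diagWord.map abs)) : γ = γ' := by
  refine StrictPartition.diagram_injective (YoungDiagram.ext ?_)
  ext ⟨r, c⟩
  rw [S.mem_iff, S'.mem_iff, h.count_eq]

theorem perm_map_abs_diagWord (S' : SignedStandardTableau γ) :
    (S.diagWord.map abs).Perm (S'.diagWord.map abs) := by
  rw [List.perm_iff_count]
  intro c
  have key := fun i => (S.lt_count (c := c) (i := i)).trans S'.lt_count.symm
  have h1 := key ((S.diagWord.map abs).count c)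
  have h2 := key ((S'.diagWord.map abs).count c)
  omega

theorem diagWord_injective :
    Function.Injective (diagWord : SignedStandardTableau γ → List ℤ) := by
  intro S S' h
  have he : S.1.entry = S'.1.entry := by
    apply Equiv.ext
    intro x
    have key : ∀ (U : SignedStandardTableau γ) (k : ℕ), (U.1.entry x : ℕ) ≤ k ↔
        x.1.1 < ((U.diagWord.map abs).take k).count ((x.1.2 : ℤ) - x.1.1) := by
      intro U k
      rw [lt_count_take]
      constructor
      · exact fun h => ⟨x, rfl, rfl, h⟩
      · rintro ⟨y, h1, h2, h3⟩
        rwa [show x = y from Subtype.ext (Prod.ext (by omega) (by omega))]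
    have h1 := fun k => (key S k).trans ((h ▸ key S' k).symm)
    exact Subtype.ext (le_antisymm ((h1 _).2 le_rfl) ((h1 _).1 le_rfl))
  have hd : S.1.diag = S'.1.diag := letterList_injective h
  refine Subtype.ext (SignedFilling.pair_injective (Prod.ext he (funext fun x => ?_)))
  have hx := (StrictPartition.mem_shiftedCells.1 x.2).1
  by_cases hxd : x.1.1 = x.1.2
  · exact (S.2.diag_unmarked x hxd).trans (S'.2.diag_unmarked x hxd).symm
  have h1 := S.1.diag_cases (S.1.entry x)
  have h2 := S'.1.diag_cases (S'.1.entry x)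
  rw [Equiv.symm_apply_apply] at h1 h2
  rw [hd, he] at h1
  rcases h1 with ⟨h1, h1'⟩ | ⟨h1, h1'⟩ <;> rcases h2 with ⟨h2, h2'⟩ | ⟨h2, h2'⟩
  · exact h1.trans h2.symm
  · omega
  · omega
  · exact h1.trans h2.symm

/-- For `x ≥ 1`, diagonal `x - 1` of a shifted shape has as many cells as diagonal `x`, or one more.
Diagonal 0 has no predecessor, so site 0 is left unconstrained. -/
theorem signedPath_diagWord : SignedPath S.diagWord := by
  rw [SignedPath, hopPath_iff_take]
  intro k x hx
  simp only [Set.mem_Ici] at hx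
  rw [hop_foldl_apply]
  have down : ∀ (c c' : ℤ) (i i' : ℕ), 0 ≤ c' → i' ≤ i → i' + c' ≤ i + c →
      i < ((S.diagWord.map abs).take k).count c → i' < ((S.diagWord.map abs).take k).count c' := by
    intro c c' i i' hc h1 h2 h
    obtain ⟨⟨⟨r, s⟩, hx⟩, hx1, hx2, hx3⟩ := S.lt_count_take.1 h
    simp only at hx1 hx2
    have hx' := StrictPartition.mem_shiftedCells.1 hx
    have hl := γ.add_rowLen_le (r := i') (s := r) (by omega) (by omega)
    have hm : (i', (i' + c').toNat) ∈ γ.shiftedCells :=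
      StrictPartition.mem_shiftedCells.2 ⟨by omega, by omega⟩
    refine S.lt_count_take.2 ⟨⟨_, hm⟩, by simp only; omega, rfl, ?_⟩
    by_cases he : (⟨_, hm⟩ : γ.shiftedCells) = ⟨(r, s), hx⟩
    · rwa [he]
    · have := S.2.lt_of he (by simp only; omega) (by simp only; omega)
      rw [← Subtype.coe_lt_coe] at this
      omega
  have d1 := down x (x - 1)
  have d2 := down (x - 1) x
  generalize ((S.diagWord.map abs).take k).count x = a at *
  generalize ((S.diagWord.map abs).take k).count (x - 1) = b at *
  have e1 := d1 (a - 1) (a - 1)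
  have e2 := d2 (b - 1) (b - 2)
  simp only [Pi.zero_apply]
  by_contra hne
  rcases Nat.lt_or_ge b 2 with h | h
  · have := e1 (by omega) (by omega) (by omega)
    omega
  · have := e2 (by omega) (by omega) (by omega)
    by_cases ha : a = 0
    · omega
    have := e1 (by omega) (by omega) (by omega)
    omega

theorem exists_of_signedPath {v : List ℤ} {m : ℕ} (hm : v.length = m) (hv : SignedPath v) :
    ∃ (γ : StrictPartition m) (S : SignedStandardTableau γ), S.diagWord = v := by
  rw [SignedPath, hopPath_iff_take] at hv
  obtain ⟨a, ha⟩ : ∃ a, a = v.map abs := ⟨_, rfl⟩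
  rw [← ha] at hv
  have hal : a.length = m := by rw [ha, List.length_map, hm]
  have hnn : ∀ {j : ℕ} (h : j < a.length), 0 ≤ a[j] := by
    intro j h
    subst ha
    simp
  have hstep : ∀ k x : ℕ, (a.take k).count ((x + 1 : ℕ) : ℤ) ≤ (a.take k).count (x : ℤ) ∧
      (a.take k).count (x : ℤ) ≤ (a.take k).count ((x + 1 : ℕ) : ℤ) + 1 := by
    intro k x
    have := hv k ((x + 1 : ℕ) : ℤ) (by simp only [Set.mem_Ici]; omega)
    rw [hop_foldl_apply, show ((x + 1 : ℕ) : ℤ) - 1 = x by push_cast; ring] at this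
    simp only [Pi.zero_apply] at this
    omega
  have left : ∀ (k : ℕ) {c c' : ℕ}, c' ≤ c → (a.take k).count (c : ℤ) ≤ (a.take k).count (c' : ℤ) := by
    intro k c c' h
    induction c, h using Nat.le_induction with
    | base => exact le_rfl
    | succ c _ ih => exact (hstep k c).1.trans ih
  have up : ∀ (k d : ℕ) {r r' : ℕ}, r' ≤ r →
      r < (a.take k).count (d : ℤ) → r' < (a.take k).count ((d + (r - r') : ℕ) : ℤ) := by
    intro k d r r' h hr
    obtain ⟨t, rfl⟩ := Nat.exists_eq_add_of_le h
    rw [Nat.add_sub_cancel_left]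
    clear h
    induction t generalizing d with
    | zero => exact hr
    | succ t ih =>
      have := ih (d + 1) (by have := (hstep k d).2; omega)
      rwa [show d + (t + 1) = d + 1 + t by ring]
  have hall : a.take a.length = a := List.take_length
  let cell : ℕ → ℕ × ℕ := fun j => ((a.take j).count (a.getD j 0), (a.getD j 0).toNat)
  have hmem : ∀ r s : ℕ, (r, s) ∈ (Finset.range a.length).image cell ↔
      r < a.count (s : ℤ) := by
    intro r s
    simp only [Finset.mem_image, Finset.mem_range, cell, Prod.mk.injEq]
    constructor
    · rintro ⟨j, hj, h1, h2⟩
      have e := count_take_succ a hj a[j]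
      have e' := count_take_mono a (k := j + 1) (l := a.length) (by omega) a[j]
      have := hnn hj
      rw [if_pos rfl] at e
      rw [hall] at e'
      rw [List.getD_eq_getElem _ _ hj] at h1 h2
      rw [show (s : ℤ) = a[j] by omega]
      omega
    · intro h
      obtain ⟨j, hj, h1, h2⟩ := exists_index_of_lt_count h
      refine ⟨j, hj, ?_⟩
      rw [List.getD_eq_getElem _ _ hj, h1]
      omega
  let μ : YoungDiagram := ⟨(Finset.range a.length).image cell, by
    rintro ⟨r, s⟩ ⟨r', s'⟩ hle h
    rw [Finset.mem_coe, hmem] at h ⊢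
    rw [← hall] at h ⊢
    exact lt_of_le_of_lt hle.1 (lt_of_lt_of_le h (left _ hle.2))⟩
  have hμ : ∀ r s : ℕ, s < μ.rowLen r ↔ r < a.count (s : ℤ) := fun r s => by
    rw [← YoungDiagram.mem_iff_lt_rowLen]
    exact hmem r s
  have hcard : μ.card = m := by
    obtain ⟨e, -⟩ := exists_filling (X := μ.cells) hal (δ := fun x => (x.1.2 : ℤ))
      (ι := fun x => x.1.1) (fun x y h1 h2 => Subtype.ext (Prod.ext h2 (by omega))) (by
        intro c i
        constructor
        · intro h
          obtain ⟨j, hj, rfl, -⟩ := exists_index_of_lt_count h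
          have := hnn hj
          have hm : (i, a[j].toNat) ∈ μ.cells :=
            (hmem _ _).2 (by rwa [show ((a[j].toNat : ℕ) : ℤ) = a[j] by omega])
          exact ⟨⟨_, hm⟩, by simp only; omega, rfl⟩
        · rintro ⟨⟨⟨r, s⟩, hx⟩, rfl, rfl⟩
          exact (hmem _ _).1 hx)
    have := Fintype.card_congr e
    simpa using this
  let γ : StrictPartition m := ⟨μ, hcard, fun r s hrs hs => by
    have h1 := (hμ s (μ.rowLen s - 1)).1 (by omega)
    have h2 := (hstep a.length (μ.rowLen s - 1)).2
    rw [hall, show μ.rowLen s - 1 + 1 = μ.rowLen s by omega] at h2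
    exact (hμ r (μ.rowLen s)).2 (by omega)⟩
  have hγ : ∀ r c : ℕ, (r, c) ∈ γ.shiftedCells ↔ r ≤ c ∧ r < a.count ((c : ℤ) - r) := by
    intro r c
    rw [StrictPartition.mem_shiftedCells]
    by_cases h : r ≤ c
    · rw [show (c : ℤ) - r = ((c - r : ℕ) : ℤ) by omega, ← hμ]
      simp only [γ]
      omega
    · simp [h]
  have hinj : ∀ x y : γ.shiftedCells, (x.1.2 : ℤ) - x.1.1 = (y.1.2 : ℤ) - y.1.1 →
      x.1.1 = y.1.1 → x = y :=
    fun x y h1 h2 => Subtype.ext (Prod.ext (by omega) (by omega))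
  have hX : ∀ c i, i < a.count c ↔
      ∃ x : γ.shiftedCells, (x.1.2 : ℤ) - x.1.1 = c ∧ x.1.1 = i := by
    intro c i
    constructor
    · intro h
      obtain ⟨j, hj, rfl, -⟩ := exists_index_of_lt_count h
      have := hnn hj
      have hm : (i, i + a[j].toNat) ∈ γ.shiftedCells :=
        (hγ _ _).2 ⟨by omega, by rwa [show ((i + a[j].toNat : ℕ) : ℤ) - i = a[j] by omega]⟩
      exact ⟨⟨_, hm⟩, by simp only; omega, rfl⟩
    · rintro ⟨⟨⟨r, s⟩, hx⟩, rfl, rfl⟩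
      exact ((hγ _ _).1 hx).2
  obtain ⟨e, he, hk⟩ := exists_filling hal hinj hX
  have hlt : ∀ p : Finset.Icc 1 m, (p : ℕ) - 1 < v.length := fun p => by
    have := Finset.mem_Icc.1 p.2
    omega
  have hval : ∀ x, |v[(e x : ℕ) - 1]'(hlt _)| = (x.1.2 : ℤ) - x.1.1 := by
    intro x
    have h1 := letterList_getElem_sub (fun p => ((e.symm p).1.2 : ℤ) - (e.symm p).1.1) (e x)
    simp only [he, Equiv.symm_apply_apply] at h1
    rw [← h1]
    simp [ha]
  -- A letter is marked exactly if its diagonal is positive, so the main diagonal is unmarked.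
  let F : SignedFilling γ := ⟨e, fun x => decide (0 < v[(e x : ℕ) - 1]'(hlt _))⟩
  have hF : F.IsStandard := by
    refine ⟨?_, ?_, ?_⟩
    · rintro ⟨⟨r, c⟩, hx⟩ ⟨⟨s, d⟩, hy⟩ h1 h2
      have hx' := (hγ _ _).1 hx
      have hy' := (hγ _ _).1 hy
      simp only at h1 h2
      subst h1
      refine (hk _ _).2 (lt_of_lt_of_le ((hk ⟨(r, d), hy⟩ _).1 le_rfl) ?_)
      have := left (e ⟨(r, d), hy⟩) (c := d - r) (c' := c - r) (by omega)
      simp only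
      rwa [show ((c - r : ℕ) : ℤ) = c - r by omega,
        show ((d - r : ℕ) : ℤ) = d - r by omega] at this
    · rintro ⟨⟨r, c⟩, hx⟩ ⟨⟨s, d⟩, hy⟩ h1 h2
      have hx' := (hγ _ _).1 hx
      have hy' := (hγ _ _).1 hy
      simp only at h1 h2
      subst h1
      refine (hk _ _).2 ?_
      have h3 := (hk ⟨(s, c), hy⟩ _).1 le_rfl
      simp only at h3 ⊢
      rw [show (c : ℤ) - s = ((c - s : ℕ) : ℤ) by omega] at h3
      have := up _ (c - s) h2 h3
      rwa [show c - s + (s - r) = c - r by omega,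
        show ((c - r : ℕ) : ℤ) = c - r by omega] at this
    · intro x hx
      have := hval x
      rw [decide_eq_false_iff_not]
      rw [hx, sub_self, abs_eq_zero] at this
      omega
  refine ⟨γ, ⟨F, hF⟩, ?_⟩
  refine List.ext_getElem ?_ fun j h1 h2 => ?_
  · exact (diagWord_length _).trans hm.symm
  · simp only [diagWord]
    rw [letterList_getElem]
    set p : Finset.Icc 1 m := ⟨j + 1, Finset.mem_Icc.2 (by omega)⟩ with hp
    have h3 := hval (e.symm p)
    rw [Equiv.apply_symm_apply] at h3
    simp only [hp, Nat.add_sub_cancel] at h3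
    simp only [SignedFilling.diag, F, Equiv.apply_symm_apply]
    simp only [hp, Nat.add_sub_cancel, decide_eq_true_eq]
    split_ifs with h4
    · rw [← h3, abs_of_pos h4]
    · rw [abs_of_nonpos (by omega)] at h3
      omega

theorem exists_diagWord_eq {v : List ℤ} (hv : SignedPath v)
    (hp : (v.map abs).Perm (S.diagWord.map abs)) :
    ∃ S' : SignedStandardTableau γ, S'.diagWord = v := by
  have hl : v.length = n := by
    have := hp.length_eq
    simpa [diagWord_length] using this
  obtain ⟨γ', S', rfl⟩ := exists_of_signedPath hl hv
  obtain rfl := S.shape_eq_of_perm S' hp.symm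
  exact ⟨S', rfl⟩

end SignedStandardTableau

/-! ### Descents of the hook reading word. -/

namespace SignedFilling

variable {n : ℕ} {γ : StrictPartition n}

theorem IsStandard.not_lt_lt {S : SignedFilling γ} (hS : S.IsStandard) {x y : γ.shiftedCells}
    (h : (S.entry y : ℕ) = S.entry x + 1) : ¬ (x.1.1 < y.1.1 ∧ x.1.2 < y.1.2) := by
  obtain ⟨⟨r, c⟩, hx⟩ := x
  obtain ⟨⟨s, e⟩, hy⟩ := y
  rintro ⟨h1, h2⟩
  simp only at h1 h2
  have hx' := StrictPartition.mem_shiftedCells.1 hx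
  have hy' := StrictPartition.mem_shiftedCells.1 hy
  have hl := γ.add_rowLen_le (r := r) (s := s) (by omega) (by omega)
  have hz : (r, e) ∈ γ.shiftedCells := StrictPartition.mem_shiftedCells.2 ⟨by omega, by omega⟩
  have a1 : S.entry ⟨_, hx⟩ < S.entry ⟨_, hz⟩ := hS.lt_of (by simp; omega) le_rfl h2.le
  have a2 : S.entry ⟨_, hz⟩ < S.entry ⟨_, hy⟩ := hS.lt_of (by simp; omega) h1.le le_rfl
  rw [← Subtype.coe_lt_coe] at a1 a2
  omega

/-- The cell `x` is read before `y` in the hook reading word. -/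
def ReadBefore (S : SignedFilling γ) (x y : γ.shiftedCells) : Prop :=
  (if S.marked y = true then y.1.2 else y.1.1) < (if S.marked x = true then x.1.2 else x.1.1) ∨
  (if S.marked y = true then y.1.2 else y.1.1) = (if S.marked x = true then x.1.2 else x.1.1) ∧
    (S.marked x = true ∧ S.marked y = true ∧ x.1.1 < y.1.1 ∨
      S.marked x = true ∧ S.marked y = false ∨
      S.marked x = false ∧ S.marked y = false ∧ x.1.2 < y.1.2)

/-- The next letter is neither weakly below and left nor strictly above and right of the current
one, and it is adjacent if in the same row or column. For each choice of marks this makes the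
reading order follow the signed diagonals. -/
theorem IsStandard.readBefore_iff {S : SignedFilling γ} (hS : S.IsStandard)
    {x y : γ.shiftedCells} (h : (S.entry y : ℕ) = S.entry x + 1) :
    S.ReadBefore y x ↔ S.diag (S.entry x) < S.diag (S.entry y) := by
  have hxy : x ≠ y := by rintro rfl; omega
  have hnot : ¬ (y.1.1 ≤ x.1.1 ∧ y.1.2 ≤ x.1.2) := by
    rintro ⟨h1, h2⟩
    have := hS.lt_of hxy.symm h1 h2
    rw [← Subtype.coe_lt_coe] at this
    omega
  have hnot' := hS.not_lt_lt h
  have hadj := fun h' => hS.adjacent (x := x) (y := y) h' h.le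
  rw [abs_diag, abs_diag, abs_eq (by norm_num)] at hadj
  have hx : x.1.1 ≤ x.1.2 := (StrictPartition.mem_shiftedCells.1 x.2).1
  have hy : y.1.1 ≤ y.1.2 := (StrictPartition.mem_shiftedCells.1 y.2).1
  have hmx := hS.diag_unmarked x
  have hmy := hS.diag_unmarked y
  unfold ReadBefore diag
  simp only [Equiv.symm_apply_apply]
  cases h1 : S.marked x <;> cases h2 : S.marked y <;> simp only [h1, h2] at hmx hmy ⊢ <;> simp <;>
    simp at hmx hmy <;> omega

theorem ReadBefore.asymm {S : SignedFilling γ} {x y : γ.shiftedCells} (h : S.ReadBefore x y) :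
    ¬ S.ReadBefore y x := by
  unfold ReadBefore at *
  cases h1 : S.marked x <;> cases h2 : S.marked y <;> simp [h1, h2] at h ⊢ <;> omega

theorem mem_hookWord (S : SignedFilling γ) (x : γ.shiftedCells) :
    (S.entry x : ℕ) ∈ S.hookWord := by
  obtain ⟨⟨r, c⟩, hx⟩ := x
  have h1 := StrictPartition.lt_of_mem_shiftedCells hx
  have h2 := (StrictPartition.mem_shiftedCells.1 hx).1
  simp only [hookWord, List.mem_flatMap, List.mem_reverse, List.mem_range, List.mem_append,
    List.mem_filterMap]
  cases h : S.marked ⟨(r, c), hx⟩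
  · refine ⟨r, by omega, Or.inr ⟨c, h1, ?_⟩⟩
    rw [dif_pos hx, if_pos h]
  · refine ⟨c, h1, Or.inl ⟨r, by omega, ?_⟩⟩
    rw [dif_pos hx, if_pos h]

theorem pairwise_hookWord (S : SignedFilling γ) : S.hookWord.Pairwise fun a b =>
    ∃ x y : γ.shiftedCells, (S.entry x : ℕ) = a ∧ (S.entry y : ℕ) = b ∧ S.ReadBefore x y := by
  rw [hookWord, List.pairwise_flatMap]
  constructor
  · intro i _
    rw [List.pairwise_append]
    refine ⟨?_, ?_, ?_⟩
    · rw [List.pairwise_filterMap]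
      refine List.pairwise_lt_range.imp fun {r r'} hr a ha b hb => ?_
      split_ifs at ha hb with h1 h2 h3 h4
      cases ha
      cases hb
      exact ⟨_, _, rfl, rfl, Or.inr ⟨by simp [*], Or.inl ⟨by assumption, by assumption, hr⟩⟩⟩
    · rw [List.pairwise_filterMap]
      refine List.pairwise_lt_range.imp fun {c c'} hc a ha b hb => ?_
      split_ifs at ha hb with h1 h2 h3 h4
      cases ha
      cases hb
      exact ⟨_, _, rfl, rfl, Or.inr ⟨by simp [*], Or.inr (Or.inr ⟨by assumption, by assumption, hc⟩)⟩⟩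
    · intro a ha b hb
      simp only [List.mem_filterMap] at ha hb
      obtain ⟨c, -, hc⟩ := ha
      obtain ⟨c', -, hc'⟩ := hb
      split_ifs at hc hc'
      cases hc
      cases hc'
      exact ⟨_, _, rfl, rfl, Or.inr ⟨by simp [*], Or.inr (Or.inl ⟨by assumption, by assumption⟩)⟩⟩
  · rw [List.pairwise_reverse]
    have key : ∀ i a, a ∈ ((List.range n).filterMap fun r =>
        if h : (r, i) ∈ γ.shiftedCells then
          if S.marked ⟨(r, i), h⟩ = true then some (S.entry ⟨(r, i), h⟩ : ℕ) else none
        else none) ++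
      ((List.range n).filterMap fun c =>
        if h : (i, c) ∈ γ.shiftedCells then
          if S.marked ⟨(i, c), h⟩ = false then some (S.entry ⟨(i, c), h⟩ : ℕ) else none
        else none) → ∃ x : γ.shiftedCells, (S.entry x : ℕ) = a ∧
          (if S.marked x = true then x.1.2 else x.1.1) = i := by
      intro i a ha
      simp only [List.mem_append, List.mem_filterMap] at ha
      rcases ha with ⟨r, -, hr⟩ | ⟨r, -, hr⟩ <;> split_ifs at hr <;> cases hr <;>
        exact ⟨_, rfl, by simp [*]⟩
    refine List.pairwise_lt_range.imp fun {r r'} hr a ha b hb => ?_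
    obtain ⟨x, hx, hx'⟩ := key _ _ ha
    obtain ⟨y, hy, hy'⟩ := key _ _ hb
    exact ⟨x, y, hx, hy, Or.inl (by rw [hx', hy']; exact hr)⟩

end SignedFilling

namespace SignedStandardTableau

variable {n : ℕ} {γ : StrictPartition n} (S : SignedStandardTableau γ)

theorem des_eq : S.des = ascents n S.diagWord := by
  classical
  unfold des wordDescents ascents
  refine Finset.filter_congr fun i hi => ?_
  rw [diagWord, ascAt_letterList _ hi]
  have hi' := Finset.mem_Ico.1 hi
  obtain ⟨x, hx⟩ := S.1.entry.surjective ⟨i, Finset.mem_Icc.2 (by omega)⟩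
  obtain ⟨y, hy⟩ := S.1.entry.surjective ⟨i + 1, Finset.mem_Icc.2 (by omega)⟩
  have ex : (S.1.entry x : ℕ) = i := by rw [hx]
  have ey : (S.1.entry y : ℕ) = i + 1 := by rw [hy]
  have hinj : ∀ {x y : γ.shiftedCells}, (S.1.entry x : ℕ) = S.1.entry y → x = y :=
    fun h => S.1.entry.injective (Subtype.ext h)
  rw [← hx, ← hy]
  have hR : ∀ a b, (∃ x y : γ.shiftedCells, (S.1.entry x : ℕ) = a ∧ (S.1.entry y : ℕ) = b ∧
      S.1.ReadBefore x y) → ¬ ∃ x y : γ.shiftedCells, (S.1.entry x : ℕ) = b ∧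
      (S.1.entry y : ℕ) = a ∧ S.1.ReadBefore x y := by
    rintro a b ⟨x, y, h1, h2, h3⟩ ⟨y', x', h1', h2', h3'⟩
    rw [hinj (h1'.trans h2.symm), hinj (h2'.trans h1.symm)] at h3'
    exact h3.asymm h3'
  have key := idxOf_lt_idxOf_iff S.1.pairwise_hookWord hR (S.1.mem_hookWord y)
    (S.1.mem_hookWord x) (by omega)
  rw [← S.2.readBefore_iff (by rw [ex, ey])]
  simp only [ex, ey] at key
  rw [key]
  constructor
  · rintro ⟨x', y', h1, h2, h3⟩
    rwa [hinj (h1.trans ey.symm), hinj (h2.trans ex.symm)] at h3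
  · exact fun h => ⟨y, x, ey, ex, h⟩

end SignedStandardTableau

/-- The Schur `P`-function of the words with given absolute diagonals. -/
theorem exists_schurP_eq {v : List ℤ} {m : ℕ} (hm : v.length = m) (hv : SignedPath v) :
    ∃ γ : StrictPartition m, ∀ {A : Type*} (s : Finset A) (f : A → List ℤ),
      Set.InjOn f s →
      (∀ u, (∃ a ∈ s, f a = u) ↔ SignedPath u ∧ (u.map abs).Perm (v.map abs)) →
      ∑ a ∈ s, fundamentalQSym m (ascents m (f a)) = schurP γ := by
  classical
  obtain ⟨γ, S, rfl⟩ := SignedStandardTableau.exists_of_signedPath hm hv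
  refine ⟨γ, fun {A} s f hf h => ?_⟩
  rw [schurP, ← Finset.sum_image (f := fun u => fundamentalQSym m (ascents m u)) hf]
  simp only [SignedStandardTableau.des_eq]
  rw [← Finset.sum_image (f := fun u => fundamentalQSym m (ascents m u))
    (SignedStandardTableau.diagWord_injective.injOn (s := _))]
  refine Finset.sum_congr ?_ fun _ _ => rfl
  ext u
  rw [Finset.mem_image, h]
  simp only [Finset.mem_image, Finset.mem_univ, true_and]
  constructor
  · rintro ⟨h1, h2⟩
    exact S.exists_diagWord_eq h1 h2
  · rintro ⟨T', rfl⟩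
    exact ⟨T'.signedPath_diagWord, T'.perm_map_abs_diagWord S⟩

/-! ### The involutions on tableaux as moves on words. -/

theorem mapTriple_getElem (t : ℤ → ℤ → ℤ → ℤ × ℤ × ℤ) {i : ℕ} {w : List ℤ}
    (h : i + 2 < w.length) {j : ℕ} (hj : j < (mapTriple t i w).length) :
    (mapTriple t i w)[j] =
      if j = i then (t w[i] w[i + 1] w[i + 2]).1
      else if j = i + 1 then (t w[i] w[i + 1] w[i + 2]).2.1
      else if j = i + 2 then (t w[i] w[i + 1] w[i + 2]).2.2
      else w[j]'(by rwa [mapTriple_length] at hj) := by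
  induction w generalizing i j with
  | nil => simp at h
  | cons a w ih =>
    rcases i with _ | i
    · rcases w with _ | ⟨b, _ | ⟨c, w⟩⟩
      · simp at h
      · simp at h
      · rcases j with _ | _ | _ | j <;> simp [mapTriple]
    · rcases j with _ | j
      · simp [mapTriple]
      · simp only [mapTriple, List.getElem_cons_succ]
        rw [ih (by simp only [List.length_cons] at h; omega)]
        simp only [Nat.add_right_cancel_iff, show i + 1 + 2 = i + 2 + 1 by ring]

namespace SignedFilling

variable {n : ℕ} {γ : StrictPartition n}

theorem diag_toggle (S : SignedFilling γ) (k : Finset.Icc 1 n) :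
    (S.toggle k).diag k = -S.diag k := by
  have h : (S.toggle k).entry = S.entry := rfl
  have h' : (S.toggle k).marked (S.entry.symm k) = !S.marked (S.entry.symm k) := by
    simp [SignedFilling.toggle]
  unfold diag
  rw [h, h']
  cases S.marked (S.entry.symm k) <;> simp

theorem diag_swapValues (S : SignedFilling γ) (k l p : Finset.Icc 1 n) :
    (S.swapValues k l).diag p = S.diag (Equiv.swap k l p) := by
  simp only [diag, SignedFilling.swapValues, Equiv.symm_trans_apply, Equiv.symm_swap]
  rfl

theorem diag_dualMove_of_ne (S : SignedFilling γ) {p q r u : Finset.Icc 1 n} (hp : u ≠ p)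
    (hq : u ≠ q) (hr : u ≠ r) : (S.dualMove p q r).diag u = S.diag u := by
  have key : ∀ x, u ≠ S.letterOn p q r x := by
    intro x
    unfold letterOn
    split_ifs <;> assumption
  unfold SignedFilling.dualMove
  simp only
  split_ifs
  · rfl
  · exact diag_toggle_of_ne _ (key _)
  · exact diag_toggle_of_ne _ (key _)
  · rw [diag_toggle_of_ne _ (key _), diag_toggle_of_ne _ (key _)]
  · rw [diag_swapValues, Equiv.swap_apply_of_ne_of_ne (key _) (key _)]

theorem diag_dualMove (S : SignedFilling γ) {p q r : Finset.Icc 1 n} (hpq : p ≠ q) (hqr : q ≠ r)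
    (hpr : p ≠ r) :
    ((S.dualMove p q r).diag p, (S.dualMove p q r).diag q, (S.dualMove p q r).diag r) =
      signedTriple (S.diag p) (S.diag q) (S.diag r) := by
  have hlo : S.loDiag p q r = min (S.diag p) (min (S.diag q) (S.diag r)) := rfl
  have hhi : S.hiDiag p q r = max (S.diag p) (max (S.diag q) (S.diag r)) := rfl
  have hmid : S.midDiag p q r =
    S.diag p + S.diag q + S.diag r - S.loDiag p q r - S.hiDiag p q r := rfl
  have e : S.dualMove p q r =
    if S.diag q = S.midDiag p q r then S
    else if S.loDiag p q r = S.midDiag p q r then S.toggle (S.letterOn p q r (S.hiDiag p q r))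
    else if S.midDiag p q r = S.hiDiag p q r then S.toggle (S.letterOn p q r (S.loDiag p q r))
    else if |(|S.loDiag p q r| - |S.hiDiag p q r|)| = 1 then
      (S.toggle (S.letterOn p q r (S.loDiag p q r))).toggle (S.letterOn p q r (S.hiDiag p q r))
    else S.swapValues (S.letterOn p q r (S.loDiag p q r)) (S.letterOn p q r (S.hiDiag p q r)) := rfl
  by_cases c1 : S.diag q = S.midDiag p q r
  · rw [e, if_pos c1, signedTriple, if_pos (by omega)]
  rw [if_neg c1] at e
  rw [signedTriple, if_neg (by omega)]
  -- As `q` is not on the median diagonal, two equal diagonals must be those of `p` and `r`, and the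
  -- letter toggled is `q`.
  by_cases c2 : S.diag p = S.diag r
  · rw [if_pos c2]
    have lq : S.letterOn p q r (S.diag q) = q := by
      unfold letterOn
      rw [if_neg (by omega), if_pos rfl]
    have e' : S.dualMove p q r = S.toggle q := by
      by_cases c3 : S.loDiag p q r = S.midDiag p q r
      · rw [e, if_pos c3, show S.hiDiag p q r = S.diag q by omega, lq]
      · rw [e, if_neg c3, if_pos (by omega), show S.loDiag p q r = S.diag q by omega, lq]
    rw [e', diag_toggle, diag_toggle_of_ne _ hpq, diag_toggle_of_ne _ hqr.symm]
  rw [if_neg (by omega), if_neg (by omega)] at e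
  rw [if_neg c2]
  have lp : S.letterOn p q r (S.diag p) = p := by
    unfold letterOn
    rw [if_pos rfl]
  have lq : S.letterOn p q r (S.diag q) = q := by
    unfold letterOn
    rw [if_neg (by omega), if_pos rfl]
  have lr : S.letterOn p q r (S.diag r) = r := by
    unfold letterOn
    rw [if_neg (by omega), if_neg (by omega)]
  -- Swapping the values while the marks stay in their cells exchanges the two signed diagonals.
  have two : ∀ k l : Finset.Icc 1 n, k ≠ l → ∀ T : SignedFilling γ, (T = if
      |(|S.diag k| - |S.diag l|)| = 1 then (S.toggle k).toggle l else S.swapValues k l) →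
      (∀ u, u ≠ k → u ≠ l → T.diag u = S.diag u) ∧
      (T.diag k, T.diag l) = if |S.diag k| = |S.diag l| + 1 ∨ |S.diag l| = |S.diag k| + 1 then
        (-S.diag k, -S.diag l) else (S.diag l, S.diag k) := by
    rintro k l hkl T rfl
    simp only [show (|(|S.diag k| - |S.diag l|)| = 1) ↔
      (|S.diag k| = |S.diag l| + 1 ∨ |S.diag l| = |S.diag k| + 1) by
        rw [abs_eq (by norm_num)]; omega]
    split_ifs
    · refine ⟨fun u h1 h2 => by rw [diag_toggle_of_ne _ h2, diag_toggle_of_ne _ h1], ?_⟩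
      rw [diag_toggle, diag_toggle_of_ne _ hkl, diag_toggle, diag_toggle_of_ne _ hkl.symm]
    · refine ⟨fun u h1 h2 => by rw [diag_swapValues, Equiv.swap_apply_of_ne_of_ne h1 h2], ?_⟩
      rw [diag_swapValues, diag_swapValues, Equiv.swap_apply_left, Equiv.swap_apply_right]
  by_cases c4 : (S.diag q < S.diag p ∧ S.diag p < S.diag r) ∨
      (S.diag r < S.diag p ∧ S.diag p < S.diag q)
  · rw [if_pos c4]
    rcases c4 with c4 | c4
    · rw [show S.loDiag p q r = S.diag q by omega, show S.hiDiag p q r = S.diag r by omega, lq,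
        lr] at e
      obtain ⟨h1, h2⟩ := two q r hqr _ e
      rw [h1 p hpq hpr, h2]
      split_ifs <;> rfl
    · rw [show S.loDiag p q r = S.diag r by omega, show S.hiDiag p q r = S.diag q by omega, lq,
        lr] at e
      obtain ⟨h1, h2⟩ := two r q hqr.symm _ e
      rw [h1 p hpr hpq]
      simp only [Prod.ext_iff] at h2 ⊢
      split_ifs at h2 ⊢ <;> first | omega | exact ⟨rfl, h2.2, h2.1⟩
  · rw [if_neg c4]
    rcases lt_or_gt_of_ne c2 with c5 | c5
    · by_cases c6 : S.diag q < S.diag p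
      · omega
      · rw [show S.loDiag p q r = S.diag p by omega, show S.hiDiag p q r = S.diag q by omega, lq,
          lp] at e
        obtain ⟨h1, h2⟩ := two p q hpq _ e
        rw [h1 r hpr.symm hqr.symm]
        simp only [Prod.ext_iff] at h2 ⊢
        split_ifs at h2 ⊢ <;> exact ⟨h2.1, h2.2, rfl⟩
    · rw [show S.loDiag p q r = S.diag q by omega, show S.hiDiag p q r = S.diag p by omega, lq,
        lp] at e
      obtain ⟨h1, h2⟩ := two q p hpq.symm _ e
      rw [h1 r hqr.symm hpr.symm]
      simp only [Prod.ext_iff] at h2 ⊢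
      split_ifs at h2 ⊢ <;> first | omega | exact ⟨h2.2, h2.1, rfl⟩

end SignedFilling

namespace SignedStandardTableau

variable {n : ℕ} {γ : StrictPartition n}

theorem diagWord_d (i : ℕ) (S : SignedStandardTableau γ) :
    (S.d i).diagWord = signedMove i S.diagWord := by
  refine List.ext_getElem ?_ fun j h1 h2 => ?_
  · rw [signedMove_length, diagWord_length, diagWord_length]
  have hj : j < n := by rwa [diagWord_length] at h1
  have hget : ∀ (T : SignedStandardTableau γ) {j : ℕ} (h : j < T.diagWord.length),
      T.diagWord[j] = T.1.diag ⟨j + 1, Finset.mem_Icc.2 (by rw [diagWord_length] at h; omega)⟩ :=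
    fun T j h => letterList_getElem _ h
  rw [hget]
  have hd : (S.d i).1 = S.1.d i := rfl
  rw [hd]
  rcases i with _ | _ | i
  · by_cases h : 2 ≤ n
    · have e : S.1.d 0 = S.1.toggle ⟨2, Finset.mem_Icc.2 ⟨by omega, h⟩⟩ := by
        rw [SignedFilling.d, if_pos rfl, dif_pos h]
      obtain ⟨x, y, w, hw⟩ : ∃ x y w, S.diagWord = x :: y :: w := by
        have := S.diagWord_length
        rcases hS : S.diagWord with _ | ⟨x, _ | ⟨y, w⟩⟩
        · rw [hS] at this; simp at this; omega
        · rw [hS] at this; simp at this; omega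
        · exact ⟨x, y, w, rfl⟩
      have hm : signedMove 0 S.diagWord = x :: -y :: w := by rw [hw]; rfl
      have hg := @hget S
      simp only [hm]
      rw [e]
      by_cases hj1 : j = 1
      · subst hj1
        rw [SignedFilling.diag_toggle, ← hget S (j := 1) (by rwa [diagWord_length])]
        simp [hw]
      · rw [SignedFilling.diag_toggle_of_ne _ (by rw [Ne, Subtype.ext_iff]; simp only; omega),
          ← hget S (j := j) (by rwa [diagWord_length])]
        simp only [hw]
        rcases j with _ | _ | j
        · rfl
        · exact absurd rfl hj1
        · rfl
    · have e : S.1.d 0 = S.1 := by rw [SignedFilling.d, if_pos rfl, dif_neg h]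
      have hm : signedMove 0 S.diagWord = S.diagWord := by
        have := S.diagWord_length
        rcases hS : S.diagWord with _ | ⟨x, _ | ⟨y, w⟩⟩
        · rfl
        · rfl
        · rw [hS] at this; simp at this; omega
      simp only [hm]
      rw [e, hget]
  · have e : S.1.d 1 = S.1 := by
      rw [SignedFilling.d, if_neg (by omega), dif_neg (by omega)]
    have hm : signedMove 1 S.diagWord = S.diagWord := rfl
    simp only [zero_add, hm]
    rw [e, hget]
  · have hm : signedMove (i + 2) S.diagWord = mapTriple signedTriple i S.diagWord := rfl
    simp only [show i + 1 + 1 = i + 2 from rfl, hm]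
    by_cases h : i + 2 < n
    · have e : S.1.d (i + 2) = S.1.dualMove ⟨i + 2 - 1, Finset.mem_Icc.2 (by omega)⟩
          ⟨i + 2, Finset.mem_Icc.2 (by omega)⟩ ⟨i + 2 + 1, Finset.mem_Icc.2 (by omega)⟩ := by
        rw [SignedFilling.d, if_neg (by omega), dif_pos ⟨by omega, h⟩]
      have ht := S.1.diag_dualMove (p := ⟨i + 2 - 1, Finset.mem_Icc.2 (by omega)⟩)
        (q := ⟨i + 2, Finset.mem_Icc.2 (by omega)⟩) (r := ⟨i + 2 + 1, Finset.mem_Icc.2 (by omega)⟩)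
        (by rw [Ne, Subtype.ext_iff]; simp only; omega)
        (by rw [Ne, Subtype.ext_iff]; simp only; omega)
        (by rw [Ne, Subtype.ext_iff]; simp only; omega)
      rw [mapTriple_getElem signedTriple (by rwa [diagWord_length]), hget, hget, hget, e]
      simp only [Prod.ext_iff] at ht
      obtain ⟨t1, t2, t3⟩ := ht
      split_ifs with c1 c2 c3
      · subst c1; exact t1
      · subst c2; exact t2
      · subst c3; exact t3
      · rw [SignedFilling.diag_dualMove_of_ne, hget] <;>
          rw [Ne, Subtype.ext_iff] <;> simp only <;> omega
    · have e : S.1.d (i + 2) = S.1 := by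
        rw [SignedFilling.d, if_neg (by omega), dif_neg (by omega)]
      have hm' := mapTriple_of_length_lt signedTriple (j := i) (w := S.diagWord)
        (by rw [diagWord_length]; omega)
      simp only [hm']
      rw [e, hget]

end SignedStandardTableau

/-! ### Queer dual equivalences from signed content words -/

/-- If two adjacent absolute diagonals are toggled in the generic case, the two letters have
opposite signs and the median is smaller than both in absolute value. It therefore remains the
median, and the same case applies again. -/
theorem signedTriple_signedTriple {x y z : ℤ} (h1 : x ≠ y) (h2 : x ≠ -y) (h3 : y ≠ z) (h4 : y ≠ -z)
    (h5 : x ≠ z ∧ x ≠ -z ∨ x = 0 ∧ z = 0 ∧ (y = 1 ∨ y = -1)) :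
    signedTriple (signedTriple x y z).1 (signedTriple x y z).2.1 (signedTriple x y z).2.2 =
      (x, y, z) := by
  have key : ∀ p q r p' q' r', signedTriple x y z = (p, q, r) → signedTriple p q r = (p', q', r') →
      p' = x ∧ q' = y ∧ r' = z := by
    intro p q r p' q' r' e e'
    unfold signedTriple at e e'
    have ax := abs_cases x
    have ay := abs_cases y
    have az := abs_cases z
    rcases h5 with h5 | ⟨rfl, rfl, rfl | rfl⟩
    · split_ifs at e <;> simp only [Prod.mk.injEq] at e <;> obtain ⟨rfl, rfl, rfl⟩ := e <;>
        (try simp only [abs_neg] at e') <;> split_ifs at e' <;> simp only [Prod.mk.injEq] at e' <;>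
        obtain ⟨rfl, rfl, rfl⟩ := e' <;> omega
    · simp at e
      obtain ⟨rfl, rfl, rfl⟩ := e
      simp at e'
      omega
    · simp at e
      obtain ⟨rfl, rfl, rfl⟩ := e
      simp at e'
      omega
  obtain ⟨a, b, c⟩ := key _ _ _ _ _ _ rfl rfl
  exact Prod.ext a (Prod.ext b c)

theorem HopPath.mapTriple_mapTriple {g : ℤ → ℤ} {w : List ℤ}
    (h : HopPath Set.univ g (doubleWord w)) (j : ℕ) :
    mapTriple signedTriple j (mapTriple signedTriple j w) = w := by
  induction w generalizing g j with
  | nil => cases j <;> rfl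
  | cons x w ih =>
    rcases j with _ | j
    · rcases w with _ | ⟨y, _ | ⟨z, w⟩⟩
      · rfl
      · rfl
      · obtain ⟨h1, h2, h3, h4, h5⟩ := h.double_facts
        simp only [mapTriple, signedTriple_signedTriple h1 h2 h3 h4 h5]
    · exact congrArg (x :: ·) (ih h.2.2 j)

theorem SignedPath.signedMove_signedMove {w : List ℤ} (h : SignedPath w) (i : ℕ) :
    signedMove i (signedMove i w) = w := by
  rcases i with _ | _ | i
  · rcases w with _ | ⟨x, _ | ⟨y, w⟩⟩
    · rfl
    · rfl
    · simp [signedMove]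
  · rfl
  · exact h.to_double.mapTriple_mapTriple i

theorem SignedPath.moves {w : List ℤ} (h : SignedPath w) (l : List ℕ) :
    SignedPath (signedMoves l w) := by
  induction l generalizing w with
  | nil => exact h
  | cons i l ih => exact ih (h.move i)

theorem map_abs_signedMoves_perm (l : List ℕ) (w : List ℤ) :
    ((signedMoves l w).map abs).Perm (w.map abs) := by
  induction l generalizing w with
  | nil => exact List.Perm.refl _
  | cons i l ih => exact (ih (signedMove i w)).trans (map_abs_signedMove_perm i w)

theorem signedMoves_length (l : List ℕ) (w : List ℤ) : (signedMoves l w).length = w.length := by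
  simpa using (map_abs_signedMoves_perm l w).length_eq

theorem mapTriple_comm (t : ℤ → ℤ → ℤ → ℤ × ℤ × ℤ) {i j : ℕ} (hij : i + 3 ≤ j) (w : List ℤ) :
    mapTriple t i (mapTriple t j w) = mapTriple t j (mapTriple t i w) := by
  by_cases hl : w.length < j + 3
  · rw [mapTriple_of_length_lt t hl, mapTriple_of_length_lt t (j := j) (w := mapTriple t i w) (by rwa [mapTriple_length])]
  obtain ⟨k, rfl⟩ := Nat.exists_eq_add_of_le hij
  obtain ⟨v, w', rfl, hv⟩ : ∃ v w', w = v ++ w' ∧ v.length = i + 3 :=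
    ⟨w.take (i + 3), w.drop (i + 3), (List.take_append_drop _ _).symm, by
      rw [List.length_take]; omega⟩
  rw [mapTriple_append_left t i v w' (by omega)]
  have e1 := mapTriple_append_right t k v w'
  have e2 := mapTriple_append_right t k (mapTriple t i v) w'
  rw [mapTriple_length] at e2
  rw [hv] at e1 e2
  rw [e1, e2, mapTriple_append_left t i v _ (by omega)]

/-- A move of index `j ≥ 2` affects the positions from `j - 2` to `j`, counted from 0, and the move
of index 0 only position 1. -/
theorem signedMove_comm {i j : ℕ} (h : 2 ≤ i ∧ i + 3 ≤ j ∨ i = 0 ∧ 4 ≤ j) (w : List ℤ) :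
    signedMove i (signedMove j w) = signedMove j (signedMove i w) := by
  rcases h with ⟨h2, hij⟩ | ⟨rfl, hj⟩
  · obtain ⟨i, rfl⟩ := Nat.exists_eq_add_of_le' h2
    obtain ⟨j, rfl⟩ := Nat.exists_eq_add_of_le' (show 2 ≤ j by omega)
    exact mapTriple_comm signedTriple (by omega) w
  · obtain ⟨j, rfl⟩ := Nat.exists_eq_add_of_le' hj
    rcases w with _ | ⟨x, _ | ⟨y, w⟩⟩ <;> rfl

theorem signedMoves_add_two (q : List ℕ) (w : List ℤ) :
    signedMoves (q.map (· + 2)) w = mapTriples signedTriple q w := by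
  induction q generalizing w with
  | nil => rfl
  | cons j q ih => exact ih (mapTriple signedTriple j w)

/-! ### From orbits of words to equivalence classes. -/

theorem genEquiv_iff {A : Type*} {φ : ℕ → A → A} {I : Set ℕ}
    (h : ∀ i ∈ I, Function.Involutive (φ i)) {S T : A} :
    GenEquiv φ I S T ↔ ∃ l : List ℕ, (∀ i ∈ l, i ∈ I) ∧ T = l.foldl (fun U i => φ i U) S := by
  constructor
  · intro hg
    induction hg with
    | rel x y hxy =>
      obtain ⟨j, hj, rfl⟩ := hxy
      exact ⟨[j], by simpa using hj, rfl⟩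
    | refl x => exact ⟨[], by simp, rfl⟩
    | symm x y _ ih =>
      obtain ⟨l, hl, rfl⟩ := ih
      refine ⟨l.reverse, fun i hi => hl i (List.mem_reverse.1 hi), ?_⟩
      clear * - h hl
      induction l generalizing x with
      | nil => rfl
      | cons i l ih =>
        simp only [List.reverse_cons, List.foldl_append, List.foldl_cons, List.foldl_nil]
        rw [← ih (φ i x) (fun j hj => hl j (by simp [hj]))]
        exact (h i (hl i (by simp)) x).symm
    | trans x y z _ _ ih1 ih2 =>
      obtain ⟨l, hl, rfl⟩ := ih1
      obtain ⟨l', hl', rfl⟩ := ih2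
      refine ⟨l ++ l', fun i hi => ?_, by rw [List.foldl_append]⟩
      rcases List.mem_append.1 hi with hi | hi
      · exact hl i hi
      · exact hl' i hi
  · rintro ⟨l, hl, rfl⟩
    induction l generalizing S with
    | nil => exact Relation.EqvGen.refl _
    | cons i l ih =>
      exact Relation.EqvGen.trans _ _ _ (Relation.EqvGen.rel _ _ ⟨i, hl i (by simp), rfl⟩)
        (ih fun j hj => hl j (by simp [hj]))

/-- A faithful encoding of `A` by signed content words, compatible with descents and with the
elementary involutions. -/
structure IsWordModel {A : Type*} (n : ℕ) (Des : A → Finset ℕ) (ψ : ℕ → A → A)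
    (W : A → List ℤ) : Prop where
  injective : Function.Injective W
  length : ∀ S, (W S).length = n
  path : ∀ S, SignedPath (W S)
  des : ∀ S, Des S = ascents n (W S)
  move : ∀ i S, W (ψ i S) = signedMove i (W S)

namespace IsWordModel

variable {A : Type*} {n : ℕ} {Des : A → Finset ℕ} {ψ : ℕ → A → A} {W : A → List ℤ}

theorem involutive (h : IsWordModel n Des ψ W) (i : ℕ) : Function.Involutive (ψ i) := fun S =>
  h.injective (by rw [h.move, h.move, (h.path S).signedMove_signedMove])

theorem word_foldl (h : IsWordModel n Des ψ W) (l : List ℕ) (S : A) :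
    W (l.foldl (fun U i => ψ i U) S) = signedMoves l (W S) := by
  induction l generalizing S with
  | nil => rfl
  | cons i l ih =>
    rw [List.foldl_cons, ih, h.move]
    rfl

theorem genEquiv_iff (h : IsWordModel n Des ψ W) {I : Set ℕ} {S T : A} :
    GenEquiv ψ I S T ↔ ∃ l : List ℕ, (∀ i ∈ l, i ∈ I) ∧ W T = signedMoves l (W S) := by
  rw [_root_.genEquiv_iff fun i _ => h.involutive i]
  refine exists_congr fun l => and_congr_right fun _ => ?_
  rw [← h.word_foldl, h.injective.eq_iff]

/-- The classes generated by the involutions with indices from `a + 2` to `a + m - 1`. -/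
theorem genEquiv_Icc_iff (h : IsWordModel n Des ψ W) {a m : ℕ} (hm : 3 ≤ m) (ham : a + m ≤ n)
    {S T : A} :
    GenEquiv ψ (Set.Icc (a + 2) (a + m - 1)) S T ↔ ∃ q : List ℕ, (∀ j ∈ q, j + 3 ≤ m) ∧
      W T = (W S).take a ++ (mapTriples signedTriple q (((W S).drop a).take m) ++
        ((W S).drop a).drop m) := by
  have hl := h.length S
  have hs : W S = (W S).take a ++ (((W S).drop a).take m ++ ((W S).drop a).drop m) := by
    rw [List.take_append_drop, List.take_append_drop]
  have hla : ((W S).take a).length = a := by rw [List.length_take]; omega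
  have hlm : (((W S).drop a).take m).length = m := by
    rw [List.length_take, List.length_drop]; omega
  have key : ∀ q : List ℕ, (∀ j ∈ q, j + 3 ≤ m) → signedMoves ((q.map (a + ·)).map (· + 2)) (W S) =
      (W S).take a ++ (mapTriples signedTriple q (((W S).drop a).take m) ++
        ((W S).drop a).drop m) := by
    intro q hq
    rw [signedMoves_add_two]
    conv_lhs => rw [hs]
    have := mapTriples_append_right signedTriple q ((W S).take a)
      (((W S).drop a).take m ++ ((W S).drop a).drop m)
    rw [hla] at this
    rw [this, mapTriples_append_left _ _ _ _ (by rwa [hlm])]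
  rw [h.genEquiv_iff]
  constructor
  · rintro ⟨l, hl, e⟩
    refine ⟨l.map (· - (a + 2)), ?_, ?_⟩
    · intro j hj
      obtain ⟨i, hi, rfl⟩ := List.mem_map.1 hj
      have := hl i hi
      rw [Set.mem_Icc] at this
      omega
    · rw [← key, e, List.map_map, List.map_map]
      · congr 1
        symm
        refine (List.map_congr_left fun i hi => ?_).trans (List.map_id l)
        have := hl i hi
        rw [Set.mem_Icc] at this
        simp only [Function.comp_apply, id]
        omega
      · intro j hj
        obtain ⟨i, hi, rfl⟩ := List.mem_map.1 hj
        have := hl i hi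
        rw [Set.mem_Icc] at this
        omega
  · rintro ⟨q, hq, e⟩
    refine ⟨(q.map (a + ·)).map (· + 2), ?_, by rw [key q hq, e]⟩
    intro i hi
    simp only [List.mem_map] at hi
    obtain ⟨_, ⟨j, hj, rfl⟩, rfl⟩ := hi
    have := hq j hj
    rw [Set.mem_Icc]
    omega

/-- The classes generated by all involutions of index at most `k`. -/
theorem genEquiv_le_iff (h : IsWordModel n Des ψ W) {k : ℕ} (hk : 1 ≤ k) (hkn : k < n) {S T : A} :
    GenEquiv ψ {i | i ≤ k ∧ i ≠ 1} S T ↔ ∃ l : List ℕ, (∀ i ∈ l, i ≤ k ∧ i ≠ 1) ∧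
      W T = signedMoves l ((W S).take (k + 1)) ++ (W S).drop (k + 1) := by
  rw [h.genEquiv_iff]
  refine exists_congr fun l => and_congr_right fun hl => ?_
  have hlen : ((W S).take (k + 1)).length = k + 1 := by
    rw [List.length_take, h.length]; omega
  rw [← signedMoves_append_word _ (fun i hi => by have := (hl i hi).1; omega) (by omega),
    List.take_append_drop]

theorem restrictDescents_eq (h : IsWordModel n Des ψ W) {a m : ℕ} (ham : a + m ≤ n) (S : A) :
    restrictDescents (a + 1) (a + m) (Des S) = ascents m (((W S).drop a).take m) := by
  have hl := h.length S
  have hla : ((W S).take a).length = a := by rw [List.length_take]; omega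
  have hlm : (((W S).drop a).take m).length = m := by
    rw [List.length_take, List.length_drop]; omega
  have key : ∀ y, 1 ≤ y → y < m →
      (AscAt (y - 1) (((W S).drop a).take m) ↔ AscAt (a + y - 1) (W S)) := by
    intro y h1 h2
    have e1 := ascAt_append_right (y - 1) ((W S).take a) ((W S).drop a)
    rw [List.take_append_drop, hla, show a + (y - 1) = a + y - 1 by omega] at e1
    have e2 := ascAt_append_left (y - 1) (((W S).drop a).take m) (((W S).drop a).drop m) (by omega)
    rw [List.take_append_drop] at e2
    rw [e1, e2]
  rw [h.des]
  ext y
  simp only [restrictDescents, ascents, Finset.mem_image, Finset.mem_filter, Finset.mem_Ico]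
  constructor
  · rintro ⟨x, ⟨⟨⟨h1, h2⟩, h3⟩, h4, h5⟩, rfl⟩
    refine ⟨by omega, (key _ (by omega) (by omega)).2 ?_⟩
    rwa [show a + (x - (a + 1 - 1)) - 1 = x - 1 by omega]
  · rintro ⟨⟨h1, h2⟩, h3⟩
    exact ⟨a + y, ⟨⟨by omega, (key y h1 h2).1 h3⟩, by omega, by omega⟩, by omega⟩

theorem inter_Icc_eq (h : IsWordModel n Des ψ W) {k : ℕ} (hk : k < n) (S : A) :
    Des S ∩ Finset.Icc 1 k = ascents (k + 1) ((W S).take (k + 1)) := by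
  have hlen : ((W S).take (k + 1)).length = k + 1 := by
    rw [List.length_take, h.length]; omega
  rw [h.des]
  ext y
  simp only [ascents, Finset.mem_inter, Finset.mem_filter, Finset.mem_Ico, Finset.mem_Icc]
  have key : 1 ≤ y → y ≤ k → (AscAt (y - 1) (W S) ↔ AscAt (y - 1) ((W S).take (k + 1))) := by
    intro h1 h2
    have := ascAt_append_left (y - 1) ((W S).take (k + 1)) ((W S).drop (k + 1)) (by omega)
    rwa [List.take_append_drop] at this
  constructor
  · rintro ⟨⟨h1, h2⟩, h3, h4⟩
    exact ⟨by omega, (key h3 h4).1 h2⟩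
  · rintro ⟨⟨h1, h2⟩, h3⟩
    exact ⟨⟨by omega, (key h1 (by omega)).2 h3⟩, h1, by omega⟩

/-- Rectifying the window of `m` letters maps the class bijectively, preserving ascents, onto all
content words of one straight shape. -/
theorem exists_schur_class [Fintype A] (h : IsWordModel n Des ψ W) {a m : ℕ} (hm : 3 ≤ m)
    (ham : a + m ≤ n) (T : A) : ∃ μ : YoungDiagram, μ.card = m ∧
      classQSym m (fun U => restrictDescents (a + 1) (a + m) (Des U)) ψ
        (Set.Icc (a + 2) (a + m - 1)) T = schurFunction μ := by
  classical
  set v := (W T).take a with hv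
  set w := ((W T).drop a).take m with hw
  set z := ((W T).drop a).drop m with hz
  have hl := h.length T
  have hvl : v.length = a := by rw [hv, List.length_take]; omega
  have hwl : w.length = m := by rw [hw, List.length_take, List.length_drop]; omega
  have hpath : SignedPath (v ++ w) := by
    have := h.path T
    rw [show W T = (v ++ w) ++ z by
      rw [hv, hw, hz, List.append_assoc, List.take_append_drop, List.take_append_drop],
      SignedPath, List.map_append] at this
    exact (hopPath_append.1 this).1
  have hclass : ∀ U, GenEquiv ψ (Set.Icc (a + 2) (a + m - 1)) T U ↔
      ∃ q : List ℕ, (∀ j ∈ q, j + 3 ≤ m) ∧ W U = v ++ (mapTriples signedTriple q w ++ z) :=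
    fun U => h.genEquiv_Icc_iff hm ham
  have hwin : ∀ {U} {q : List ℕ}, W U = v ++ (mapTriples signedTriple q w ++ z) →
      ((W U).drop a).take m = mapTriples signedTriple q w := by
    intro U q e
    rw [e, List.drop_append_of_le_length (by omega), List.drop_of_length_le (by omega),
      List.nil_append, List.take_append_of_le_length (by rw [mapTriples_length]; omega),
      List.take_of_length_le (by rw [mapTriples_length]; omega)]
  obtain ⟨μ, hμ, hsum⟩ := exists_schurFunction_eq hpath.hopPath_sortAfter
  rw [sortAfter_length, hwl] at hμ hsum
  refine ⟨μ, hμ, ?_⟩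
  rw [classQSym, ← hsum (Finset.univ.filter fun U =>
    GenEquiv ψ (Set.Icc (a + 2) (a + m - 1)) T U) (fun U => sortAfter v (((W U).drop a).take m))]
  · refine Finset.sum_congr (by congr) fun U hU => ?_
    obtain ⟨q, -, e⟩ := (hclass U).1 (by simpa using hU)
    rw [h.restrictDescents_eq ham, hwin e]
    congr 1
    unfold ascents
    exact Finset.filter_congr fun i _ => ((hpath.map_triples q).ascAt_sortAfter _).symm
  · intro U hU U' hU' e
    simp only [Finset.coe_filter, Finset.mem_univ, true_and, Set.mem_ofPred_eq] at hU hU'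
    -- Two members of the class differ by moves inside the window, so equal rectifications give
    -- equal windows by `SignedPath.eq_of_sortAfter_eq`.
    obtain ⟨q, -, e1⟩ := (hclass U).1 hU
    have hUU := Relation.EqvGen.trans _ _ _ (Relation.EqvGen.symm _ _ hU) hU'
    obtain ⟨p, -, e2⟩ := (h.genEquiv_Icc_iff hm ham).1 hUU
    have hp2 := hpath.map_triples q
    have etake : (W U).take a = v := by
      rw [e1, List.take_append_of_le_length (by omega), List.take_of_length_le (by omega)]
    have el : (((W U).drop a).take m).length = m := by rw [hwin e1, mapTriples_length, hwl]
    have eU' : ((W U').drop a).take m =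
        mapTriples signedTriple p (((W U).drop a).take m) := by
      rw [e2, List.drop_append_of_le_length (by rw [etake]; omega),
        List.drop_of_length_le (by rw [etake]; omega),
        List.nil_append, List.take_append_of_le_length (by rw [mapTriples_length]; omega),
        List.take_of_length_le (by rw [mapTriples_length]; omega)]
    simp only at e
    rw [eU'] at e
    rw [← hwin e1] at hp2
    have e3 := hp2.eq_of_sortAfter_eq e.symm
    rw [e3, List.take_append_drop, List.take_append_drop] at e2
    exact h.injective e2.symm
  · intro u
    simp only [Finset.mem_filter, Finset.mem_univ, true_and]
    constructor
    · rintro ⟨U, hU, rfl⟩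
      obtain ⟨q, -, e⟩ := (hclass U).1 hU
      rw [hwin e, hpath.sortAfter_mapTriples]
      exact ⟨hpath.hopPath_sortAfter.mapTriples_dual q, mapTriples_dual_perm q _⟩
    · rintro ⟨h1, h2⟩
      -- Every word of this shape is reached by elementary dual equivalences, which lift to moves on
      -- the window.
      obtain ⟨q, hq, rfl⟩ := HopPath.dual_connected m _ _ (by rw [sortAfter_length, hwl])
        hpath.hopPath_sortAfter h1 h2.symm
      obtain ⟨U, hU⟩ : ∃ U, W U = v ++ (mapTriples signedTriple q w ++ z) := by
        refine ⟨((q.map (a + ·)).map (· + 2)).foldl (fun U i => ψ i U) T, ?_⟩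
        rw [h.word_foldl, signedMoves_add_two]
        have := mapTriples_append_right signedTriple q v (w ++ z)
        rw [hvl] at this
        rw [← mapTriples_append_left _ _ _ _ (by rwa [hwl]), ← this, hv, hw, hz,
          List.take_append_drop, List.take_append_drop]
      exact ⟨U, (hclass U).2 ⟨q, hq, hU⟩, by rw [hwin hU, hpath.sortAfter_mapTriples]⟩

theorem take_path (h : IsWordModel n Des ψ W) (k : ℕ) (S : A) : SignedPath ((W S).take k) := by
  have := h.path S
  rw [← List.take_append_drop k (W S), SignedPath, List.map_append] at this
  exact (hopPath_append.1 this).1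

/-- By `SignedPath.reach`, the first `k + 1` letters run through all signed words of one shifted
shape, while the other letters stay fixed. -/
theorem exists_schurP_class [Fintype A] (h : IsWordModel n Des ψ W) {k : ℕ} (hk : 1 ≤ k)
    (hkn : k < n) (S : A) : ∃ γ : StrictPartition (k + 1),
      classQSym (k + 1) (fun U => Des U ∩ Finset.Icc 1 k) ψ {i | i ≤ k ∧ i ≠ 1} S = schurP γ := by
  classical
  have hlen : ((W S).take (k + 1)).length = k + 1 := by
    rw [List.length_take, h.length]; omega
  have htake : ∀ {U} {l : List ℕ},
      W U = signedMoves l ((W S).take (k + 1)) ++ (W S).drop (k + 1) →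
      (W U).take (k + 1) = signedMoves l ((W S).take (k + 1)) := by
    intro U l e
    rw [e, List.take_append_of_le_length (by rw [signedMoves_length, hlen]),
      List.take_of_length_le (by rw [signedMoves_length, hlen])]
  obtain ⟨γ, hsum⟩ := exists_schurP_eq hlen (h.take_path (k + 1) S)
  refine ⟨γ, ?_⟩
  rw [classQSym, ← hsum (Finset.univ.filter fun U => GenEquiv ψ {i | i ≤ k ∧ i ≠ 1} S U)
    (fun U => (W U).take (k + 1))]
  · refine Finset.sum_congr (by congr) fun U _ => ?_
    rw [h.inter_Icc_eq hkn]
  · intro U hU U' hU' e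
    simp only [Finset.coe_filter, Finset.mem_univ, true_and, Set.mem_ofPred_eq] at hU hU'
    obtain ⟨l, -, e1⟩ := (h.genEquiv_le_iff hk hkn).1 hU
    obtain ⟨l', -, e2⟩ := (h.genEquiv_le_iff hk hkn).1 hU'
    simp only at e
    rw [htake e1, htake e2] at e
    rw [← e, ← e1] at e2
    exact h.injective e2.symm
  · intro u
    simp only [Finset.mem_filter, Finset.mem_univ, true_and]
    constructor
    · rintro ⟨U, hU, rfl⟩
      obtain ⟨l, -, e1⟩ := (h.genEquiv_le_iff hk hkn).1 hU
      rw [htake e1]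
      exact ⟨(h.take_path _ S).moves l, map_abs_signedMoves_perm l _⟩
    · rintro ⟨h1, h2⟩
      obtain ⟨l, hl, -, rfl⟩ := SignedPath.reach (k - 1) _ _ (by rw [hlen]; omega)
        (h.take_path (k + 1) S) h1 h2.symm
      rw [Nat.sub_add_cancel hk] at hl
      have e1 : W (l.foldl (fun U i => ψ i U) S) =
          signedMoves l ((W S).take (k + 1)) ++ (W S).drop (k + 1) := by
        rw [h.word_foldl, ← signedMoves_append_word _
          (fun i hi => by have := (hl i hi).1; omega) (by omega), List.take_append_drop]
      exact ⟨_, (h.genEquiv_le_iff hk hkn).2 ⟨l, hl, e1⟩, htake e1⟩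

theorem exists_two_edge (h : IsWordModel n Des ψ W) {k : ℕ} (hkn : k < n) {S T : A}
    (hST : GenEquiv ψ {i | i ≤ k ∧ i ≠ 1} S T) :
    ∃ l : List ℕ, (∀ i ∈ l, i ≤ k ∧ i ≠ 1) ∧ l.count k ≤ 2 ∧
      T = l.foldl (fun U i => ψ i U) S := by
  -- `SignedPath.reach` starts with words of two letters, that is, with `k = 1`. For `k = 0` the
  -- class is an orbit of a single involution.
  rcases Nat.eq_zero_or_pos k with rfl | hk
  · obtain ⟨l, hl, rfl⟩ := (_root_.genEquiv_iff fun i _ => h.involutive i).1 hST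
    have key : ∀ l : List ℕ, (∀ i ∈ l, i = 0) → ∀ S, l.foldl (fun U i => ψ i U) S = S ∨
        l.foldl (fun U i => ψ i U) S = ψ 0 S := by
      intro l
      induction l with
      | nil => exact fun _ S => Or.inl rfl
      | cons i l ih =>
        intro hl S
        obtain rfl := hl i (by simp)
        rcases ih (fun j hj => hl j (by simp [hj])) (ψ 0 S) with e | e
        · exact Or.inr e
        · refine Or.inl ?_
          rw [List.foldl_cons, e]
          exact h.involutive 0 S
    rcases key l (fun i hi => Nat.le_zero.1 (hl i hi).1) S with e | e
    · exact ⟨[], by simp, by simp, e⟩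
    · exact ⟨[0], by simp, by simp, e⟩
  · obtain ⟨l, hl, e⟩ := (h.genEquiv_le_iff hk hkn).1 hST
    have hlen : ((W S).take (k + 1)).length = k + 1 := by
      rw [List.length_take, h.length]; omega
    obtain ⟨l', hl', hc, e'⟩ := SignedPath.reach (k - 1) _ _ (by rw [hlen]; omega)
        (h.take_path (k + 1) S) ((h.take_path (k + 1) S).moves l)
        (map_abs_signedMoves_perm l _).symm
    rw [Nat.sub_add_cancel hk] at hl' hc
    refine ⟨l', hl', hc, h.injective ?_⟩
    rw [e, e', h.word_foldl, ← signedMoves_append_word _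
      (fun i hi => by have := (hl' i hi).1; omega) (by omega), List.take_append_drop]

theorem isQueerDualEquivalence [Fintype A] (h : IsWordModel n Des ψ W) :
    IsQueerDualEquivalence n Des ψ where
  dual :=
    { des_subset := fun T => by
        classical
        rw [h.des, ascents]
        exact Finset.filter_subset _ _
      involutive := fun i _ _ => h.involutive i
      schur_class := fun b i hb hbi hi _ T => by
        -- The involutions of index `b` to `i` concern the letters from `b - 1` to `i + 1`, so `b -
        -- 2` letters precede the window.
        have := h.exists_schur_class (a := b - 2) (m := i - b + 3) (by omega) (by omega) T
        rwa [show b - 2 + 1 = b - 1 by omega, show b - 2 + (i - b + 3) = i + 1 by omega,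
          show b - 2 + 2 = b by omega, Nat.add_sub_cancel] at this
      comm := fun i j hi _ hj _ hij T => h.injective (by
        rw [h.move, h.move, h.move, h.move]
        rcases le_total i j with hle | hle
        · exact (signedMove_comm (by
            left; rw [abs_of_nonpos (by omega)] at hij; omega) _).symm
        · exact signedMove_comm (by
            left; rw [abs_of_nonneg (by omega)] at hij; omega) _) }
  involutive_zero := h.involutive 0
  schurP_class := fun i hi _ hin S => h.exists_schurP_class hi hin S
  comm := fun i hi _ S => h.injective (by
    rw [h.move, h.move, h.move, h.move]
    exact signedMove_comm (by omega) _)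
  two_edge := fun k hk S T hST => h.exists_two_edge hk hST

end IsWordModel

theorem mainTheorem6 (n : ℕ) :
    (∀ γ : StrictPartition n,
      IsQueerDualEquivalence n (fun S : SignedStandardTableau γ => S.des)
        (fun i S => S.d i)) ∧
    IsQueerDualEquivalence n
      (fun S : (γ : StrictPartition n) × SignedStandardTableau γ => S.2.des)
      (fun i S => ⟨S.1, S.2.d i⟩) := by
  constructor
  · intro γ
    exact IsWordModel.isQueerDualEquivalence (W := SignedStandardTableau.diagWord)
      ⟨SignedStandardTableau.diagWord_injective, fun S => S.diagWord_length,
        fun S => S.signedPath_diagWord, fun S => S.des_eq, fun i S => S.diagWord_d i⟩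
  · refine IsWordModel.isQueerDualEquivalence (W := fun S => S.2.diagWord)
      ⟨?_, fun S => S.2.diagWord_length, fun S => S.2.signedPath_diagWord, fun S => S.2.des_eq,
        fun i S => S.2.diagWord_d i⟩
    rintro ⟨γ, S⟩ ⟨γ', S'⟩ e
    simp only at e
    -- The absolute diagonals determine the shape, so the word remains a faithful encoding when all
    -- shapes are taken together.
    obtain rfl := S.shape_eq_of_perm S' (by rw [e])
    rw [SignedStandardTableau.diagWord_injective e]
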